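/- **Conventions.** C\*-algebras and \*-homomorphisms are unital, $\otimes$ is the minimal tensor product, $X\otimes C(\mathbb T)=C(\mathbb T,X)$, $z\in C(\mathbb T)$ is the identity function, and for subsets $S,T$ of a C\*-algebra $ST$ is the norm closed linear span of $\{st: s\in S,\ t\in T\}$. A *$\mathbb T$-C\*-algebra* is a C\*-algebra $X$ with a coaction, i.e. a \*-homomorphism $\rho^X: X\to X\otimes C(\mathbb T)$ such that $(\rho^X\otimes \mathrm{id})\rho^X=(\mathrm{id}\otimes\Delta_{\mathbb T})\rho^X$, where $\Delta_{\mathbb T}(z)=z\otimes z$, and $\rho^X(X)(1\otimes C(\mathbb T))=X\otimes C(\mathbb T)$; $x\in X$ is homogeneous of degree $k$ if $\rho^X(x)=x\otimes z^k$. A \*-homomorphism $\varphi:X\to Y$ is *equivariant* if $\rho^Y\varphi=(\varphi\otimes\mathrm{id})\rho^X$. Let $\zeta\in\mathbb T$. Let $C(\mathbb T^2_\zeta)$ be the universal C\*-algebra generated by unitaries $U,V$ with $VU=\zeta UV$, and let $\iota_1,\iota_2:C(\mathbb T)\to C(\mathbb T^2_\zeta)$ be given by $\iota_1(z)=U$,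 $\iota_2(z)=V$. For $\mathbb T$-C\*-algebras $X,Y$ let $j_1:X\to X\otimes Y\otimes C(\mathbb T^2_\zeta)$ be $\rho^X$ followed by $x\otimes f\mapsto x\otimes 1\otimes\iota_1(f)$, let $j_2:Y\to X\otimes Y\otimes C(\mathbb T^2_\zeta)$ be $\rho^Y$ followed by $y\otimes f\mapsto 1\otimes y\otimes\iota_2(f)$, and put $X\boxtimes_\zeta Y:=j_1(X)j_2(Y)$, which is a C\*-algebra. It carries the unique coaction for which $j_1$ and $j_2$ are equivariant. For equivariant $\pi_1,\pi_2$, $\pi_1\boxtimes_\zeta\pi_2$ is the \*-homomorphism with $j_1(x)j_2(y)\mapsto j_1(\pi_1(x))j_2(\pi_2(y))$, and $(X\boxtimes_\zeta Y)\boxtimes_\zeta Z$ and $X\boxtimes_\zeta (Y\boxtimes_\zeta Z)$ are identified by the isomorphism that matches the canonical copies of $X$, $Y$ and $Z$. A *braided compact quantum group* (over $\mathbb T$, with parameter $\zeta$) is a triple $(A,\rho,\Delta)$ of a C\*-algebra $A$, a coaction $\rho$ of $C(\mathbb T)$ on $A$ and an equivariant \*-homomorphism $\Delta:A\to A\boxtimes_\zeta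 A$ such that $(\Delta\boxtimes_\zeta\mathrm{id})\Delta=(\mathrm{id}\boxtimes_\zeta\Delta)\Delta$ (coassociativity) and $\Delta(A)j_2(A)=\Delta(A)j_1(A)=A\boxtimes_\zeta A$ (bisimplifiability). **Statement.** Let $n\ge 0$ and let $F=(F_{ij})\in GL(n,\mathbb C)$, with inverse $F^{-1}=(F^{ij})$, be admissible with respect to $\underline d=(d_1,\dots,d_n)$, $\underline d'=(d'_1,\dots,d'_n)\in\mathbb Z^n$ and $d\in\mathbb Z$, i.e. $F_{ij}=0=F^{ji}$ whenever $-d_j+d\ne d'_i$. Let $\zeta\in\mathbb T$. For an $n\times n$ matrix $v$ over a C\*-algebra write $\bar v_\zeta=(\zeta^{d_i(d_j-d_i)}v_{ij}^*)_{i,j}$. Let $A=C(U_\zeta^+(F))$ be the C\*-algebra with generators $u_{ij}$, $1\le i,j\le n$, and the relations that $u=(u_{ij})$ and $F\bar u_\zeta F^{-1}$ are unitary, i.e. the completion of the universal unital \*-algebra with these generators and relations in its largest C\*-seminorm. Then: 1. $u$ and $F\bar u_\zeta F^{-1}$ are unitary in $M_n(A)$, and for every C\*-algebra $B$ and every $v\in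 M_n(B)$ such that $v$ and $F\bar v_\zeta F^{-1}$ are unitary there is a unique \*-homomorphism $\varphi:A\to B$ with $\varphi(u_{ij})=v_{ij}$ for all $i,j$. 2. There is a unique \*-homomorphism $\rho: A\to C(\mathbb T,A)$ with $\rho(u_{ij})(z)=z^{d_j-d_i}u_{ij}$ for all $i,j$ and $z\in\mathbb T$, and $\rho$ is a coaction of $C(\mathbb T)$ on $A$. 3. With respect to $\rho$, there is a unique \*-homomorphism $\Delta:A\to A\boxtimes_\zeta A$ with $\Delta(u_{ij})=\sum_{k=1}^n j_1(u_{ik})j_2(u_{kj})$ for all $i,j$. It is $\mathbb T$-equivariant, coassociative and bisimplifiable. Thus $(A,\rho,\Delta)$ is a braided compact quantum group, the braided free unitary quantum group $U_\zeta^+(F)$. -/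

import Mathlib

open scoped TensorProduct

set_option linter.unusedSectionVars false

noncomputable section

/-- A C*-seminorm on a unital *-algebra. -/
structure CStarSeminorm (A : Type*) [Ring A] [StarRing A] [Algebra ℂ A] extends Seminorm ℂ A where
  mul_le : ∀ x y : A, toFun (x * y) ≤ toFun x * toFun y
  star_mul_self : ∀ x : A, toFun (star x * x) = toFun x * toFun x

namespace CStarSeminorm

section

variable {A : Type*} [Ring A] [StarRing A] [Algebra ℂ A]

instance : CoeFun (CStarSeminorm A) (fun _ => A → ℝ) := ⟨fun p => p.toFun⟩

variable (p : CStarSeminorm A)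

lemma nonneg (x : A) : 0 ≤ p x := apply_nonneg p.toSeminorm x

lemma map_zero : p 0 = 0 := _root_.map_zero p.toSeminorm

lemma add_le (x y : A) : p (x + y) ≤ p x + p y := map_add_le_add p.toSeminorm x y

lemma smul (c : ℂ) (x : A) : p (c • x) = ‖c‖ * p x := map_smul_eq_mul p.toSeminorm c x

lemma map_neg (x : A) : p (-x) = p x := map_neg_eq_map p.toSeminorm x

lemma le_star (x : A) : p x ≤ p (star x) := by
  rcases (p.nonneg x).eq_or_lt with h | h
  · rw [← h]; exact p.nonneg _
  · have h1 := p.star_mul_self x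
    have h2 := p.mul_le (star x) x
    rw [h1] at h2
    exact le_of_mul_le_mul_right h2 h

lemma map_star (x : A) : p (star x) = p x :=
  le_antisymm (by simpa using p.le_star (star x)) (p.le_star x)

lemma one_le : p 1 ≤ 1 := by
  have h := p.star_mul_self 1
  simp only [star_one, mul_one] at h
  nlinarith [p.nonneg 1]

/-- The pointwise supremum of a pointwise bounded family of C*-seminorms. -/
def iSup {ι : Sort*} (q : ι → CStarSeminorm A) (hq : ∀ x, BddAbove (Set.range fun i => q i x)) :
    CStarSeminorm A where
  toFun x := ⨆ i, q i x
  map_zero' := by simp [map_zero]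
  add_le' x y := by
    rcases isEmpty_or_nonempty ι with h | h
    · simp
    · exact ciSup_le fun i => ((q i).add_le x y).trans
        (add_le_add (le_ciSup (hq x) i) (le_ciSup (hq y) i))
  neg' x := by simp [map_neg]
  smul' c x := by
    simp_rw [smul, Real.mul_iSup_of_nonneg (norm_nonneg c)]
  mul_le x y := by
    rcases isEmpty_or_nonempty ι with h | h
    · simp
    · refine ciSup_le fun i => ((q i).mul_le x y).trans ?_
      exact mul_le_mul (le_ciSup (hq x) i) (le_ciSup (hq y) i) ((q i).nonneg y)
        (Real.iSup_nonneg fun j => (q j).nonneg x)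
  star_mul_self x := by
    rcases isEmpty_or_nonempty ι with h | h
    · simp
    · have h0 : 0 ≤ ⨆ i, q i x := Real.iSup_nonneg fun j => (q j).nonneg x
      apply le_antisymm
      · refine ciSup_le fun i => ?_
        rw [(q i).star_mul_self x]
        exact mul_self_le_mul_self ((q i).nonneg x) (le_ciSup (hq x) i)
      · have hs : 0 ≤ ⨆ i, q i (star x * x) := Real.iSup_nonneg fun j => (q j).nonneg _
        rw [← sq, ← Real.le_sqrt h0 hs]
        refine ciSup_le fun i => Real.le_sqrt_of_sq_le ?_
        rw [sq, ← (q i).star_mul_self x]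
        exact le_ciSup (hq (star x * x)) i

/-- The *-algebra `A`, regarded as a seminormed algebra by means of `p`. -/
def Pre (_ : CStarSeminorm A) : Type _ := A

instance : Ring p.Pre := inferInstanceAs (Ring A)
instance : StarRing p.Pre := inferInstanceAs (StarRing A)
instance : Algebra ℂ p.Pre := inferInstanceAs (Algebra ℂ A)

instance : SeminormedRing p.Pre :=
  { (inferInstance : Ring p.Pre),
    AddGroupSeminorm.toSeminormedAddCommGroup p.toSeminorm.toAddGroupSeminorm with
    norm_mul_le := p.mul_le }

lemma pre_norm (x : p.Pre) : ‖x‖ = p x := rfl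

instance : NormedAlgebra ℂ p.Pre :=
  { (inferInstance : Algebra ℂ p.Pre) with
    norm_smul_le := fun c x => (p.smul c x).le }

instance : NormedStarGroup p.Pre := ⟨fun x => (p.map_star x).le⟩

/-- The Hausdorff completion of `A` with respect to a C*-seminorm. -/
def Completion : Type _ := UniformSpace.Completion p.Pre

namespace Completion

instance : NormedRing p.Completion := inferInstanceAs (NormedRing (UniformSpace.Completion p.Pre))

instance : CompleteSpace p.Completion :=
  inferInstanceAs (CompleteSpace (UniformSpace.Completion p.Pre))

instance : Algebra ℂ p.Completion :=
  inferInstanceAs (Algebra ℂ (UniformSpace.Completion p.Pre))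

/-- The canonical map into the completion. -/
def mk (x : A) : p.Completion := ((show p.Pre from x : p.Pre) : UniformSpace.Completion p.Pre)

lemma norm_mk (x : A) : ‖mk p x‖ = p x := UniformSpace.Completion.norm_coe (E := p.Pre) x

lemma denseRange_mk : DenseRange (mk p) := UniformSpace.Completion.denseRange_coe (α := p.Pre)

lemma mk_add (x y : A) : mk p (x + y) = mk p x + mk p y :=
  UniformSpace.Completion.coe_add (α := p.Pre) x y

lemma mk_mul (x y : A) : mk p (x * y) = mk p x * mk p y :=
  UniformSpace.Completion.coe_mul (α := p.Pre) x y

lemma mk_one : mk p 1 = 1 := rfl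

lemma mk_zero : mk p 0 = 0 := rfl

lemma mk_smul (c : ℂ) (x : A) : mk p (c • x) = c • mk p x :=
  UniformSpace.Completion.coe_smul (M := ℂ) (X := p.Pre) c x

instance : NormedAlgebra ℂ p.Completion :=
  { (inferInstance : Algebra ℂ p.Completion) with
    norm_smul_le := fun c x => by
      have h := norm_smul_le (α := ℂ) (β := UniformSpace.Completion p.Pre) c x
      exact h }

/-- The extension of the involution to the completion. -/
instance : Star p.Completion :=
  ⟨fun x => UniformSpace.Completion.map (star : p.Pre → p.Pre) x⟩

lemma uniformContinuous_pre_star : UniformContinuous (star : p.Pre → p.Pre) :=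
  star_isometry.uniformContinuous

lemma continuous_star' : Continuous (star : p.Completion → p.Completion) :=
  UniformSpace.Completion.continuous_map

lemma mk_star (x : A) : mk p (star x) = star (mk p x) :=
  (UniformSpace.Completion.map_coe (uniformContinuous_pre_star p) x).symm

lemma induction {P : p.Completion → Prop} (x : p.Completion) (hP : IsClosed {x | P x})
    (h : ∀ a : A, P (mk p a)) : P x :=
  UniformSpace.Completion.induction_on (α := p.Pre) x hP h

lemma induction₂ {P : p.Completion → p.Completion → Prop} (x y : p.Completion)
    (hP : IsClosed {x : p.Completion × p.Completion | P x.1 x.2})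
    (h : ∀ a b : A, P (mk p a) (mk p b)) : P x y :=
  UniformSpace.Completion.induction_on₂ (α := p.Pre) (β := p.Pre) x y hP h

instance : StarRing p.Completion where
  star_involutive x := by
    induction x using induction with
    | hP => exact isClosed_eq ((continuous_star' p).comp (continuous_star' p)) continuous_id
    | h a => rw [← mk_star, ← mk_star, star_star]
  star_mul x y := by
    induction x, y using induction₂ with
    | hP =>
      exact isClosed_eq ((continuous_star' p).comp (continuous_fst.mul continuous_snd))
        (((continuous_star' p).comp continuous_snd).mul ((continuous_star' p).comp continuous_fst))
    | h a b => simp only [← mk_star, ← mk_mul, star_mul]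
  star_add x y := by
    induction x, y using induction₂ with
    | hP =>
      exact isClosed_eq ((continuous_star' p).comp (continuous_fst.add continuous_snd))
        (((continuous_star' p).comp continuous_fst).add ((continuous_star' p).comp continuous_snd))
    | h a b => simp only [← mk_star, ← mk_add, star_add]

instance : CStarRing p.Completion where
  norm_mul_self_le x := by
    induction x using induction with
    | hP =>
      exact isClosed_le (continuous_norm.mul continuous_norm)
        (continuous_norm.comp ((continuous_star' p).mul continuous_id))
    | h a => rw [← mk_star, ← mk_mul, norm_mk, norm_mk, p.star_mul_self]

instance [StarModule ℂ A] : StarModule ℂ p.Completion where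
  star_smul c x := by
    induction x using induction with
    | hP =>
      exact isClosed_eq ((continuous_star' p).comp (continuous_const_smul c))
        ((continuous_star' p).const_smul (star c))
    | h a => simp only [← mk_star, ← mk_smul, star_smul]

instance [StarModule ℂ A] : CStarAlgebra p.Completion where

/-- The canonical map into the completion, as a *-homomorphism. -/
def ofHom [StarModule ℂ A] : A →⋆ₐ[ℂ] p.Completion where
  toFun := mk p
  map_one' := mk_one p
  map_mul' := mk_mul p
  map_zero' := mk_zero p
  map_add' := mk_add p
  commutes' c := by
    rw [Algebra.algebraMap_eq_smul_one, Algebra.algebraMap_eq_smul_one, mk_smul, mk_one]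
  map_star' := mk_star p

end Completion
end
end CStarSeminorm

/-- The free unital *-algebra over `ℂ` on a set `X` of generators: the free algebra on generators
`x` and `x*`, `x ∈ X`. -/
def FreeStarAlgebra (X : Type*) : Type _ := FreeAlgebra ℂ (X ⊕ X)

namespace FreeStarAlgebra

variable {X : Type*}

instance : Ring (FreeStarAlgebra X) := inferInstanceAs (Ring (FreeAlgebra ℂ (X ⊕ X)))
instance : Algebra ℂ (FreeStarAlgebra X) := inferInstanceAs (Algebra ℂ (FreeAlgebra ℂ (X ⊕ X)))

/-- The formal generators: `of (inl x)` is `x` and `of (inr x)` is `x*`. -/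
def of (s : X ⊕ X) : FreeStarAlgebra X := FreeAlgebra.ι ℂ s

/-- The generators. -/
def gen (x : X) : FreeStarAlgebra X := of (Sum.inl x)

lemma induction_of {P : FreeStarAlgebra X → Prop}
    (hc : ∀ c : ℂ, P (algebraMap ℂ _ c)) (hg : ∀ s, P (of s))
    (hm : ∀ a b, P a → P b → P (a * b)) (ha : ∀ a b, P a → P b → P (a + b))
    (a : FreeStarAlgebra X) : P a :=
  FreeAlgebra.induction ℂ (X ⊕ X) (motive := P) hc hg hm ha a

/-- The opposite of the free *-algebra with the conjugate scalar multiplication. -/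
def ConjOp (X : Type*) : Type _ := (FreeStarAlgebra X)ᵐᵒᵖ

instance : Ring (ConjOp X) := inferInstanceAs (Ring (FreeStarAlgebra X)ᵐᵒᵖ)

instance : Algebra ℂ (ConjOp X) :=
  RingHom.toAlgebra' ((algebraMap ℂ (FreeStarAlgebra X)ᵐᵒᵖ).comp (starRingEnd ℂ))
    (fun c x => Algebra.commutes (A := (FreeStarAlgebra X)ᵐᵒᵖ) (starRingEnd ℂ c) x)

/-- The involution as an algebra homomorphism into `ConjOp X`: it interchanges the generators
`x` and `x*`. -/
def starHom : FreeStarAlgebra X →ₐ[ℂ] ConjOp X :=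
  FreeAlgebra.lift ℂ (A := ConjOp X) fun s => MulOpposite.op (of s.swap)

/-- The conjugate linear, antimultiplicative involution that interchanges `x` and `x*`. -/
instance : Star (FreeStarAlgebra X) := ⟨fun a => MulOpposite.unop (starHom a)⟩

lemma star_def (a : FreeStarAlgebra X) : star a = MulOpposite.unop (starHom a) := rfl

lemma star_mul' (a b : FreeStarAlgebra X) : star (a * b) = star b * star a := by
  simp only [star_def, map_mul]; rfl

lemma star_add' (a b : FreeStarAlgebra X) : star (a + b) = star a + star b := by
  simp only [star_def, map_add]; rfl

lemma star_algebraMap (c : ℂ) :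
    star (algebraMap ℂ (FreeStarAlgebra X) c) = algebraMap ℂ (FreeStarAlgebra X) (star c) := by
  simp only [star_def, AlgHom.commutes]; rfl

lemma star_of (s : X ⊕ X) : star (of s) = of s.swap :=
  congrArg MulOpposite.unop (FreeAlgebra.lift_ι_apply (R := ℂ) (A := ConjOp X)
    (fun t : X ⊕ X => MulOpposite.op (of t.swap)) s)

lemma star_gen (x : X) : star (gen x) = of (Sum.inr x) := star_of _

lemma induction {P : FreeStarAlgebra X → Prop}
    (hc : ∀ c : ℂ, P (algebraMap ℂ _ c)) (hg : ∀ x, P (gen x)) (hs : ∀ x, P (star (gen x)))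
    (hm : ∀ a b, P a → P b → P (a * b)) (ha : ∀ a b, P a → P b → P (a + b))
    (a : FreeStarAlgebra X) : P a := by
  refine induction_of hc ?_ hm ha a
  rintro (x | x)
  · exact hg x
  · exact star_gen x ▸ hs x

instance : StarRing (FreeStarAlgebra X) where
  star_involutive a := by
    induction a using induction_of with
    | hc c => rw [star_algebraMap, star_algebraMap, star_star]
    | hg s => rw [star_of, star_of, Sum.swap_swap]
    | hm a b h1 h2 => rw [star_mul', star_mul', h1, h2]
    | ha a b h1 h2 => rw [star_add', star_add', h1, h2]
  star_mul := star_mul'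
  star_add := star_add'

instance : StarModule ℂ (FreeStarAlgebra X) where
  star_smul c a := by
    rw [Algebra.smul_def, star_mul, star_algebraMap, Algebra.smul_def, ← Algebra.commutes]

end FreeStarAlgebra

/-- Generators and relations (each `r ∈ rels` stands for the relation `r = 0`) for a unital
C*-algebra, such that the C*-seminorms which vanish on the relations are bounded on every generator.
-/
structure CStarPresentation (X : Type*) where
  rels : Set (FreeStarAlgebra X)
  bounded : ∀ x : X, ∃ C : ℝ, ∀ p : CStarSeminorm (FreeStarAlgebra X),
    (∀ r ∈ rels, p r = 0) → p (FreeStarAlgebra.gen x) ≤ C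

namespace CStarPresentation

variable {X : Type*} (P : CStarPresentation X)

/-- The C*-seminorms that vanish on the relations, i.e. the C*-seminorms on the universal
unital *-algebra with the given generators and relations. -/
def Admits : Type _ := {p : CStarSeminorm (FreeStarAlgebra X) // ∀ r ∈ P.rels, p r = 0}

lemma bounded' (a : FreeStarAlgebra X) : BddAbove (Set.range fun p : P.Admits => p.1 a) := by
  suffices h : ∃ C : ℝ, ∀ p : P.Admits, p.1 a ≤ C by
    obtain ⟨C, hC⟩ := h
    exact ⟨C, by rintro _ ⟨p, rfl⟩; exact hC p⟩
  induction a using FreeStarAlgebra.induction with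
  | hc c =>
    refine ⟨‖c‖, fun p => ?_⟩
    rw [Algebra.algebraMap_eq_smul_one, p.1.smul]
    exact mul_le_of_le_one_right (norm_nonneg c) p.1.one_le
  | hg x =>
    obtain ⟨C, hC⟩ := P.bounded x
    exact ⟨C, fun p => hC p.1 p.2⟩
  | hs x =>
    obtain ⟨C, hC⟩ := P.bounded x
    exact ⟨C, fun p => (p.1.map_star _).trans_le (hC p.1 p.2)⟩
  | hm a b ha hb =>
    obtain ⟨C, hC⟩ := ha
    obtain ⟨D, hD⟩ := hb
    refine ⟨C * D, fun p => (p.1.mul_le a b).trans ?_⟩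
    exact mul_le_mul (hC p) (hD p) (p.1.nonneg b) ((p.1.nonneg a).trans (hC p))
  | ha a b ha hb =>
    obtain ⟨C, hC⟩ := ha
    obtain ⟨D, hD⟩ := hb
    exact ⟨C + D, fun p => (p.1.add_le a b).trans (add_le_add (hC p) (hD p))⟩

/-- The largest C*-seminorm that vanishes on the relations. -/
def maxSeminorm : CStarSeminorm (FreeStarAlgebra X) :=
  CStarSeminorm.iSup (fun p : P.Admits => p.1) P.bounded'

/-- The universal unital C*-algebra with the given generators and relations: the completion in the
largest C*-seminorm. -/
def Alg : Type _ := P.maxSeminorm.Completion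

instance : CStarAlgebra P.Alg := inferInstanceAs (CStarAlgebra P.maxSeminorm.Completion)

/-- The canonical homomorphism from the free *-algebra. -/
def toAlg : FreeStarAlgebra X →⋆ₐ[ℂ] P.Alg := CStarSeminorm.Completion.ofHom P.maxSeminorm

/-- The generators of the universal C*-algebra. -/
def gen (x : X) : P.Alg := P.toAlg (FreeStarAlgebra.gen x)

lemma toAlg_rel {r : FreeStarAlgebra X} (hr : r ∈ P.rels) : P.toAlg r = 0 := by
  rw [← norm_eq_zero]
  refine (CStarSeminorm.Completion.norm_mk P.maxSeminorm r).trans ?_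
  exact (iSup_congr fun p : P.Admits => p.2 r hr).trans (by simp)

end CStarPresentation

/-- A unital *-representation of a C*-algebra on a Hilbert space. -/
structure HilbertRep.{w, u} (A : Type u) [CStarAlgebra A] where
  H : Type w
  [instNACG : NormedAddCommGroup H]
  [instIPS : InnerProductSpace ℂ H]
  [instComplete : CompleteSpace H]
  hom : A →⋆ₐ[ℂ] (H →L[ℂ] H)

attribute [instance] HilbertRep.instNACG HilbertRep.instIPS HilbertRep.instComplete

/-- The tensor product of two Hilbert spaces. -/
def HilbertTensor (E F : Type*) [NormedAddCommGroup E] [InnerProductSpace ℂ E]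
    [NormedAddCommGroup F] [InnerProductSpace ℂ F] : Type _ :=
  UniformSpace.Completion (E ⊗[ℂ] F)

namespace HilbertTensor

variable {E F : Type*} [NormedAddCommGroup E] [InnerProductSpace ℂ E]
    [NormedAddCommGroup F] [InnerProductSpace ℂ F]

instance : NormedAddCommGroup (HilbertTensor E F) :=
  inferInstanceAs (NormedAddCommGroup (UniformSpace.Completion (E ⊗[ℂ] F)))

instance : InnerProductSpace ℂ (HilbertTensor E F) :=
  inferInstanceAs (InnerProductSpace ℂ (UniformSpace.Completion (E ⊗[ℂ] F)))

instance : CompleteSpace (HilbertTensor E F) :=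
  inferInstanceAs (CompleteSpace (UniformSpace.Completion (E ⊗[ℂ] F)))

/-- The canonical map from the algebraic tensor product. -/
def mk (x : E ⊗[ℂ] F) : HilbertTensor E F := (x : UniformSpace.Completion (E ⊗[ℂ] F))

lemma mk_zero : mk (0 : E ⊗[ℂ] F) = 0 := UniformSpace.Completion.coe_zero

lemma mk_add (x y : E ⊗[ℂ] F) : mk (x + y) = mk x + mk y := UniformSpace.Completion.coe_add x y

lemma mk_smul (c : ℂ) (x : E ⊗[ℂ] F) : mk (c • x) = c • mk x :=
  UniformSpace.Completion.coe_smul c x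

lemma inner_mk (x y : E ⊗[ℂ] F) : inner ℂ (mk x) (mk y) = inner ℂ x y :=
  UniformSpace.Completion.inner_coe x y

lemma denseRange_mk : DenseRange (mk : E ⊗[ℂ] F → HilbertTensor E F) :=
  UniformSpace.Completion.denseRange_coe

/-- The operator `S ⊗ T`. -/
def map (S : E →L[ℂ] E) (T : F →L[ℂ] F) : HilbertTensor E F →L[ℂ] HilbertTensor E F :=
  (TensorProduct.mapL S T).completion

lemma map_mk (S : E →L[ℂ] E) (T : F →L[ℂ] F) (x : E ⊗[ℂ] F) :
    map S T (mk x) = mk (TensorProduct.mapL S T x) :=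
  ContinuousLinearMap.completion_apply_coe (TensorProduct.mapL S T) x

lemma map_mk_tmul (S : E →L[ℂ] E) (T : F →L[ℂ] F) (x : E) (y : F) :
    map S T (mk (x ⊗ₜ y)) = mk (S x ⊗ₜ T y) := by
  rw [map_mk, TensorProduct.mapL_tmul]

lemma ext {P Q : HilbertTensor E F →L[ℂ] HilbertTensor E F}
    (h : ∀ x y, P (mk (x ⊗ₜ y)) = Q (mk (x ⊗ₜ y))) : P = Q := by
  refine DFunLike.coe_injective (denseRange_mk.equalizer P.continuous Q.continuous ?_)
  funext t
  induction t with
  | zero => simp [mk_zero]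
  | tmul x y => exact h x y
  | add x y hx hy =>
    simp only [Function.comp_apply] at hx hy
    simp only [Function.comp_apply, mk_add, map_add, hx, hy]

lemma map_add_left (S S' : E →L[ℂ] E) (T : F →L[ℂ] F) : map (S + S') T = map S T + map S' T :=
  ext fun x y => by
    simp only [map_mk_tmul, add_apply, TensorProduct.add_tmul, mk_add]

lemma map_add_right (S : E →L[ℂ] E) (T T' : F →L[ℂ] F) : map S (T + T') = map S T + map S T' :=
  ext fun x y => by
    simp only [map_mk_tmul, add_apply, TensorProduct.tmul_add, mk_add]

lemma map_smul_left (c : ℂ) (S : E →L[ℂ] E) (T : F →L[ℂ] F) : map (c • S) T = c • map S T :=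
  ext fun x y => by
    simp only [map_mk_tmul, smul_apply, ← TensorProduct.smul_tmul', mk_smul]

lemma map_smul_right (c : ℂ) (S : E →L[ℂ] E) (T : F →L[ℂ] F) : map S (c • T) = c • map S T :=
  ext fun x y => by
    simp only [map_mk_tmul, smul_apply, TensorProduct.tmul_smul, mk_smul]

lemma map_mul (S S' : E →L[ℂ] E) (T T' : F →L[ℂ] F) :
    map (S * S') (T * T') = map S T * map S' T' :=
  ext fun x y => by
    simp only [map_mk_tmul, mul_apply_eq_comp]

lemma map_one : map (1 : E →L[ℂ] E) (1 : F →L[ℂ] F) = 1 :=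
  ext fun x y => by
    simp only [map_mk_tmul, one_apply_eq_self]

lemma map_star [CompleteSpace E] [CompleteSpace F] (S : E →L[ℂ] E) (T : F →L[ℂ] F) :
    map (star S) (star T) = star (map S T) := by
  refine (ContinuousLinearMap.eq_adjoint_iff _ _).mpr fun x y => ?_
  induction x using UniformSpace.Completion.induction_on (α := E ⊗[ℂ] F) with
  | hp =>
    exact isClosed_eq ((map (star S) (star T)).continuous.inner continuous_const)
      (continuous_id.inner continuous_const)
  | ih x =>
    induction y using UniformSpace.Completion.induction_on (α := E ⊗[ℂ] F) with
    | hp =>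
      exact isClosed_eq (continuous_const.inner continuous_id)
        (continuous_const.inner (map S T).continuous)
    | ih y =>
      change inner ℂ (map (star S) (star T) (mk x)) (mk y) = inner ℂ (mk x) (map S T (mk y))
      rw [map_mk, map_mk, inner_mk, inner_mk]
      induction x with
      | zero => simp
      | add x x' hx hx' => rw [_root_.map_add, inner_add_left, inner_add_left, hx, hx']
      | tmul h k =>
        induction y with
        | zero => simp
        | add y y' hy hy' => rw [_root_.map_add, inner_add_right, inner_add_right, hy, hy']
        | tmul h' k' =>
          rw [TensorProduct.mapL_tmul, TensorProduct.mapL_tmul, TensorProduct.inner_tmul,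
            TensorProduct.inner_tmul, ContinuousLinearMap.star_eq_adjoint,
            ContinuousLinearMap.star_eq_adjoint, ContinuousLinearMap.adjoint_inner_left,
            ContinuousLinearMap.adjoint_inner_left]

end HilbertTensor

namespace MinTensor

universe u v

variable {A : Type u} {B : Type v} [CStarAlgebra A] [CStarAlgebra B]

/-- The tensor product `π ⊗ σ` of two representations, on the algebraic tensor product. -/
def tensorRep (π : HilbertRep A) (σ : HilbertRep B) :
    A ⊗[ℂ] B →ₐ[ℂ] (HilbertTensor π.H σ.H →L[ℂ] HilbertTensor π.H σ.H) :=
  Algebra.TensorProduct.algHomOfLinearMapTensorProduct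
    (TensorProduct.lift (LinearMap.mk₂ ℂ (fun a b => HilbertTensor.map (π.hom a) (σ.hom b))
      (fun a a' b => by rw [map_add, HilbertTensor.map_add_left])
      (fun c a b => by rw [map_smul, HilbertTensor.map_smul_left])
      (fun a b b' => by rw [map_add, HilbertTensor.map_add_right])
      (fun c a b => by rw [map_smul, HilbertTensor.map_smul_right])))
    (fun a a' b b' => by
      simp only [TensorProduct.lift.tmul, LinearMap.mk₂_apply]
      rw [map_mul, map_mul, HilbertTensor.map_mul])
    (by
      simp only [TensorProduct.lift.tmul, LinearMap.mk₂_apply, map_one]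
      exact HilbertTensor.map_one)

lemma tensorRep_tmul (π : HilbertRep A) (σ : HilbertRep B) (a : A) (b : B) :
    tensorRep π σ (a ⊗ₜ b) = HilbertTensor.map (π.hom a) (σ.hom b) := rfl

lemma tensorRep_star (π : HilbertRep A) (σ : HilbertRep B) (t : A ⊗[ℂ] B) :
    tensorRep π σ (star t) = star (tensorRep π σ t) := by
  induction t with
  | zero => simp
  | add t s ht hs => rw [star_add, map_add, map_add, star_add, ht, hs]
  | tmul a b =>
    rw [TensorProduct.star_tmul, tensorRep_tmul, tensorRep_tmul, map_star, map_star,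
      HilbertTensor.map_star]

/-- The C*-seminorm `t ↦ ‖(π ⊗ σ)(t)‖`. -/
def repSeminorm (π : HilbertRep A) (σ : HilbertRep B) : CStarSeminorm (A ⊗[ℂ] B) where
  toFun t := ‖tensorRep π σ t‖
  map_zero' := by rw [map_zero, norm_zero]
  add_le' x y := by rw [map_add]; exact norm_add_le _ _
  neg' x := by rw [map_neg, norm_neg]
  smul' c x := by rw [map_smul, norm_smul]
  mul_le x y := by rw [map_mul]; exact norm_mul_le _ _
  star_mul_self x := by
    rw [map_mul, tensorRep_star]; exact CStarRing.norm_star_mul_self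

/-- The representation `a ↦ π(a) ⊗ 1`. -/
def leftRep (π : HilbertRep A) (σ : HilbertRep B) :
    A →⋆ₐ[ℂ] (HilbertTensor π.H σ.H →L[ℂ] HilbertTensor π.H σ.H) :=
  { (tensorRep π σ).comp Algebra.TensorProduct.includeLeft with
    map_star' := fun a => by
      change tensorRep π σ (star a ⊗ₜ 1) = star (tensorRep π σ (a ⊗ₜ 1))
      rw [← tensorRep_star, TensorProduct.star_tmul, star_one] }

/-- The representation `b ↦ 1 ⊗ σ(b)`. -/
def rightRep (π : HilbertRep A) (σ : HilbertRep B) :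
    B →⋆ₐ[ℂ] (HilbertTensor π.H σ.H →L[ℂ] HilbertTensor π.H σ.H) :=
  { (tensorRep π σ).comp Algebra.TensorProduct.includeRight with
    map_star' := fun a => by
      change tensorRep π σ (1 ⊗ₜ star a) = star (tensorRep π σ (1 ⊗ₜ a))
      rw [← tensorRep_star, TensorProduct.star_tmul, star_one] }

lemma repSeminorm_tmul_le (π : HilbertRep A) (σ : HilbertRep B) (a : A) (b : B) :
    repSeminorm π σ (a ⊗ₜ b) ≤ ‖a‖ * ‖b‖ := by
  have h : tensorRep π σ (a ⊗ₜ b) = leftRep π σ a * rightRep π σ b := by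
    change _ = tensorRep π σ (a ⊗ₜ 1) * tensorRep π σ (1 ⊗ₜ b)
    rw [← map_mul, Algebra.TensorProduct.tmul_mul_tmul, mul_one, one_mul]
  change ‖tensorRep π σ (a ⊗ₜ b)‖ ≤ _
  rw [h]
  exact (norm_mul_le _ _).trans (mul_le_mul (NonUnitalStarAlgHom.norm_apply_le _ a)
      (NonUnitalStarAlgHom.norm_apply_le _ b) (norm_nonneg _) (norm_nonneg _))

lemma repSeminorm_bddAbove (t : A ⊗[ℂ] B) : BddAbove (Set.range
    fun i : HilbertRep.{u, u} A × HilbertRep.{v, v} B => repSeminorm i.1 i.2 t) := by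
  suffices h : ∃ C : ℝ, ∀ i : HilbertRep.{u, u} A × HilbertRep.{v, v} B,
      repSeminorm i.1 i.2 t ≤ C by
    obtain ⟨C, hC⟩ := h
    exact ⟨C, by rintro _ ⟨p, rfl⟩; exact hC p⟩
  induction t with
  | zero => exact ⟨0, fun i => (CStarSeminorm.map_zero _).le⟩
  | tmul a b => exact ⟨‖a‖ * ‖b‖, fun i => repSeminorm_tmul_le _ _ a b⟩
  | add x y hx hy =>
    obtain ⟨C, hC⟩ := hx
    obtain ⟨D, hD⟩ := hy
    exact ⟨C + D, fun i => (CStarSeminorm.add_le _ x y).trans (add_le_add (hC i) (hD i))⟩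

variable (A B) in
/-- The minimal (spatial) C*-norm on the algebraic tensor product: the supremum of
`‖(π ⊗ σ)(t)‖` over all representations `π` of `A` and `σ` of `B` on Hilbert spaces. -/
def minSeminorm : CStarSeminorm (A ⊗[ℂ] B) :=
  CStarSeminorm.iSup (fun i : HilbertRep.{u, u} A × HilbertRep.{v, v} B => repSeminorm i.1 i.2)
    repSeminorm_bddAbove

end MinTensor

/-- The minimal tensor product of two unital C*-algebras. -/
def MinTensor (A B : Type*) [CStarAlgebra A] [CStarAlgebra B] : Type _ :=
  (MinTensor.minSeminorm A B).Completion

namespace MinTensor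

variable (A B : Type*) [CStarAlgebra A] [CStarAlgebra B]

instance : CStarAlgebra (MinTensor A B) :=
  inferInstanceAs (CStarAlgebra (MinTensor.minSeminorm A B).Completion)

/-- The canonical homomorphism from the algebraic tensor product. -/
def ofTensor : A ⊗[ℂ] B →⋆ₐ[ℂ] MinTensor A B :=
  CStarSeminorm.Completion.ofHom (minSeminorm A B)

/-- The embedding `a ↦ a ⊗ 1`. -/
def inl : A →⋆ₐ[ℂ] MinTensor A B :=
  (ofTensor A B).comp
    { (Algebra.TensorProduct.includeLeft : A →ₐ[ℂ] A ⊗[ℂ] B) with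
      map_star' := fun a => by
        change star a ⊗ₜ[ℂ] (1 : B) = star (a ⊗ₜ[ℂ] (1 : B))
        rw [TensorProduct.star_tmul, star_one] }

/-- The embedding `b ↦ 1 ⊗ b`. -/
def inr : B →⋆ₐ[ℂ] MinTensor A B :=
  (ofTensor A B).comp
    { (Algebra.TensorProduct.includeRight : B →ₐ[ℂ] A ⊗[ℂ] B) with
      map_star' := fun b => by
        change (1 : A) ⊗ₜ[ℂ] star b = star ((1 : A) ⊗ₜ[ℂ] b)
        rw [TensorProduct.star_tmul, star_one] }

lemma inl_mul_inr (a : A) (b : B) : inl A B a * inr A B b = ofTensor A B (a ⊗ₜ b) := by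
  change ofTensor A B (a ⊗ₜ 1) * ofTensor A B (1 ⊗ₜ b) = _
  rw [← map_mul, Algebra.TensorProduct.tmul_mul_tmul, mul_one, one_mul]

lemma commute_inl_inr (a : A) (b : B) : Commute (inl A B a) (inr A B b) := by
  rw [commute_iff_eq, inl_mul_inr]
  change _ = ofTensor A B (1 ⊗ₜ b) * ofTensor A B (a ⊗ₜ 1)
  rw [← map_mul, Algebra.TensorProduct.tmul_mul_tmul, mul_one, one_mul]

end MinTensor

namespace CFun

variable (K : Type*) [TopologicalSpace K] [CompactSpace K] (X : Type*) [CStarAlgebra X]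

/-- The embedding `x ↦ x ⊗ 1` of `X` into `C(K, X) = X ⊗ C(K)`. -/
def constHom : X →⋆ₐ[ℂ] C(K, X) where
  toFun x := ContinuousMap.const K x
  map_one' := rfl
  map_mul' _ _ := rfl
  map_zero' := rfl
  map_add' _ _ := rfl
  commutes' _ := rfl
  map_star' _ := rfl

/-- The embedding `f ↦ 1 ⊗ f` of `C(K)` into `C(K, X) = X ⊗ C(K)`. -/
def scalarHom : C(K, ℂ) →⋆ₐ[ℂ] C(K, X) where
  toFun f := ⟨fun z => algebraMap ℂ X (f z), by fun_prop⟩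
  map_one' := by ext; simp
  map_mul' _ _ := by ext; simp
  map_zero' := by ext; simp
  map_add' _ _ := by ext; simp
  commutes' _ := by ext; rfl
  map_star' _ := by ext; exact algebraMap_star_comm _

variable {K X}

lemma constHom_apply (x : X) (z : K) : constHom K X x z = x := rfl

lemma scalarHom_apply (f : C(K, ℂ)) (z : K) : scalarHom K X f z = algebraMap ℂ X (f z) := rfl

lemma commute_constHom_scalarHom (x : X) (f : C(K, ℂ)) :
    Commute (constHom K X x) (scalarHom K X f) := by
  ext z; exact (Algebra.commutes (f z) x).symm

variable (K X) in
/-- The canonical homomorphism from the algebraic tensor product of `X` and `C(K)` to `C(K, X)`. -/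
def tensorHom : X ⊗[ℂ] C(K, ℂ) →ₐ[ℂ] C(K, X) :=
  Algebra.TensorProduct.lift (constHom K X).toAlgHom (scalarHom K X).toAlgHom
    commute_constHom_scalarHom

lemma tensorHom_tmul (x : X) (f : C(K, ℂ)) (z : K) : tensorHom K X (x ⊗ₜ f) z = f z • x := by
  change constHom K X x z * scalarHom K X f z = _
  rw [constHom_apply, scalarHom_apply, ← Algebra.commutes, Algebra.smul_def]

lemma exists_partition [T2Space K] {E : Type*} [PseudoMetricSpace E] (F : C(K, E)) {ε : ℝ}
    (hε : 0 < ε) : ∃ (t : Finset K) (g : t → C(K, ℝ)), (∀ m z, 0 ≤ g m z) ∧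
      (∀ z, ∑ m, g m z = 1) ∧ ∀ m z, g m z ≠ 0 → dist (F z) (F m) ≤ ε := by
  obtain ⟨t, ht⟩ := isCompact_univ.elim_finite_subcover
    (fun m : K => {z | dist (F z) (F m) < ε})
    (fun m => isOpen_lt (by fun_prop) continuous_const)
    (fun z _ => Set.mem_iUnion.2 ⟨z, by simpa using hε⟩)
  obtain ⟨f, hf⟩ := PartitionOfUnity.exists_isSubordinate (s := (Set.univ : Set K)) isClosed_univ
    (fun m : t => {z | dist (F z) (F m) < ε})
    (fun m => isOpen_lt (by fun_prop) continuous_const)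
    (fun z hz => by
      obtain ⟨m, hm, hz⟩ := Set.mem_iUnion₂.1 (ht hz)
      exact Set.mem_iUnion.2 ⟨⟨m, hm⟩, hz⟩)
  refine ⟨t, fun m => f m, fun m z => f.nonneg m z, fun z => ?_, fun m z hz => ?_⟩
  · rw [← finsum_eq_sum_of_fintype]; exact f.sum_eq_one (Set.mem_univ z)
  · exact (hf m (subset_tsupport _ hz)).le

/-- A real valued function, regarded as a complex valued one. -/
def toComplex (g : C(K, ℝ)) : C(K, ℂ) := ⟨fun z => (g z : ℂ), by fun_prop⟩

lemma norm_sub_sum_le {E : Type*} [NormedAddCommGroup E] [NormedSpace ℂ E] (F : K → E)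
    {t : Finset K} (g : t → C(K, ℝ)) (h0 : ∀ m z, 0 ≤ g m z) (h1 : ∀ z, ∑ m, g m z = 1) {ε : ℝ}
    (hg : ∀ m z, g m z ≠ 0 → ‖F z - F m‖ ≤ ε) (z : K) :
    ‖F z - ∑ m : t, toComplex (g m) z • F m‖ ≤ ε := by
  have h2 : F z = ∑ m, toComplex (g m) z • F z := by
    rw [← Finset.sum_smul]
    have : ∑ m, toComplex (g m) z = 1 := by
      have := congrArg (fun r : ℝ => (r : ℂ)) (h1 z)
      simpa [toComplex] using this
    rw [this, one_smul]
  nth_rewrite 1 [h2]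
  rw [← Finset.sum_sub_distrib]
  calc ‖∑ m, (toComplex (g m) z • F z - toComplex (g m) z • F m)‖
      ≤ ∑ m, ‖toComplex (g m) z • F z - toComplex (g m) z • F m‖ := norm_sum_le _ _
    _ ≤ ∑ m, g m z * ε := by
        refine Finset.sum_le_sum fun m _ => ?_
        rw [← smul_sub, norm_smul]
        have h3 : ‖toComplex (g m) z‖ = g m z := by
          simp [toComplex, abs_of_nonneg (h0 m z)]
        rw [h3]
        by_cases hz : g m z = 0
        · rw [hz, zero_mul, zero_mul]
        · exact mul_le_mul_of_nonneg_left (hg m z hz) (h0 m z)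
    _ = ε := by rw [← Finset.sum_mul, h1, one_mul]

lemma denseRange_tensorHom [T2Space K] : DenseRange (tensorHom K X) := by
  intro F
  rw [Metric.mem_closure_range_iff]
  intro ε hε
  obtain ⟨t, g, h0, h1, hg⟩ := exists_partition F (half_pos hε)
  refine ⟨∑ m : t, F m ⊗ₜ toComplex (g m), ?_⟩
  rw [dist_eq_norm]
  refine lt_of_le_of_lt ?_ (half_lt_self hε)
  rw [ContinuousMap.norm_le _ (half_pos hε).le]
  intro z
  have := norm_sub_sum_le F g h0 h1 (fun m z hz => by rw [← dist_eq_norm]; exact hg m z hz) z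
  rw [map_sum, ContinuousMap.sub_apply, ContinuousMap.sum_apply]
  simpa only [tensorHom_tmul] using this

section lift

variable {M : Type*} [CStarAlgebra M] (i : X →⋆ₐ[ℂ] M) (σ : C(K, ℂ) →⋆ₐ[ℂ] M)

/-- The homomorphism on the algebraic tensor product defined by commuting homomorphisms. -/
def algLift (hc : ∀ x f, Commute (i x) (σ f)) : X ⊗[ℂ] C(K, ℂ) →ₐ[ℂ] M :=
  Algebra.TensorProduct.lift i.toAlgHom σ.toAlgHom hc

lemma algLift_tmul (hc : ∀ x f, Commute (i x) (σ f)) (x : X) (f : C(K, ℂ)) : algLift i σ hc (x ⊗ₜ f) = i x * σ f := rfl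

/-- The Riemann sum attached to a partition of unity. -/
def riemann {t : Finset K} (g : t → C(K, ℝ)) (F : K → X) : M :=
  ∑ m : t, i (F m) * σ (toComplex (g m))

variable {t : Finset K} (g : t → C(K, ℝ))

lemma riemann_const (h1 : ∀ z, ∑ m, g m z = 1) (c : ℂ) :
    riemann i σ g (fun _ => algebraMap ℂ X c) = algebraMap ℂ M c := by
  have h2 : ∑ m, toComplex (g m) = 1 := by
    ext z
    have := congrArg (fun r : ℝ => (r : ℂ)) (h1 z)
    simpa [toComplex] using this
  rw [riemann, ← Finset.mul_sum, ← map_sum, h2, map_one, mul_one]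
  exact i.toAlgHom.commutes c

lemma riemann_sub (F G : K → X) :
    riemann i σ g (fun z => F z - G z) = riemann i σ g F - riemann i σ g G := by
  simp only [riemann, map_sub, sub_mul, Finset.sum_sub_distrib]

lemma riemann_add (F G : K → X) :
    riemann i σ g (fun z => F z + G z) = riemann i σ g F + riemann i σ g G := by
  simp only [riemann, map_add, add_mul, Finset.sum_add_distrib]

lemma riemann_smul (c : ℂ) (F : K → X) :
    riemann i σ g (fun z => c • F z) = c • riemann i σ g F := by
  simp only [riemann, map_smul, smul_mul_assoc, Finset.smul_sum]

lemma riemann_nonneg (hc : ∀ x f, Commute (i x) (σ f)) {t : Finset K} (g : t → C(K, ℝ))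
    (h0 : ∀ m z, 0 ≤ g m z) [PartialOrder X] [StarOrderedRing X] [PartialOrder M] [StarOrderedRing M]
    (F : K → X) (hF : ∀ z, 0 ≤ F z) : 0 ≤ riemann i σ g F := by
  refine Finset.sum_nonneg fun m _ => ?_
  obtain ⟨b, hb⟩ := CStarAlgebra.nonneg_iff_eq_star_mul_self.1 (hF m)
  let r : C(K, ℂ) := ⟨fun z => (Real.sqrt (g m z) : ℂ), by fun_prop⟩
  have hr : toComplex (g m) = star r * r := by
    ext z
    simp only [toComplex, ContinuousMap.coe_mk, ContinuousMap.mul_apply, ContinuousMap.star_apply, r,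
      RCLike.star_def, Complex.conj_ofReal]
    rw [← Complex.ofReal_mul, Real.mul_self_sqrt (h0 m z)]
  have h : i (F m) * σ (toComplex (g m)) = star (i b * σ r) * (i b * σ r) := by
    rw [hb, hr, map_mul, map_mul, star_mul, ← map_star, ← map_star, mul_assoc, ← mul_assoc (i b),
      (hc b (star r)).eq, mul_assoc (σ (star r)), ← mul_assoc (i (star b)),
      (hc (star b) (star r)).eq, mul_assoc]
  rw [h]
  exact star_mul_self_nonneg _

lemma norm_riemann_selfAdjoint_le (hc : ∀ x f, Commute (i x) (σ f)) {t : Finset K}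
    (g : t → C(K, ℝ)) (h0 : ∀ m z, 0 ≤ g m z) (h1 : ∀ z, ∑ m, g m z = 1)
    (F : K → X) (C : ℝ) (hC : 0 ≤ C) (hF : ∀ z, ‖F z‖ ≤ C)
    (hs : ∀ z, IsSelfAdjoint (F z)) : ‖riemann i σ g F‖ ≤ 3 * C := by
  let _ := CStarAlgebra.spectralOrder X
  have _ := CStarAlgebra.spectralOrderedRing X
  let _ := CStarAlgebra.spectralOrder M
  have _ := CStarAlgebra.spectralOrderedRing M
  have key : ∀ z, -algebraMap ℂ X C ≤ F z ∧ F z ≤ algebraMap ℂ X C := by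
    intro z
    have e : ∀ r : ℝ, algebraMap ℂ X r = algebraMap ℝ X r := fun r => by
      rw [Algebra.algebraMap_eq_smul_one, Algebra.algebraMap_eq_smul_one, Complex.coe_smul]
    have h2 : algebraMap ℝ X ‖F z‖ ≤ algebraMap ℝ X C := algebraMap_mono X (hF z)
    rw [e]
    exact ⟨(neg_le_neg h2).trans (hs z).neg_algebraMap_norm_le_self,
      (hs z).le_algebraMap_norm_self.trans h2⟩
  have hn : ∀ c : ℝ, 0 ≤ c → ‖algebraMap ℂ M c‖ ≤ c := fun c hc => by
    rw [Algebra.algebraMap_eq_smul_one, norm_smul, Complex.norm_real, Real.norm_of_nonneg hc]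
    refine mul_le_of_le_one_right hc ?_
    have h := CStarRing.norm_star_mul_self (x := (1 : M))
    rw [star_one, mul_one] at h
    nlinarith [norm_nonneg (1 : M)]
  have p1 : 0 ≤ riemann i σ g (fun z => F z + algebraMap ℂ X C) :=
    riemann_nonneg i σ hc g h0 _ fun z => by
      rw [← sub_neg_eq_add]; exact sub_nonneg.2 (key z).1
  have p2 : 0 ≤ riemann i σ g (fun z => algebraMap ℂ X C - F z) :=
    riemann_nonneg i σ hc g h0 _ fun z => sub_nonneg.2 (key z).2
  rw [riemann_add, riemann_const i σ g h1] at p1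
  rw [riemann_sub, riemann_const i σ g h1] at p2
  have p3 : ‖riemann i σ g F + algebraMap ℂ M C‖ ≤ 2 * C := by
    refine (CStarAlgebra.norm_le_norm_of_nonneg_of_le p1
      (b := algebraMap ℂ M ((2 * C : ℝ) : ℂ)) ?_).trans (hn _ (by positivity))
    have := add_le_add_left (sub_nonneg.1 p2) (algebraMap ℂ M C)
    refine this.trans_eq ?_
    rw [← map_add]; congr 1; push_cast; ring
  calc ‖riemann i σ g F‖ = ‖(riemann i σ g F + algebraMap ℂ M C) - algebraMap ℂ M C‖ := by
        rw [add_sub_cancel_right]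
    _ ≤ _ := norm_sub_le _ _
    _ ≤ 2 * C + C := add_le_add p3 (hn C hC)
    _ = 3 * C := by ring

lemma norm_riemann_le (hc : ∀ x f, Commute (i x) (σ f)) {t : Finset K}
    (g : t → C(K, ℝ)) (h0 : ∀ m z, 0 ≤ g m z) (h1 : ∀ z, ∑ m, g m z = 1)
    (F : C(K, X)) : ‖riemann i σ g F‖ ≤ 6 * ‖F‖ := by
  have h2 : riemann i σ g F = riemann i σ g (fun z => (realPart (F z) : X)) +
      Complex.I • riemann i σ g (fun z => (imaginaryPart (F z) : X)) := by
    rw [← riemann_smul, ← riemann_add]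
    congr 1
    funext z
    exact (realPart_add_I_smul_imaginaryPart (F z)).symm
  rw [h2]
  refine (norm_add_le _ _).trans ?_
  rw [norm_smul, Complex.norm_I, one_mul]
  have a1 := norm_riemann_selfAdjoint_le i σ hc g h0 h1 (fun z => (realPart (F z) : X)) ‖F‖
    (norm_nonneg F) (fun z => (realPart.norm_le (F z)).trans (F.norm_coe_le_norm z))
    (fun z => (realPart (F z)).2)
  have a2 := norm_riemann_selfAdjoint_le i σ hc g h0 h1 (fun z => (imaginaryPart (F z) : X)) ‖F‖
    (norm_nonneg F) (fun z => (imaginaryPart.norm_le (F z)).trans (F.norm_coe_le_norm z))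
    (fun z => (imaginaryPart (F z)).2)
  linarith

lemma norm_algLift_le [T2Space K] (hc : ∀ x f, Commute (i x) (σ f)) (s : X ⊗[ℂ] C(K, ℂ)) :
    ‖algLift i σ hc s‖ ≤ 6 * ‖tensorHom K X s‖ := by
  obtain ⟨S, rfl⟩ := TensorProduct.exists_finset s
  set B : ℝ := ∑ k ∈ S, ‖k.1‖ with hB
  have hB0 : 0 ≤ B := Finset.sum_nonneg fun _ _ => norm_nonneg _
  refine le_of_forall_pos_le_add fun ε hε => ?_
  have hε' : 0 < ε / (B + 1) := by positivity
  let G : C(K, S → ℂ) := ⟨fun z k => k.1.2 z, by fun_prop⟩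
  obtain ⟨t, g, h0, h1, hg⟩ := exists_partition G hε'
  set T := tensorHom K X (∑ k ∈ S, k.1 ⊗ₜ k.2) with hT
  have hr : riemann i σ g T = ∑ k ∈ S, i k.1 * σ (∑ m : t, k.2 m • toComplex (g m)) := by
    have : ∀ m : K, T m = ∑ k ∈ S, k.2 m • k.1 := fun m => by
      rw [hT, map_sum, ContinuousMap.sum_apply]
      exact Finset.sum_congr rfl fun k _ => tensorHom_tmul _ _ _
    simp only [riemann, this, map_sum, Finset.sum_mul, Finset.mul_sum, map_smul, smul_mul_assoc,
      mul_smul_comm]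
    exact Finset.sum_comm
  have hl : algLift i σ hc (∑ k ∈ S, k.1 ⊗ₜ k.2) = ∑ k ∈ S, i k.1 * σ k.2 := by
    rw [map_sum]; rfl
  have hd : ‖algLift i σ hc (∑ k ∈ S, k.1 ⊗ₜ k.2) - riemann i σ g T‖ ≤ ε := by
    rw [hr, hl, ← Finset.sum_sub_distrib]
    calc _ ≤ ∑ k ∈ S, ‖i k.1 * σ k.2 - i k.1 * σ (∑ m : t, k.2 m • toComplex (g m))‖ :=
          norm_sum_le _ _
      _ ≤ ∑ k ∈ S, ‖k.1‖ * (ε / (B + 1)) := by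
          refine Finset.sum_le_sum fun k hk => ?_
          rw [← mul_sub, ← map_sub]
          refine (norm_mul_le _ _).trans (mul_le_mul (NonUnitalStarAlgHom.norm_apply_le i k.1)
            ((NonUnitalStarAlgHom.norm_apply_le σ _).trans ?_) (norm_nonneg _) (norm_nonneg _))
          rw [ContinuousMap.norm_le _ hε'.le]
          intro z
          have := norm_sub_sum_le (ε := ε / (B + 1)) (fun z => k.2 z) g h0 h1 (fun m z hz => by
            have h3 := hg m z hz
            rw [dist_eq_norm] at h3
            exact (norm_le_pi_norm (G z - G m) ⟨k, hk⟩).trans h3) z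
          rw [ContinuousMap.sub_apply, ContinuousMap.sum_apply]
          simpa [mul_comm] using this
      _ = B * (ε / (B + 1)) := by rw [← Finset.sum_mul]
      _ ≤ ε := by
          rw [mul_div_assoc', div_le_iff₀ (by positivity)]
          nlinarith
  calc _ = ‖(algLift i σ hc (∑ k ∈ S, k.1 ⊗ₜ k.2) - riemann i σ g T) + riemann i σ g T‖ := by
        rw [sub_add_cancel]
    _ ≤ _ := norm_add_le _ _
    _ ≤ ε + 6 * ‖T‖ := add_le_add hd (norm_riemann_le i σ hc g h0 h1 T)
    _ = _ := by ring

variable [T2Space K]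

/-- The continuous linear extension of `algLift` to `C(K, X)`. -/
def liftCLM (hc : ∀ x f, Commute (i x) (σ f)) : C(K, X) →L[ℂ] M :=
  (algLift i σ hc).toLinearMap.extendOfNorm (tensorHom K X).toLinearMap

lemma liftCLM_tensorHom (hc : ∀ x f, Commute (i x) (σ f)) (s : X ⊗[ℂ] C(K, ℂ)) :
    liftCLM i σ hc (tensorHom K X s) = algLift i σ hc s :=
  LinearMap.extendOfNorm_eq (f := (algLift i σ hc).toLinearMap)
    (e := (tensorHom K X).toLinearMap) denseRange_tensorHom ⟨6, norm_algLift_le i σ hc⟩ s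

lemma tensorHom_star (s : X ⊗[ℂ] C(K, ℂ)) : tensorHom K X (star s) = star (tensorHom K X s) := by
  induction s with
  | zero => simp
  | add s t hs ht => rw [star_add, map_add, map_add, star_add, hs, ht]
  | tmul x f =>
    ext z
    rw [TensorProduct.star_tmul, ContinuousMap.star_apply, tensorHom_tmul, tensorHom_tmul,
      ContinuousMap.star_apply, star_smul]

lemma algLift_star (hc : ∀ x f, Commute (i x) (σ f)) (s : X ⊗[ℂ] C(K, ℂ)) : algLift i σ hc (star s) = star (algLift i σ hc s) := by
  induction s with
  | zero => simp
  | add s t hs ht => rw [star_add, map_add, map_add, star_add, hs, ht]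
  | tmul x f =>
    rw [TensorProduct.star_tmul, algLift_tmul, algLift_tmul, star_mul, map_star, map_star,
      ← map_star, ← map_star, (hc _ _).eq]

/-- The homomorphism `C(K, X) = X ⊗ C(K) → M`, `x ⊗ f ↦ i(x) σ(f)`, defined by two unital
*-homomorphisms `i : X → M` and `σ : C(K) → M` with commuting ranges. -/
def liftHom (hc : ∀ x f, Commute (i x) (σ f)) : C(K, X) →⋆ₐ[ℂ] M where
  toFun := liftCLM i σ hc
  map_one' := by
    have h : tensorHom K X 1 = 1 := (tensorHom K X).map_one'
    exact (congrArg _ h.symm).trans ((liftCLM_tensorHom i σ hc 1).trans (algLift i σ hc).map_one')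
  map_zero' := map_zero _
  map_add' := map_add _
  map_mul' F G := by
    refine denseRange_tensorHom.induction_on₂
      (p := fun F G => liftCLM i σ hc (F * G) = liftCLM i σ hc F * liftCLM i σ hc G)
      (isClosed_eq (by fun_prop) (by fun_prop)) (fun s t => ?_) F G
    rw [← map_mul, liftCLM_tensorHom, liftCLM_tensorHom, liftCLM_tensorHom, map_mul]
  commutes' c := by
    have h : tensorHom K X (algebraMap ℂ _ c) = algebraMap ℂ _ c := (tensorHom K X).commutes c
    exact (congrArg _ h.symm).trans
      ((liftCLM_tensorHom i σ hc _).trans ((algLift i σ hc).commutes c))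
  map_star' F := by
    refine denseRange_tensorHom.induction_on
      (p := fun F => liftCLM i σ hc (star F) = star (liftCLM i σ hc F)) F
      (isClosed_eq (by fun_prop) (by fun_prop)) (fun s => ?_)
    rw [← tensorHom_star, liftCLM_tensorHom, liftCLM_tensorHom, algLift_star]

lemma liftHom_constHom (hc : ∀ x f, Commute (i x) (σ f)) (x : X) : liftHom i σ hc (constHom K X x) = i x := by
  have h : constHom K X x = tensorHom K X (x ⊗ₜ 1) := by
    ext z; rw [tensorHom_tmul, constHom_apply, ContinuousMap.one_apply, one_smul]
  rw [h]
  exact (liftCLM_tensorHom i σ hc _).trans (by rw [algLift_tmul, map_one, mul_one])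

lemma liftHom_scalarHom (hc : ∀ x f, Commute (i x) (σ f)) (f : C(K, ℂ)) : liftHom i σ hc (scalarHom K X f) = σ f := by
  have h : scalarHom K X f = tensorHom K X (1 ⊗ₜ f) := by
    ext z; rw [tensorHom_tmul, scalarHom_apply, Algebra.algebraMap_eq_smul_one]
  rw [h]
  exact (liftCLM_tensorHom i σ hc _).trans (by rw [algLift_tmul, map_one, one_mul])

end lift

end CFun

/-- For subsets `S`, `T` of a C*-algebra, `closedMul S T` is the norm closed linear span of the
products `s * t`, `s ∈ S`, `t ∈ T`. -/
def closedMul {A : Type*} [CStarAlgebra A] (S T : Set A) : Submodule ℂ A :=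
  (Submodule.span ℂ {a | ∃ s ∈ S, ∃ t ∈ T, a = s * t}).topologicalClosure

/-- The functional calculus homomorphism `C(𝕋) → M`, `z ↦ U`, of a unitary element `U`. -/
def unitaryHom {M : Type*} [CStarAlgebra M] (U : unitary M) : C(Circle, ℂ) →⋆ₐ[ℂ] M :=
  (cfcHom (R := ℂ) (a := (U : M)) (p := IsStarNormal) inferInstance).comp
    (ContinuousMap.compStarAlgHom' ℂ ℂ
      ⟨fun z : spectrum ℂ (U : M) =>
        (⟨z, spectrum.subset_circle_of_unitary U.2 z.2⟩ : Circle), by fun_prop⟩)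

/-- The canonical generator `z` of `C(𝕋)`. -/
def circleCoord : C(Circle, ℂ) := ⟨fun z => (z : ℂ), by fun_prop⟩

lemma unitaryHom_circleCoord {M : Type*} [CStarAlgebra M] (U : unitary M) :
    unitaryHom U circleCoord = U :=
  cfcHom_id (R := ℂ) (a := (U : M)) (p := IsStarNormal) inferInstance

/-- A continuous coaction of the circle group on a unital C*-algebra `X`: a unital *-homomorphism
`ρ : X → X ⊗ C(𝕋) = C(𝕋, X)` with `(ρ ⊗ id) ρ = (id ⊗ Δ) ρ` (evaluated at `(z, w) ∈ 𝕋 × 𝕋`) and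
`ρ(X) (1 ⊗ C(𝕋)) = X ⊗ C(𝕋)`. -/
structure CircleCoaction (X : Type*) [CStarAlgebra X] where
  toHom : X →⋆ₐ[ℂ] C(Circle, X)
  coassoc : ∀ (x : X) (z w : Circle), toHom (toHom x w) z = toHom x (z * w)
  podles : closedMul (Set.range toHom) (Set.range (CFun.scalarHom Circle X)) = ⊤

namespace CircleCoaction

variable {X : Type*} [CStarAlgebra X] (ρ : CircleCoaction X)

/-- `x` is homogeneous of degree `n`, i.e. `ρ(x) = x ⊗ z ^ n`. -/
def IsHomogeneous (n : ℤ) (x : X) : Prop :=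
  ∀ z : Circle, ρ.toHom x z = ((z ^ n : Circle) : ℂ) • x

/-- The automorphism `ρ_z`, as a continuous linear map. -/
def actL (z : Circle) : X →L[ℂ] X :=
  (ContinuousMap.evalCLM ℂ z).comp (LinearMap.mkContinuous ρ.toHom.toAlgHom.toLinearMap 1
    fun x => (NonUnitalStarAlgHom.norm_apply_le ρ.toHom x).trans_eq (one_mul _).symm)

lemma actL_apply (z : Circle) (x : X) : ρ.actL z x = ρ.toHom x z := rfl

lemma act_one (x : X) : ρ.toHom x 1 = x := by
  let e : C(Circle, X) →L[ℂ] X := ContinuousMap.evalCLM ℂ 1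
  have hcl : IsClosed {F : C(Circle, X) | ρ.actL 1 (e F) = e F} :=
    isClosed_eq (by fun_prop) (by fun_prop)
  have hle : closedMul (Set.range ρ.toHom) (Set.range (CFun.scalarHom Circle X)) ≤
      LinearMap.eqLocus ((ρ.actL 1).comp e).toLinearMap e.toLinearMap := by
    refine Submodule.topologicalClosure_minimal _ (Submodule.span_le.2 ?_) hcl
    rintro _ ⟨_, ⟨y, rfl⟩, _, ⟨f, rfl⟩, rfl⟩
    change ρ.toHom (ρ.toHom y 1 * algebraMap ℂ X (f 1)) 1 = ρ.toHom y 1 * algebraMap ℂ X (f 1)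
    rw [← Algebra.commutes, ← Algebra.smul_def, map_smul, ContinuousMap.smul_apply, ρ.coassoc,
      mul_one]
  have hx : CFun.constHom Circle X x ∈
      closedMul (Set.range ρ.toHom) (Set.range (CFun.scalarHom Circle X)) := by
    rw [ρ.podles]; trivial
  exact hle hx

open MeasureTheory AddCircle in
/-- The component of degree `n` of an element. -/
def component (n : ℤ) (x : X) : X :=
  fourierCoeff (T := 1) (fun t => ρ.toHom x t.toCircle) n

lemma continuous_orbit (x : X) :
    Continuous fun t : AddCircle (1 : ℝ) => ρ.toHom x t.toCircle :=
  (ρ.toHom x).continuous.comp AddCircle.continuous_toCircle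

lemma integrable_of_continuous {E : Type*} [NormedAddCommGroup E] {f : AddCircle (1 : ℝ) → E}
    (hf : Continuous f) : MeasureTheory.Integrable f AddCircle.haarAddCircle :=
  hf.integrable_of_hasCompactSupport (HasCompactSupport.of_compactSpace f)

lemma isHomogeneous_component (n : ℤ) (x : X) : ρ.IsHomogeneous n (ρ.component n x) := by
  intro z
  obtain ⟨s, rfl⟩ := (AddCircle.homeomorphCircle (one_ne_zero : (1 : ℝ) ≠ 0)).surjective z
  rw [AddCircle.homeomorphCircle_apply, ← actL_apply, component, fourierCoeff,
    ← ContinuousLinearMap.integral_comp_comm]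
  · have h1 : ∀ t : AddCircle (1 : ℝ), ρ.actL s.toCircle
        (fourier (-n) t • ρ.toHom x t.toCircle) =
        (fun t => fourier n s • (fourier (-n) t • ρ.toHom x t.toCircle)) (s + t) := by
      intro t
      rw [map_smul, actL_apply, ρ.coassoc, ← AddCircle.toCircle_add]
      simp only [smul_smul]
      congr 1
      simp only [fourier_apply, smul_add, AddCircle.toCircle_add, Circle.coe_mul]
      rw [← mul_assoc, ← Circle.coe_mul, ← AddCircle.toCircle_add, neg_smul n s,
        add_neg_cancel (n • s), AddCircle.toCircle_zero, Circle.coe_one, one_mul]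
    rw [MeasureTheory.integral_congr_ae (Filter.Eventually.of_forall h1)]
    refine (MeasureTheory.integral_add_left_eq_self
      (fun t => fourier n s • (fourier (-n) t • ρ.toHom x t.toCircle)) s).trans ?_
    refine (MeasureTheory.integral_smul (fourier n s) _).trans ?_
    rw [fourier_apply, AddCircle.toCircle_zsmul]
  · exact integrable_of_continuous
      (((fourier (-n)).continuous).smul (ρ.continuous_orbit x))

/-- The homogeneous elements span a dense subspace. -/
lemma closure_span_homogeneous :
    (Submodule.span ℂ {x | ∃ n, ρ.IsHomogeneous n x}).topologicalClosure = ⊤ := by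
  set S := (Submodule.span ℂ {x | ∃ n, ρ.IsHomogeneous n x}).topologicalClosure with hS
  have hcl : IsClosed (S : Set X) := Submodule.isClosed_topologicalClosure _
  refine eq_top_iff.2 fun x _ => ?_
  obtain ⟨g, -, hg⟩ := exists_dual_vector'' ℂ (S.mkQ x)
  have hg0 : ∀ n, g (S.mkQ (ρ.component n x)) = 0 := fun n => by
    have : ρ.component n x ∈ S :=
      Submodule.le_topologicalClosure _ (Submodule.subset_span ⟨n, ρ.isHomogeneous_component n x⟩)
    have h2 : S.mkQ (ρ.component n x) = 0 := (Submodule.Quotient.mk_eq_zero S).2 this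
    rw [h2, map_zero]
  let L : X →L[ℂ] ℂ := g.comp S.mkQL
  let f : C(AddCircle (1 : ℝ), ℂ) :=
    ⟨fun t => L (ρ.toHom x t.toCircle), L.continuous.comp (ρ.continuous_orbit x)⟩
  have hf : ∀ n, fourierCoeff f n = 0 := fun n => by
    rw [← hg0 n]
    change _ = L (ρ.component n x)
    rw [component, fourierCoeff, fourierCoeff, ← ContinuousLinearMap.integral_comp_comm]
    · simp only [map_smul]; rfl
    · exact integrable_of_continuous
        (((fourier (-n)).continuous).smul (ρ.continuous_orbit x))
  have h0 := has_pointwise_sum_fourier_series_of_summable (f := f)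
    (by rw [show fourierCoeff f = fun _ => (0 : ℂ) from funext hf]; exact summable_zero) 0
  simp only [hf, zero_smul] at h0
  have h1 : f 0 = 0 := h0.unique hasSum_zero
  have h2 : g (S.mkQ x) = 0 := by
    rw [← h1]
    change _ = L (ρ.toHom x (AddCircle.toCircle 0))
    rw [AddCircle.toCircle_zero, ρ.act_one]; rfl
  rw [h2] at hg
  have h3 : ‖S.mkQ x‖ = 0 := Complex.ofReal_eq_zero.1 hg.symm
  exact (Submodule.Quotient.mk_eq_zero S).1 (norm_eq_zero.1 h3)

variable {ρ} in
lemma IsHomogeneous.mul {m n : ℤ} {x y : X} (hx : ρ.IsHomogeneous m x)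
    (hy : ρ.IsHomogeneous n y) : ρ.IsHomogeneous (m + n) (x * y) := fun z => by
  rw [map_mul, ContinuousMap.mul_apply, hx z, hy z, zpow_add, Circle.coe_mul, smul_mul_smul_comm]

variable {ρ} in
lemma IsHomogeneous.star {n : ℤ} {x : X} (hx : ρ.IsHomogeneous n x) :
    ρ.IsHomogeneous (-n) (star x) := fun z => by
  rw [map_star, ContinuousMap.star_apply, hx z, star_smul, zpow_neg, Circle.coe_inv_eq_conj]; rfl

lemma isHomogeneous_one : ρ.IsHomogeneous 0 1 := fun z => by
  rw [map_one, ContinuousMap.one_apply, zpow_zero, Circle.coe_one, one_smul]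

end CircleCoaction

lemma CStarSeminorm.map_eq_of_sub {A : Type*} [Ring A] [StarRing A] [Algebra ℂ A]
    (p : CStarSeminorm A) {x y : A} (h : p (x - y) = 0) : p x = p y := by
  refine le_antisymm ?_ ?_
  · have := p.add_le (x - y) y
    rwa [sub_add_cancel, h, zero_add] at this
  · have := p.add_le (-(x - y)) x
    rwa [neg_sub, sub_add_cancel, ← neg_sub, p.map_neg, h, zero_add] at this

lemma circle_star_mul_self (z : Circle) : star (z : ℂ) * z = 1 := by
  rw [RCLike.star_def, ← Circle.coe_inv_eq_conj, ← Circle.coe_mul, inv_mul_cancel, Circle.coe_one]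

lemma circle_mul_star_self (z : Circle) : (z : ℂ) * star (z : ℂ) = 1 := by
  rw [RCLike.star_def, ← Circle.coe_inv_eq_conj, ← Circle.coe_mul, mul_inv_cancel, Circle.coe_one]

/-- The scalar unitaries. -/
def scalarUnitary (M : Type*) [CStarAlgebra M] : Circle →* unitary M where
  toFun z := ⟨algebraMap ℂ M z, by
    rw [Unitary.mem_iff, ← algebraMap_star_comm, ← map_mul, ← map_mul, circle_star_mul_self,
      circle_mul_star_self, map_one]
    exact ⟨rfl, rfl⟩⟩
  map_one' := Subtype.ext (map_one _)
  map_mul' z w := Subtype.ext (map_mul (algebraMap ℂ M) (z : ℂ) w)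

/-- The function `z ↦ z ^ n` on the circle. -/
def circlePow (n : ℤ) : C(Circle, ℂ) :=
  ⟨fun z => ((z ^ n : Circle) : ℂ), continuous_induced_dom.comp (continuous_zpow n)⟩

lemma circlePow_natCast (m : ℕ) : circlePow m = circleCoord ^ m := by
  ext w
  rw [ContinuousMap.pow_apply]
  change ((w ^ (m : ℤ) : Circle) : ℂ) = (w : ℂ) ^ m
  rw [zpow_natCast, Circle.coe_pow]

lemma circlePow_negSucc (m : ℕ) : circlePow (Int.negSucc m) = star (circleCoord ^ (m + 1)) := by
  ext w
  rw [ContinuousMap.star_apply, ContinuousMap.pow_apply]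
  change ((w ^ Int.negSucc m : Circle) : ℂ) = star ((w : ℂ) ^ (m + 1))
  rw [zpow_negSucc, Circle.coe_inv_eq_conj, Circle.coe_pow]; rfl

lemma unitaryHom_circlePow {M : Type*} [CStarAlgebra M] (U : unitary M) (n : ℤ) :
    unitaryHom U (circlePow n) = (U ^ n : unitary M) := by
  rcases n with m | m
  · rw [Int.ofNat_eq_natCast, circlePow_natCast, map_pow, unitaryHom_circleCoord, zpow_natCast,
      SubmonoidClass.coe_pow]
  · rw [circlePow_negSucc, map_star, map_pow, unitaryHom_circleCoord, zpow_negSucc,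
      ← Unitary.star_eq_inv, Unitary.coe_star, SubmonoidClass.coe_pow]

namespace NCTorus

open FreeStarAlgebra

/-- The C*-algebra `C(𝕋²_ζ)` of the noncommutative torus, by generators `U` (`gen 0`) and
`V` (`gen 1`) and relations: `U` and `V` are unitary and `V U = ζ U V`. -/
def presentation (ζ : Circle) : CStarPresentation (Fin 2) where
  rels := {r | (∃ i, r = star (gen i) * gen i - 1) ∨ (∃ i, r = gen i * star (gen i) - 1) ∨
    r = gen 1 * gen 0 - (ζ : ℂ) • (gen 0 * gen 1)}
  bounded i := by
    refine ⟨1, fun p hp => ?_⟩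
    have h := p.map_eq_of_sub (hp _ (Or.inl ⟨i, rfl⟩))
    rw [p.star_mul_self] at h
    nlinarith [p.one_le, p.nonneg (gen i)]

end NCTorus

/-- The C*-algebra `C(𝕋²_ζ)`. -/
def NCTorus (ζ : Circle) : Type := (NCTorus.presentation ζ).Alg

namespace NCTorus

variable (ζ : Circle)

instance : CStarAlgebra (NCTorus ζ) := inferInstanceAs (CStarAlgebra (presentation ζ).Alg)

/-- The unitary generators: `U` for `i = 0` and `V` for `i = 1`. -/
def gen (i : Fin 2) : unitary (NCTorus ζ) where
  val := (presentation ζ).gen i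
  property := by
    have h1 := (presentation ζ).toAlg_rel (Or.inl ⟨i, rfl⟩)
    have h2 := (presentation ζ).toAlg_rel (Or.inr (Or.inl ⟨i, rfl⟩))
    rw [map_sub, map_mul, map_star, map_one, sub_eq_zero] at h1 h2
    exact ⟨h1, h2⟩

/-- The generator `U`. -/
def U : unitary (NCTorus ζ) := gen ζ 0

/-- The generator `V`. -/
def V : unitary (NCTorus ζ) := gen ζ 1

lemma V_mul_U : (V ζ : NCTorus ζ) * U ζ = (ζ : ℂ) • ((U ζ : NCTorus ζ) * V ζ) := by
  have h := (presentation ζ).toAlg_rel (Or.inr (Or.inr rfl))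
  rw [map_sub, map_smul, map_mul, map_mul, sub_eq_zero] at h
  exact h

lemma V_zpow_mul_U_zpow (l k : ℤ) :
    ((V ζ ^ l : unitary (NCTorus ζ)) : NCTorus ζ) * (U ζ ^ k : unitary (NCTorus ζ)) =
    ((ζ ^ (l * k) : Circle) : ℂ) •
      (((U ζ ^ k : unitary (NCTorus ζ)) : NCTorus ζ) * (V ζ ^ l : unitary (NCTorus ζ))) := by
  let c := scalarUnitary (NCTorus ζ)
  have hc : ∀ w u, Commute (c w) u := fun w u =>
    Subtype.ext (Algebra.commutes (w : ℂ) (u : NCTorus ζ))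
  have h0 : V ζ * U ζ = c ζ * U ζ * V ζ := by
    refine Subtype.ext ?_
    change (V ζ : NCTorus ζ) * U ζ = algebraMap ℂ _ (ζ : ℂ) * U ζ * V ζ
    rw [V_mul_U, Algebra.smul_def, mul_assoc]
  have h1 : SemiconjBy (V ζ) (U ζ) (c ζ * U ζ) := h0
  have h2 := h1.zpow_right k
  rw [(hc ζ (U ζ)).mul_zpow] at h2
  have h3 : SemiconjBy (U ζ ^ k)⁻¹ (V ζ) (c ζ ^ k * V ζ) := by
    rw [SemiconjBy, inv_mul_eq_iff_eq_mul, ← mul_assoc, eq_mul_inv_iff_mul_eq, h2.eq,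
      ← mul_assoc, ← map_zpow, (hc _ _).eq]
  have h4 := (h3.zpow_right l).eq
  rw [← map_zpow, (hc _ (V ζ)).mul_zpow, inv_mul_eq_iff_eq_mul, ← mul_assoc,
    eq_mul_inv_iff_mul_eq, ← mul_assoc, ← map_zpow, ← zpow_mul, mul_comm k l, ← (hc _ _).eq,
    mul_assoc] at h4
  have h5 := congrArg (fun u : unitary (NCTorus ζ) => (u : NCTorus ζ)) h4
  refine h5.trans ?_
  rw [Algebra.smul_def]; rfl

end NCTorus

namespace Braided

variable {X Y : Type*} [CStarAlgebra X] [CStarAlgebra Y] (ζ : Circle)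
  (ρX : CircleCoaction X) (ρY : CircleCoaction Y)

/-- The algebra `X ⊗ Y ⊗ C(𝕋²_ζ)`. -/
abbrev Ambient (X Y : Type*) [CStarAlgebra X] [CStarAlgebra Y] (ζ : Circle) : Type _ :=
  MinTensor (MinTensor X Y) (NCTorus ζ)

/-- The homomorphism `j₁ : X → X ⊗ Y ⊗ C(𝕋²_ζ)`: the coaction `ρX : X → C(𝕋, X) = X ⊗ C(𝕋)`
followed by `x ⊗ f ↦ x ⊗ 1 ⊗ ι₁(f)`, where `ι₁(z) = U`. -/
def j₁' : X →⋆ₐ[ℂ] Ambient X Y ζ :=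
  (CFun.liftHom ((MinTensor.inl (MinTensor X Y) (NCTorus ζ)).comp (MinTensor.inl X Y))
    ((MinTensor.inr (MinTensor X Y) (NCTorus ζ)).comp (unitaryHom (NCTorus.U ζ)))
    (fun _ _ => MinTensor.commute_inl_inr _ _ _ _)).comp ρX.toHom

/-- The homomorphism `j₂ : Y → X ⊗ Y ⊗ C(𝕋²_ζ)`: the coaction `ρY : Y → C(𝕋, Y) = Y ⊗ C(𝕋)`
followed by `y ⊗ f ↦ 1 ⊗ y ⊗ ι₂(f)`, where `ι₂(z) = V`. -/
def j₂' : Y →⋆ₐ[ℂ] Ambient X Y ζ :=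
  (CFun.liftHom ((MinTensor.inl (MinTensor X Y) (NCTorus ζ)).comp (MinTensor.inr X Y))
    ((MinTensor.inr (MinTensor X Y) (NCTorus ζ)).comp (unitaryHom (NCTorus.V ζ)))
    (fun _ _ => MinTensor.commute_inl_inr _ _ _ _)).comp ρY.toHom

variable {ρX ρY}

lemma liftHom_homogeneous {X M : Type*} [CStarAlgebra X] [CStarAlgebra M] {ρ : CircleCoaction X}
    (i : X →⋆ₐ[ℂ] M) (σ : C(Circle, ℂ) →⋆ₐ[ℂ] M) (hc : ∀ x f, Commute (i x) (σ f)) {k : ℤ} {x : X}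
    (hx : ρ.IsHomogeneous k x) : CFun.liftHom i σ hc (ρ.toHom x) = i x * σ (circlePow k) := by
  have h : ρ.toHom x = CFun.constHom Circle X x * CFun.scalarHom Circle X (circlePow k) := by
    ext z
    rw [hx z, ContinuousMap.mul_apply, CFun.constHom_apply, CFun.scalarHom_apply,
      ← Algebra.commutes, ← Algebra.smul_def]; rfl
  rw [h, map_mul, CFun.liftHom_constHom, CFun.liftHom_scalarHom]

/-- `j₁(x) = x ⊗ 1 ⊗ U ^ k` for `x` homogeneous of degree `k`. -/
lemma j₁'_homogeneous {k : ℤ} {x : X} (hx : ρX.IsHomogeneous k x) :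
    j₁' (Y := Y) ζ ρX x = MinTensor.inl (MinTensor X Y) (NCTorus ζ) (MinTensor.inl X Y x) *
      MinTensor.inr (MinTensor X Y) (NCTorus ζ) (NCTorus.U ζ ^ k : unitary (NCTorus ζ)) := by
  refine (liftHom_homogeneous _ _ _ hx).trans ?_
  rw [StarAlgHom.comp_apply, StarAlgHom.comp_apply, unitaryHom_circlePow]

/-- `j₂(y) = 1 ⊗ y ⊗ V ^ l` for `y` homogeneous of degree `l`. -/
lemma j₂'_homogeneous {l : ℤ} {y : Y} (hy : ρY.IsHomogeneous l y) :
    j₂' (X := X) ζ ρY y = MinTensor.inl (MinTensor X Y) (NCTorus ζ) (MinTensor.inr X Y y) *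
      MinTensor.inr (MinTensor X Y) (NCTorus ζ) (NCTorus.V ζ ^ l : unitary (NCTorus ζ)) := by
  refine (liftHom_homogeneous _ _ _ hy).trans ?_
  rw [StarAlgHom.comp_apply, StarAlgHom.comp_apply, unitaryHom_circlePow]

/-- The commutation relation `j₂(y) j₁(x) = ζ ^ (l k) j₁(x) j₂(y)` for homogeneous elements. -/
lemma j₂'_mul_j₁' {k l : ℤ} {x : X} {y : Y} (hx : ρX.IsHomogeneous k x)
    (hy : ρY.IsHomogeneous l y) :
    j₂' ζ ρY y * j₁' ζ ρX x = ((ζ ^ (l * k) : Circle) : ℂ) • (j₁' ζ ρX x * j₂' ζ ρY y) := by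
  rw [j₁'_homogeneous ζ hx, j₂'_homogeneous ζ hy]
  set a := MinTensor.inl X Y x
  set b := MinTensor.inr X Y y
  set I := MinTensor.inl (MinTensor X Y) (NCTorus ζ)
  set J := MinTensor.inr (MinTensor X Y) (NCTorus ζ)
  have hIJ : ∀ p q, J q * I p = I p * J q := fun p q => (MinTensor.commute_inl_inr _ _ p q).eq.symm
  have hab : b * a = a * b := (MinTensor.commute_inl_inr _ _ x y).eq.symm
  have h : ∀ (p q : MinTensor X Y) (s t : NCTorus ζ), I p * J s * (I q * J t) =
      I (p * q) * J (s * t) := fun p q s t => by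
    rw [mul_assoc, ← mul_assoc (J s), hIJ, map_mul, map_mul]; simp only [mul_assoc]
  rw [h, h, hab, NCTorus.V_zpow_mul_U_zpow, map_smul, mul_smul_comm]

variable (ρX ρY)

/-- The linear span of the products `j₁(x) j₂(y)` of homogeneous elements, as a *-subalgebra. -/
def homogeneousPart : StarSubalgebra ℂ (Ambient X Y ζ) where
  carrier := Submodule.span ℂ {a | ∃ (k l : ℤ) (x : X) (y : Y), ρX.IsHomogeneous k x ∧
    ρY.IsHomogeneous l y ∧ a = j₁' ζ ρX x * j₂' ζ ρY y}
  add_mem' := Submodule.add_mem _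
  mul_mem' {a b} ha hb := by
    refine Submodule.span_induction₂ (p := fun a b _ _ => a * b ∈ Submodule.span ℂ _)
      ?_ ?_ ?_ ?_ ?_ ?_ ?_ ha hb
    · rintro _ _ ⟨k, l, x, y, hx, hy, rfl⟩ ⟨k', l', x', y', hx', hy', rfl⟩
      have h : j₁' ζ ρX x * j₂' ζ ρY y * (j₁' ζ ρX x' * j₂' ζ ρY y') =
          ((ζ ^ (l * k') : Circle) : ℂ) • (j₁' ζ ρX (x * x') * j₂' ζ ρY (y * y')) := by
        rw [mul_assoc, ← mul_assoc (j₂' ζ ρY y), j₂'_mul_j₁' ζ hx' hy, smul_mul_assoc,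
          mul_smul_comm, map_mul, map_mul]
        simp only [mul_assoc]
      rw [h]
      exact Submodule.smul_mem _ _ (Submodule.subset_span
        ⟨k + k', l + l', _, _, hx.mul hx', hy.mul hy', rfl⟩)
    · intro b _; rw [zero_mul]; exact Submodule.zero_mem _
    · intro b _; rw [mul_zero]; exact Submodule.zero_mem _
    · intro a a' b _ _ _ h h'; rw [add_mul]; exact Submodule.add_mem _ h h'
    · intro a b b' _ _ _ h h'; rw [mul_add]; exact Submodule.add_mem _ h h'
    · intro c a b _ _ h; rw [smul_mul_assoc]; exact Submodule.smul_mem _ _ h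
    · intro c a b _ _ h; rw [mul_smul_comm]; exact Submodule.smul_mem _ _ h
  algebraMap_mem' c := by
    rw [Algebra.algebraMap_eq_smul_one]
    refine Submodule.smul_mem _ _ (Submodule.subset_span
      ⟨0, 0, 1, 1, ρX.isHomogeneous_one, ρY.isHomogeneous_one, ?_⟩)
    rw [map_one, map_one, one_mul]
  star_mem' {a} ha := by
    refine Submodule.span_induction (p := fun a _ => star a ∈ Submodule.span ℂ _) ?_ ?_ ?_ ?_ ha
    · rintro _ ⟨k, l, x, y, hx, hy, rfl⟩
      rw [star_mul, ← map_star, ← map_star, j₂'_mul_j₁' ζ hx.star hy.star]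
      exact Submodule.smul_mem _ _ (Submodule.subset_span
        ⟨-k, -l, _, _, hx.star, hy.star, rfl⟩)
    · rw [star_zero]; exact Submodule.zero_mem _
    · intro a b _ _ h h'; rw [star_add]; exact Submodule.add_mem _ h h'
    · intro c a _ h; rw [star_smul]; exact Submodule.smul_mem _ _ h

/-- The closed span of all products `j₁(x) j₂(y)` is the closure of the span of those with
homogeneous `x` and `y`. -/
lemma closedMul_eq_closure :
    (closedMul (Set.range (j₁' (Y := Y) ζ ρX)) (Set.range (j₂' (X := X) ζ ρY)) :
      Set (Ambient X Y ζ)) = (homogeneousPart ζ ρX ρY).topologicalClosure := by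
  set D : Submodule ℂ (Ambient X Y ζ) := Submodule.span ℂ {a | ∃ (k l : ℤ) (x : X) (y : Y),
    ρX.IsHomogeneous k x ∧ ρY.IsHomogeneous l y ∧ a = j₁' ζ ρX x * j₂' ζ ρY y} with hD
  have hD' : ((homogeneousPart ζ ρX ρY).topologicalClosure : Set (Ambient X Y ζ)) =
      D.topologicalClosure := rfl
  rw [hD']
  refine Set.Subset.antisymm ?_ ?_
  · refine SetLike.coe_subset_coe.2 (Submodule.topologicalClosure_minimal _
      (Submodule.span_le.2 ?_) D.isClosed_topologicalClosure)
    rintro _ ⟨_, ⟨x, rfl⟩, _, ⟨y, rfl⟩, rfl⟩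
    have c1 : Continuous (j₁' (Y := Y) ζ ρX) := by
      let L := LinearMap.mkContinuous (j₁' (Y := Y) ζ ρX).toAlgHom.toLinearMap 1
        fun x => (NonUnitalStarAlgHom.norm_apply_le (j₁' (Y := Y) ζ ρX) x).trans_eq (one_mul _).symm
      exact L.continuous
    have c2 : Continuous (j₂' (X := X) ζ ρY) := by
      let L := LinearMap.mkContinuous (j₂' (X := X) ζ ρY).toAlgHom.toLinearMap 1
        fun x => (NonUnitalStarAlgHom.norm_apply_le (j₂' (X := X) ζ ρY) x).trans_eq (one_mul _).symm
      exact L.continuous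
    have s1 : ∀ (l : ℤ) (y : Y), ρY.IsHomogeneous l y → ∀ x : X,
        j₁' ζ ρX x * j₂' ζ ρY y ∈ D.topologicalClosure := by
      intro l y hy x
      let L : X →ₗ[ℂ] Ambient X Y ζ :=
        (LinearMap.mulRight ℂ (j₂' ζ ρY y)).comp (j₁' (Y := Y) ζ ρX).toAlgHom.toLinearMap
      have hle : (Submodule.span ℂ {x | ∃ n, ρX.IsHomogeneous n x}).topologicalClosure ≤
          D.topologicalClosure.comap L := by
        refine Submodule.topologicalClosure_minimal _ (Submodule.span_le.2 ?_)
          (D.isClosed_topologicalClosure.preimage (c1.mul continuous_const))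
        rintro x ⟨k, hx⟩
        exact D.le_topologicalClosure (Submodule.subset_span ⟨k, l, x, y, hx, hy, rfl⟩)
      rw [ρX.closure_span_homogeneous] at hle
      exact hle (Submodule.mem_top (x := x))
    let L : Y →ₗ[ℂ] Ambient X Y ζ :=
      (LinearMap.mulLeft ℂ (j₁' ζ ρX x)).comp (j₂' (X := X) ζ ρY).toAlgHom.toLinearMap
    have hle : (Submodule.span ℂ {y | ∃ n, ρY.IsHomogeneous n y}).topologicalClosure ≤
        D.topologicalClosure.comap L := by
      refine Submodule.topologicalClosure_minimal _ (Submodule.span_le.2 ?_)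
        (D.isClosed_topologicalClosure.preimage (continuous_const.mul c2))
      rintro y ⟨l, hy⟩
      exact s1 l y hy x
    rw [ρY.closure_span_homogeneous] at hle
    exact hle (Submodule.mem_top (x := y))
  · refine SetLike.coe_subset_coe.2 (Submodule.topologicalClosure_mono (Submodule.span_mono ?_))
    rintro _ ⟨k, l, x, y, -, -, rfl⟩
    exact ⟨_, ⟨x, rfl⟩, _, ⟨y, rfl⟩, rfl⟩

/-- The norm closed linear span `j₁(X) j₂(Y)` of the products `j₁(x) j₂(y)`, which is a
C*-subalgebra of `X ⊗ Y ⊗ C(𝕋²_ζ)`. -/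
def subalgebra : StarSubalgebra ℂ (Ambient X Y ζ) :=
  ((homogeneousPart ζ ρX ρY).topologicalClosure).copy
    (closedMul (Set.range (j₁' ζ ρX)) (Set.range (j₂' ζ ρY))) (closedMul_eq_closure ζ ρX ρY)

end Braided

/-- The braided tensor product `X ⊠_ζ Y = j₁(X) j₂(Y)`. -/
def BraidedTensor {X Y : Type*} [CStarAlgebra X] [CStarAlgebra Y] (ζ : Circle)
    (ρX : CircleCoaction X) (ρY : CircleCoaction Y) : Type _ :=
  Braided.subalgebra ζ ρX ρY

namespace BraidedTensor

variable {X Y : Type*} [CStarAlgebra X] [CStarAlgebra Y] (ζ : Circle)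
  (ρX : CircleCoaction X) (ρY : CircleCoaction Y)

lemma isClosed_subalgebra : IsClosed (Braided.subalgebra ζ ρX ρY : Set (Braided.Ambient X Y ζ)) :=
  Submodule.isClosed_topologicalClosure _

instance : CStarAlgebra (BraidedTensor ζ ρX ρY) :=
  StarSubalgebra.cstarAlgebra (Braided.subalgebra ζ ρX ρY)
    (h_closed := isClosed_subalgebra ζ ρX ρY)

lemma j₁'_mem (x : X) : Braided.j₁' (Y := Y) ζ ρX x ∈ Braided.subalgebra ζ ρX ρY :=
  Submodule.le_topologicalClosure _ (Submodule.subset_span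
    ⟨_, ⟨x, rfl⟩, _, ⟨1, rfl⟩, by rw [map_one, mul_one]⟩)

lemma j₂'_mem (y : Y) : Braided.j₂' (X := X) ζ ρY y ∈ Braided.subalgebra ζ ρX ρY :=
  Submodule.le_topologicalClosure _ (Submodule.subset_span
    ⟨_, ⟨1, rfl⟩, _, ⟨y, rfl⟩, by rw [map_one, one_mul]⟩)

/-- The canonical morphism `j₁ : X → X ⊠_ζ Y`. -/
def j₁ : X →⋆ₐ[ℂ] BraidedTensor ζ ρX ρY :=
  StarAlgHom.codRestrict (Braided.j₁' ζ ρX) (Braided.subalgebra ζ ρX ρY) (j₁'_mem ζ ρX ρY)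

/-- The canonical morphism `j₂ : Y → X ⊠_ζ Y`. -/
def j₂ : Y →⋆ₐ[ℂ] BraidedTensor ζ ρX ρY :=
  StarAlgHom.codRestrict (Braided.j₂' ζ ρY) (Braided.subalgebra ζ ρX ρY) (j₂'_mem ζ ρX ρY)

end BraidedTensor

namespace CircleCoaction

/-- A morphism `φ : X → Y` is `𝕋`-equivariant: `ρY ∘ φ = (φ ⊗ id) ∘ ρX`. -/
def IsEquivariant {X Y : Type*} [CStarAlgebra X] [CStarAlgebra Y] (ρX : CircleCoaction X)
    (ρY : CircleCoaction Y) (φ : X →⋆ₐ[ℂ] Y) : Prop :=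
  ∀ (x : X) (z : Circle), ρY.toHom (φ x) z = φ (ρX.toHom x z)

end CircleCoaction

namespace BraidedTensor

variable {X Y Z X' Y' : Type*} [CStarAlgebra X] [CStarAlgebra Y] [CStarAlgebra Z]
  [CStarAlgebra X'] [CStarAlgebra Y'] {ζ : Circle}
  {ρX : CircleCoaction X} {ρY : CircleCoaction Y} {ρZ : CircleCoaction Z}
  {ρX' : CircleCoaction X'} {ρY' : CircleCoaction Y'}

/-- `ρ` is the coaction of the circle on `X ⊠_ζ Y`: the coaction, unique since `j₁(X)` and `j₂(Y)`
generate `X ⊠_ζ Y`, for which `j₁` and `j₂` are equivariant. -/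
def IsCoaction (ρ : CircleCoaction (BraidedTensor ζ ρX ρY)) : Prop :=
  ρX.IsEquivariant ρ (j₁ ζ ρX ρY) ∧ ρY.IsEquivariant ρ (j₂ ζ ρX ρY)

/-- `Φ` is the morphism `π₁ ⊠_ζ π₂`, i.e. `Φ(j₁(x) j₂(y)) = j₁(π₁(x)) j₂(π₂(y))`; this determines
`Φ` since the products `j₁(x) j₂(y)` span a dense subspace. -/
def IsMap (π₁ : X →⋆ₐ[ℂ] X') (π₂ : Y →⋆ₐ[ℂ] Y')
    (Φ : BraidedTensor ζ ρX ρY →⋆ₐ[ℂ] BraidedTensor ζ ρX' ρY') : Prop :=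
  ∀ (x : X) (y : Y), Φ (j₁ ζ ρX ρY x * j₂ ζ ρX ρY y) =
    j₁ ζ ρX' ρY' (π₁ x) * j₂ ζ ρX' ρY' (π₂ y)

/-- `α` is the canonical isomorphism `(X ⊠_ζ Y) ⊠_ζ Z ≅ X ⊠_ζ (Y ⊠_ζ Z)`: it identifies the three
canonical images of `X`, `Y` and `Z`, which generate both sides. -/
def IsAssociator {ρXY : CircleCoaction (BraidedTensor ζ ρX ρY)}
    {ρYZ : CircleCoaction (BraidedTensor ζ ρY ρZ)}
    (α : BraidedTensor ζ ρXY ρZ ≃⋆ₐ[ℂ] BraidedTensor ζ ρX ρYZ) : Prop :=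
  (∀ x : X, α (j₁ ζ ρXY ρZ (j₁ ζ ρX ρY x)) = j₁ ζ ρX ρYZ x) ∧
  (∀ y : Y, α (j₁ ζ ρXY ρZ (j₂ ζ ρX ρY y)) = j₂ ζ ρX ρYZ (j₁ ζ ρY ρZ y)) ∧
  (∀ z : Z, α (j₂ ζ ρXY ρZ z) = j₂ ζ ρX ρYZ (j₂ ζ ρY ρZ z))

end BraidedTensor

open BraidedTensor in
/-- `(A, ρ, Δ)` is a braided compact quantum group over the circle group: with respect to the
coaction `ρ₂` on `A ⊠_ζ A` the morphism `Δ` is equivariant, it is coassociative,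
`(Δ ⊠_ζ id) Δ = (id ⊠_ζ Δ) Δ`, where `(A ⊠_ζ A) ⊠_ζ A` and `A ⊠_ζ (A ⊠_ζ A)` are identified by the
canonical isomorphism, and it is bisimplifiable, `Δ(A) j₂(A) = Δ(A) j₁(A) = A ⊠_ζ A`. -/
def IsBraidedCompactQuantumGroup {A : Type*} [CStarAlgebra A] (ζ : Circle) (ρ : CircleCoaction A)
    (Δ : A →⋆ₐ[ℂ] BraidedTensor ζ ρ ρ) : Prop :=
  ∃ ρ₂ : CircleCoaction (BraidedTensor ζ ρ ρ), IsCoaction ρ₂ ∧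
    ρ.IsEquivariant ρ₂ Δ ∧
    (∃ (Δ_id : BraidedTensor ζ ρ ρ →⋆ₐ[ℂ] BraidedTensor ζ ρ₂ ρ)
      (id_Δ : BraidedTensor ζ ρ ρ →⋆ₐ[ℂ] BraidedTensor ζ ρ ρ₂)
      (α : BraidedTensor ζ ρ₂ ρ ≃⋆ₐ[ℂ] BraidedTensor ζ ρ ρ₂),
      IsMap Δ (StarAlgHom.id ℂ A) Δ_id ∧ IsMap (StarAlgHom.id ℂ A) Δ id_Δ ∧ IsAssociator α ∧
      ∀ a : A, α (Δ_id (Δ a)) = id_Δ (Δ a)) ∧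
    closedMul (Set.range Δ) (Set.range (j₂ ζ ρ ρ)) = ⊤ ∧
    closedMul (Set.range Δ) (Set.range (j₁ ζ ρ ρ)) = ⊤

namespace FreeUnitary

open Matrix

variable {n : ℕ}

/-- `F ∈ GL(n, ℂ)` is admissible with respect to the tuples `d`, `d'` and the integer `d₀`:
`F i j = 0 = F⁻¹ j i` whenever `-d j + d₀ ≠ d' i`. -/
def IsAdmissible (F : GL (Fin n) ℂ) (d d' : Fin n → ℤ) (d₀ : ℤ) : Prop :=
  ∀ i j, -d j + d₀ ≠ d' i →
    (F : Matrix (Fin n) (Fin n) ℂ) i j = 0 ∧ ((F⁻¹ : GL (Fin n) ℂ) : Matrix (Fin n) (Fin n) ℂ) j i = 0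

section

variable {R : Type*} [Ring R] [StarRing R] [Algebra ℂ R]

/-- The matrix `v̄_ζ` with entries `ζ ^ (d i (d j - d i)) (v i j)*`. -/
def conjMatrix (ζ : Circle) (d : Fin n → ℤ) (v : Matrix (Fin n) (Fin n) R) :
    Matrix (Fin n) (Fin n) R :=
  Matrix.of fun i j => ((ζ ^ (d i * (d j - d i)) : Circle) : ℂ) • star (v i j)

/-- The matrix `F v̄_ζ F⁻¹`. -/
def twistedConj (F : GL (Fin n) ℂ) (ζ : Circle) (d : Fin n → ℤ) (v : Matrix (Fin n) (Fin n) R) :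
    Matrix (Fin n) (Fin n) R :=
  (F : Matrix (Fin n) (Fin n) ℂ).map (algebraMap ℂ R) * conjMatrix ζ d v *
    ((F⁻¹ : GL (Fin n) ℂ) : Matrix (Fin n) (Fin n) ℂ).map (algebraMap ℂ R)

end

/-- The matrix of free generators. -/
def freeMatrix (n : ℕ) : Matrix (Fin n) (Fin n) (FreeStarAlgebra (Fin n × Fin n)) :=
  Matrix.of fun i j => FreeStarAlgebra.gen (i, j)

/-- The relations `v* v = 1` and `v v* = 1`, entry by entry. -/
def unitaryRels {R : Type*} [Ring R] [StarRing R] (v : Matrix (Fin n) (Fin n) R) : Set R :=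
  {r | ∃ i j, r = (star v * v - 1) i j} ∪ {r | ∃ i j, r = (v * star v - 1) i j}

lemma entry_le_one {A : Type*} [CStarAlgebra A] (v : Matrix (Fin n) (Fin n) A)
    (h : star v * v = 1) (i j : Fin n) : ‖v i j‖ ≤ 1 := by
  let _ := CStarAlgebra.spectralOrder A
  have _ := CStarAlgebra.spectralOrderedRing A
  have h1 : ∑ k, star (v k j) * v k j = 1 := by
    have := congrFun (congrFun h j) j
    rwa [Matrix.mul_apply, Matrix.one_apply_eq] at this
  have h2 : star (v i j) * v i j ≤ 1 := by
    rw [← h1]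
    exact Finset.single_le_sum (f := fun k => star (v k j) * v k j)
      (fun k _ => star_mul_self_nonneg _) (Finset.mem_univ i)
  have h3 := CStarAlgebra.norm_le_norm_of_nonneg_of_le (star_mul_self_nonneg (v i j)) h2
  rw [CStarRing.norm_star_mul_self] at h3
  have h4 := CStarRing.norm_star_mul_self (x := (1 : A))
  rw [star_one, mul_one] at h4
  have h5 : ‖(1 : A)‖ ≤ 1 := by nlinarith [norm_nonneg (1 : A)]
  nlinarith [norm_nonneg (v i j)]

/-- The presentation of `C(U_ζ⁺(F))`: the generators are the entries of an `n × n` matrix `u`, and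
the relations say that `u` and `F ū_ζ F⁻¹` are unitary. -/
def presentation (F : GL (Fin n) ℂ) (ζ : Circle) (d : Fin n → ℤ) :
    CStarPresentation (Fin n × Fin n) where
  rels := unitaryRels (freeMatrix n) ∪ unitaryRels (twistedConj F ζ d (freeMatrix n))
  bounded := by
    rintro ⟨i, j⟩
    refine ⟨1, fun p hp => ?_⟩
    let φ := CStarSeminorm.Completion.ofHom p
    let v : Matrix (Fin n) (Fin n) p.Completion := (freeMatrix n).map φ
    have hv : star v * v = 1 := by
      ext k l
      have h1 : φ ((star (freeMatrix n) * freeMatrix n - 1) k l) = 0 := by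
        rw [← norm_eq_zero]
        exact (CStarSeminorm.Completion.norm_mk p _).trans
          (hp _ (Or.inl (Or.inl ⟨k, l, rfl⟩)))
      rw [Matrix.sub_apply, map_sub, sub_eq_zero, Matrix.mul_apply, map_sum] at h1
      rw [Matrix.mul_apply]
      refine Eq.trans (Finset.sum_congr rfl fun m _ => ?_) (h1.trans ?_)
      · rw [map_mul]
        congr 1
        exact (map_star φ _).symm
      · rw [Matrix.one_apply, Matrix.one_apply]
        split_ifs
        · exact map_one φ
        · exact map_zero φ
    exact (CStarSeminorm.Completion.norm_mk p _).symm.trans_le (entry_le_one v hv i j)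

end FreeUnitary

/-- The C*-algebra `C(U_ζ⁺(F))`: the universal unital C*-algebra generated by the entries of an
`n × n` matrix `u` such that `u` and `F ū_ζ F⁻¹` are unitary. -/
def FreeUnitary {n : ℕ} (F : Matrix.GeneralLinearGroup (Fin n) ℂ) (ζ : Circle) (d : Fin n → ℤ) :
    Type :=
  (FreeUnitary.presentation F ζ d).Alg

namespace FreeUnitary

variable {n : ℕ} (F : Matrix.GeneralLinearGroup (Fin n) ℂ) (ζ : Circle) (d : Fin n → ℤ)

instance : CStarAlgebra (FreeUnitary F ζ d) :=
  inferInstanceAs (CStarAlgebra (FreeUnitary.presentation F ζ d).Alg)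

/-- The matrix of generators. -/
def u : Matrix (Fin n) (Fin n) (FreeUnitary F ζ d) :=
  Matrix.of fun i j => (presentation F ζ d).gen (i, j)

end FreeUnitary

end

/-! Everything about `A` rests on its universal property. A matrix over `B` that satisfies the
relations defines a *-homomorphism on the free *-algebra, and the norm of `B` pulled back along it
is one of the C*-seminorms whose supremum is the norm of `A`. Hence it is contractive and extends to
`A` (`FreeUnitary.lift`); density of the *-polynomials in the generators gives uniqueness
(`FreeUnitary.hom_ext`).

Coaction. The matrix `z^(d_j - d_i) u_ij` is `D* u D` with `D = diag(z^(d_i))`, hence unitary. By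
admissibility `F_ik` vanishes unless `-d_k + d₀ = d'_i`, so `F ū_ζ F⁻¹` gets rescaled by `z^(d'_j -
d'_i)` and stays unitary as well (`twistedConj_gaugeMatrix`). The universal property yields one
endomorphism for each `z`; since homogeneous elements span a dense subspace, these form a coaction
(`CircleCoaction.ofFamily`).

Comultiplication. The matrix `j₁(u) j₂(u)` is a product of unitaries. The involution reverses the
two factors in each summand of an entry, and the braided commutation relation restores their order
at the price of a power of `ζ`. The weights `ζ^(d_i (d_j - d_i))` absorb exactly this power, so `v ↦
v̄_ζ` is multiplicative on this product (`conjMatrix_j₁_mul_j₂`), and so is `v ↦ F v̄_ζ F⁻¹`.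

Coassociativity is associativity of the matrix product, once the two triple braided products are
identified. That identification (`exists_associator`) is the analytic core. The canonical copies of
the three algebras generate a C*-subalgebra of the direct product of both triple products, and it
suffices that both coordinate projections are injective on it. This is tested by functionals. On
homogeneous elements `j₁(x) j₂(y)` is the elementary tensor `x ⊗ y ⊗ U^k V^l`; the Fourier
coefficients of `C(𝕋²_ζ)` read off the degrees, and coefficient functionals of representations see
`x` and `y`. On homogeneous triples the functionals of the left and of the right triple product have
the same values after relabelling degrees. That they separate points comes from slice maps on the
minimal tensor product.

Bisimplifiability. From `Δ(m) = j₁(m) j₂(m)` for the unitaries `m = u` and `m = F ū_ζ F⁻¹` one gets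
`j₁(m) = Δ(m) j₂(m)*`, so `Δ(A) j₂(A)` contains `j₁` of all `u_ij` and `u_ij*`. Moving homogeneous
elements past `j₂(A)` extends this to all words. The other equality is the mirror image, followed by
taking adjoints. -/

noncomputable section

universe w u v

/-! ### Continuity of *-homomorphisms and density arguments -/

section CStarHom

variable {A B : Type*} [CStarAlgebra A] [CStarAlgebra B]

lemma StarAlgHom.continuous_of_cstarAlgebra (φ : A →⋆ₐ[ℂ] B) : Continuous φ :=
  AddMonoidHomClass.continuous_of_bound φ 1 fun x => by
    simpa using NonUnitalStarAlgHom.norm_apply_le φ x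

/-- A *-homomorphism of C*-algebras as a continuous linear map. -/
def StarAlgHom.toCLM (φ : A →⋆ₐ[ℂ] B) : A →L[ℂ] B :=
  ⟨φ.toAlgHom.toLinearMap, φ.continuous_of_cstarAlgebra⟩

@[simp]
lemma StarAlgHom.toCLM_apply (φ : A →⋆ₐ[ℂ] B) (a : A) : φ.toCLM a = φ a := rfl

end CStarHom

lemma ContinuousLinearMap.eq_of_eqOn_dense_span {E F : Type*} [NormedAddCommGroup E]
    [NormedSpace ℂ E] [NormedAddCommGroup F] [NormedSpace ℂ F] {S : Set E}
    (hS : (Submodule.span ℂ S).topologicalClosure = ⊤) {f g : E →L[ℂ] F}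
    (h : ∀ x ∈ S, f x = g x) : f = g :=
  ContinuousLinearMap.ext_on (s := S)
    ((Submodule.dense_iff_topologicalClosure_eq_top).2 hS) fun x hx => h x hx

lemma StarAlgHom.eq_of_eqOn_dense_span {A B : Type*} [CStarAlgebra A] [CStarAlgebra B] {S : Set A}
    (hS : (Submodule.span ℂ S).topologicalClosure = ⊤) {φ ψ : A →⋆ₐ[ℂ] B}
    (h : ∀ x ∈ S, φ x = ψ x) : φ = ψ := by
  have h2 : φ.toCLM = ψ.toCLM := ContinuousLinearMap.eq_of_eqOn_dense_span hS h
  ext x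
  exact congrArg (fun f : A →L[ℂ] B => f x) h2

/-- If a continuous linear map sends a set with dense span into a closed subspace, it sends
everything into it. -/
lemma ContinuousLinearMap.apply_mem_of_dense_span {E F : Type*} [NormedAddCommGroup E]
    [NormedSpace ℂ E] [NormedAddCommGroup F] [NormedSpace ℂ F] {S : Set E}
    (hS : (Submodule.span ℂ S).topologicalClosure = ⊤) {f : E →L[ℂ] F} {W : Submodule ℂ F}
    (hW : IsClosed (W : Set F)) (h : ∀ x ∈ S, f x ∈ W) (x : E) : f x ∈ W := by
  have hle : (Submodule.span ℂ S).topologicalClosure ≤ W.comap f.toLinearMap :=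
    Submodule.topologicalClosure_minimal _ (Submodule.span_le.2 h) (hW.preimage f.continuous)
  rw [hS] at hle
  exact hle (Submodule.mem_top (x := x))

/-! ### Extending *-homomorphisms to completions -/

namespace CStarSeminorm

variable {A : Type*} [Ring A] [StarRing A] [Algebra ℂ A]

/-- The pullback of the norm of a C*-algebra under a *-homomorphism. -/
def ofStarAlgHom {M : Type*} [CStarAlgebra M] (φ : A →⋆ₐ[ℂ] M) : CStarSeminorm A where
  toFun x := ‖φ x‖
  map_zero' := by rw [_root_.map_zero, norm_zero]
  add_le' x y := by rw [map_add]; exact norm_add_le _ _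
  neg' x := by rw [_root_.map_neg, norm_neg]
  smul' c x := by rw [map_smul, norm_smul]
  mul_le x y := by rw [map_mul]; exact norm_mul_le _ _
  star_mul_self x := by rw [map_mul, StarHomClass.map_star]; exact CStarRing.norm_star_mul_self

namespace Completion

variable [StarModule ℂ A] (p : CStarSeminorm A) {M : Type*} [CStarAlgebra M]

lemma denseRange_ofHom : DenseRange (ofHom p) := denseRange_mk p

lemma norm_ofHom (x : A) : ‖ofHom p x‖ = p x := norm_mk p x

/-- The continuous linear extension of a bounded map to the completion. -/
def liftCLM {E : Type*} [NormedAddCommGroup E] [NormedSpace ℂ E] [CompleteSpace E]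
    (f : A →ₗ[ℂ] E) : p.Completion →L[ℂ] E :=
  f.extendOfNorm (ofHom p).toAlgHom.toLinearMap

lemma liftCLM_ofHom {E : Type*} [NormedAddCommGroup E] [NormedSpace ℂ E] [CompleteSpace E]
    {f : A →ₗ[ℂ] E} {C : ℝ} (hf : ∀ a, ‖f a‖ ≤ C * p a) (a : A) :
    liftCLM p f (ofHom p a) = f a :=
  LinearMap.extendOfNorm_eq (f := f) (e := (ofHom p).toAlgHom.toLinearMap) (denseRange_ofHom p)
    ⟨C, fun x => (hf x).trans_eq (congrArg _ (norm_ofHom p x).symm)⟩ a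

/-- The extension of a contractive *-homomorphism to the completion. -/
def lift (φ : A →⋆ₐ[ℂ] M) (hφ : ∀ a, ‖φ a‖ ≤ p a) : p.Completion →⋆ₐ[ℂ] M :=
  have key : ∀ a, liftCLM p φ.toAlgHom.toLinearMap (ofHom p a) = φ a :=
    liftCLM_ofHom p (C := 1) fun a => by rw [one_mul]; exact hφ a
  { toFun := liftCLM p φ.toAlgHom.toLinearMap
    map_one' := by rw [← map_one (ofHom p), key, map_one]
    map_zero' := _root_.map_zero _
    map_add' := map_add _
    map_mul' := fun x y => by
      refine (denseRange_ofHom p).induction_on₂ (p := fun x y =>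
        liftCLM p φ.toAlgHom.toLinearMap (x * y) =
          liftCLM p φ.toAlgHom.toLinearMap x * liftCLM p φ.toAlgHom.toLinearMap y)
        (isClosed_eq (by fun_prop) (by fun_prop)) (fun s t => ?_) x y
      rw [← map_mul, key, key, key, map_mul]
    commutes' := fun c => by
      have h : ofHom p (algebraMap ℂ _ c) = algebraMap ℂ _ c := (ofHom p).toAlgHom.commutes c
      rw [← h, key]
      exact φ.toAlgHom.commutes c
    map_star' := fun x => by
      refine (denseRange_ofHom p).induction_on (p := fun x =>
        liftCLM p φ.toAlgHom.toLinearMap (star x) = star (liftCLM p φ.toAlgHom.toLinearMap x)) x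
        (isClosed_eq ((ContinuousLinearMap.continuous _).comp (continuous_star' p))
          (ContinuousLinearMap.continuous _).star) (fun s => ?_)
      rw [← StarHomClass.map_star, key, key, StarHomClass.map_star] }

lemma lift_ofHom (φ : A →⋆ₐ[ℂ] M) (hφ : ∀ a, ‖φ a‖ ≤ p a) (a : A) :
    lift p φ hφ (ofHom p a) = φ a :=
  liftCLM_ofHom p (f := φ.toAlgHom.toLinearMap) (C := 1)
    (fun a => by rw [one_mul]; exact hφ a) a

end Completion

end CStarSeminorm

/-! ### Universal properties of free *-algebras and of presented C*-algebras -/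

namespace FreeStarAlgebra

variable {X : Type*} {M : Type*} [CStarAlgebra M]

/-- The algebra homomorphism defined by the images of the generators. -/
def liftAlgHom (f : X → M) : FreeStarAlgebra X →ₐ[ℂ] M :=
  FreeAlgebra.lift ℂ (Sum.elim f fun x => star (f x))

lemma liftAlgHom_of (f : X → M) (s : X ⊕ X) :
    liftAlgHom f (of s) = Sum.elim f (fun x => star (f x)) s :=
  FreeAlgebra.lift_ι_apply (R := ℂ) (A := M) (Sum.elim f fun x => star (f x)) s

/-- The *-homomorphism defined by the images of the generators. -/
def lift (f : X → M) : FreeStarAlgebra X →⋆ₐ[ℂ] M :=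
  { liftAlgHom f with
    map_star' := fun a => by
      change liftAlgHom f (star a) = star (liftAlgHom f a)
      induction a using induction_of with
      | hc c => rw [star_algebraMap, AlgHom.commutes, AlgHom.commutes]; exact algebraMap_star_comm c
      | hg s =>
        rw [star_of, liftAlgHom_of, liftAlgHom_of]
        rcases s with x | x <;> simp
      | hm a b ha hb => rw [star_mul, map_mul, map_mul, star_mul, ha, hb]
      | ha a b ha hb => rw [star_add, map_add, map_add, star_add, ha, hb] }

@[simp]
lemma lift_gen (f : X → M) (x : X) : lift f (gen x) = f x :=
  liftAlgHom_of f (Sum.inl x)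

end FreeStarAlgebra

namespace CStarPresentation

variable {X : Type*} (P : CStarPresentation X) {M : Type*} [CStarAlgebra M]

/-- The universal property of a C*-algebra given by generators and relations. -/
def lift (f : X → M) (hf : ∀ r ∈ P.rels, FreeStarAlgebra.lift f r = 0) : P.Alg →⋆ₐ[ℂ] M :=
  CStarSeminorm.Completion.lift P.maxSeminorm (FreeStarAlgebra.lift f) fun a =>
    -- The pulled back norm vanishes on the relations, so it is a member of the family whose
    -- supremum is the maximal seminorm.
    le_ciSup (P.bounded' a) ⟨CStarSeminorm.ofStarAlgHom (FreeStarAlgebra.lift f),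
      fun r hr => (congrArg norm (hf r hr)).trans norm_zero⟩

@[simp]
lemma lift_gen (f : X → M) (hf : ∀ r ∈ P.rels, FreeStarAlgebra.lift f r = 0) (x : X) :
    P.lift f hf (P.gen x) = f x :=
  (CStarSeminorm.Completion.lift_ofHom _ _ _ _).trans (FreeStarAlgebra.lift_gen f x)

lemma denseRange_toAlg : DenseRange P.toAlg :=
  CStarSeminorm.Completion.denseRange_ofHom _

/-- A set that spans a subspace which contains `1` and whose closure is invariant under left
multiplication by the generators and their adjoints spans a dense subspace. -/
lemma dense_span_of_mul_mem {S : Set P.Alg} (h1 : 1 ∈ S)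
    (hg : ∀ x, ∀ s ∈ S, P.gen x * s ∈ (Submodule.span ℂ S).topologicalClosure)
    (hs : ∀ x, ∀ s ∈ S, star (P.gen x) * s ∈ (Submodule.span ℂ S).topologicalClosure) :
    (Submodule.span ℂ S).topologicalClosure = ⊤ := by
  set W := (Submodule.span ℂ S).topologicalClosure with hW
  have hWc : IsClosed (W : Set P.Alg) := Submodule.isClosed_topologicalClosure _
  have ext : ∀ b : P.Alg, (∀ s ∈ S, b * s ∈ W) → ∀ s ∈ W, b * s ∈ W := by
    intro b hb s hs
    have hle : W ≤ W.comap (LinearMap.mulLeft ℂ b) :=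
      Submodule.topologicalClosure_minimal _ (Submodule.span_le.2 hb)
        (hWc.preimage (continuous_const.mul continuous_id))
    exact hle hs
  -- The induction on `a` needs all of `W`, not only `S`, because a product acts by two successive
  -- multiplications. Applied to `s = 1` it shows that the dense image of the free *-algebra lies in
  -- `W`.
  have key : ∀ a : FreeStarAlgebra X, ∀ s ∈ W, P.toAlg a * s ∈ W := by
    intro a
    induction a using FreeStarAlgebra.induction with
    | hc c =>
      intro s hs
      have h : P.toAlg (algebraMap ℂ _ c) = algebraMap ℂ _ c := P.toAlg.toAlgHom.commutes c
      rw [h, ← Algebra.smul_def]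
      exact W.smul_mem c hs
    | hg x => exact ext _ (hg x)
    | hs x => rw [map_star]; exact ext _ (hs x)
    | hm a b ha hb => intro s hs; rw [map_mul, mul_assoc]; exact ha _ (hb s hs)
    | ha a b ha hb => intro s hs; rw [map_add, add_mul]; exact W.add_mem (ha s hs) (hb s hs)
  refine eq_top_iff.2 fun x _ => ?_
  refine P.denseRange_toAlg.induction_on (p := fun x => x ∈ W) x hWc fun a => ?_
  rw [← mul_one (P.toAlg a)]
  exact key a 1 (Submodule.le_topologicalClosure _ (Submodule.subset_span h1))

variable {P} in
lemma hom_ext {φ ψ : P.Alg →⋆ₐ[ℂ] M} (h : ∀ x, φ (P.gen x) = ψ (P.gen x)) : φ = ψ := by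
  have key : ∀ a : FreeStarAlgebra X, φ (P.toAlg a) = ψ (P.toAlg a) := by
    intro a
    induction a using FreeStarAlgebra.induction with
    | hc c =>
      have h : P.toAlg (algebraMap ℂ _ c) = algebraMap ℂ _ c := P.toAlg.toAlgHom.commutes c
      rw [h]
      exact (φ.toAlgHom.commutes c).trans (ψ.toAlgHom.commutes c).symm
    | hg x => exact h x
    | hs x => rw [map_star, map_star, map_star]; exact congrArg star (h x)
    | hm a b ha hb => rw [map_mul, map_mul, map_mul, ha, hb]
    | ha a b ha hb => rw [map_add, map_add, map_add, ha, hb]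
  refine StarAlgHom.ext fun x => ?_
  exact P.denseRange_toAlg.induction_on (p := fun x => φ x = ψ x) x
    (isClosed_eq φ.continuous_of_cstarAlgebra ψ.continuous_of_cstarAlgebra) key

end CStarPresentation

/-- The pullback of a representation under a *-homomorphism. -/
def HilbertRep.comap {A : Type u} {A' : Type v} [CStarAlgebra A] [CStarAlgebra A']
    (φ : A →⋆ₐ[ℂ] A') (π : HilbertRep.{w, v} A') : HilbertRep.{w, u} A where
  H := π.H
  hom := π.hom.comp φ

/-! ### Representations and functoriality of the minimal tensor product -/

namespace MinTensor

section

variable {A : Type u} {B : Type v} [CStarAlgebra A] [CStarAlgebra B]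

lemma denseRange_ofTensor : DenseRange (ofTensor A B) :=
  CStarSeminorm.Completion.denseRange_ofHom _

lemma norm_ofTensor (t : A ⊗[ℂ] B) : ‖ofTensor A B t‖ = minSeminorm A B t :=
  CStarSeminorm.Completion.norm_ofHom _ t

lemma repSeminorm_le (π : HilbertRep.{u, u} A) (σ : HilbertRep.{v, v} B) (t : A ⊗[ℂ] B) :
    repSeminorm π σ t ≤ minSeminorm A B t :=
  le_ciSup (repSeminorm_bddAbove t) (π, σ)

lemma dense_span_tmul :
    (Submodule.span ℂ {t | ∃ a b, t = ofTensor A B (a ⊗ₜ b)}).topologicalClosure = ⊤ := by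
  refine eq_top_iff.2 fun x _ => ?_
  refine denseRange_ofTensor.induction_on (p := fun x => x ∈ Submodule.topologicalClosure _) x
    (Submodule.isClosed_topologicalClosure _) fun t => ?_
  refine Submodule.le_topologicalClosure _ ?_
  induction t with
  | zero => rw [map_zero]; exact Submodule.zero_mem _
  | tmul a b => exact Submodule.subset_span ⟨a, b, rfl⟩
  | add s t hs ht => rw [map_add]; exact Submodule.add_mem _ hs ht

lemma clm_ext {E : Type*} [NormedAddCommGroup E] [NormedSpace ℂ E] {f g : MinTensor A B →L[ℂ] E}
    (h : ∀ a b, f (ofTensor A B (a ⊗ₜ b)) = g (ofTensor A B (a ⊗ₜ b))) : f = g :=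
  ContinuousLinearMap.eq_of_eqOn_dense_span dense_span_tmul (by rintro _ ⟨a, b, rfl⟩; exact h a b)

/-- The representation `π ⊗ σ` on the algebraic tensor product, as a *-homomorphism. -/
def tensorStarRep (π : HilbertRep.{u, u} A) (σ : HilbertRep.{v, v} B) :
    A ⊗[ℂ] B →⋆ₐ[ℂ] (HilbertTensor π.H σ.H →L[ℂ] HilbertTensor π.H σ.H) :=
  { tensorRep π σ with map_star' := tensorRep_star π σ }

/-- The representation `π ⊗ σ` of the minimal tensor product. -/
def rep (π : HilbertRep.{u, u} A) (σ : HilbertRep.{v, v} B) :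
    HilbertRep.{max u v, max u v} (MinTensor A B) where
  H := HilbertTensor π.H σ.H
  hom := CStarSeminorm.Completion.lift (minSeminorm A B) (tensorStarRep π σ) (repSeminorm_le π σ)

lemma rep_ofTensor (π : HilbertRep.{u, u} A) (σ : HilbertRep.{v, v} B) (t : A ⊗[ℂ] B) :
    (rep π σ).hom (ofTensor A B t) = tensorRep π σ t :=
  CStarSeminorm.Completion.lift_ofHom _ (tensorStarRep π σ) (repSeminorm_le π σ) t

end

section map

variable {A A' : Type u} {B B' : Type v} [CStarAlgebra A] [CStarAlgebra B] [CStarAlgebra A']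
  [CStarAlgebra B'] (φ : A →⋆ₐ[ℂ] A') (ψ : B →⋆ₐ[ℂ] B')

/-- The algebraic tensor product of *-homomorphisms. -/
def algMap : A ⊗[ℂ] B →⋆ₐ[ℂ] A' ⊗[ℂ] B' :=
  { Algebra.TensorProduct.map φ.toAlgHom ψ.toAlgHom with
    map_star' := fun t => by
      change Algebra.TensorProduct.map φ.toAlgHom ψ.toAlgHom (star t) =
        star (Algebra.TensorProduct.map φ.toAlgHom ψ.toAlgHom t)
      induction t with
      | zero => simp
      | add s t hs ht => rw [star_add, map_add, map_add, star_add, hs, ht]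
      | tmul a b =>
        rw [TensorProduct.star_tmul, Algebra.TensorProduct.map_tmul,
          Algebra.TensorProduct.map_tmul, TensorProduct.star_tmul]
        exact congrArg₂ _ (map_star φ a) (map_star ψ b) }

lemma algMap_tmul (a : A) (b : B) : algMap φ ψ (a ⊗ₜ b) = φ a ⊗ₜ ψ b := rfl

lemma tensorRep_algMap (π : HilbertRep.{u, u} A') (σ : HilbertRep.{v, v} B') (t : A ⊗[ℂ] B) :
    tensorRep π σ (algMap φ ψ t) =
      tensorRep (π.comap φ) (σ.comap ψ) t := by
  induction t with
  | zero => rw [_root_.map_zero, _root_.map_zero, _root_.map_zero]; rfl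
  | add s t hs ht =>
    rw [map_add, map_add, map_add]
    exact congrArg₂ (· + ·) hs ht
  | tmul a b => exact tensorRep_tmul π σ (φ a) (ψ b)

/-- Representations of `A'` and `B'` pull back to representations of `A` and `B`, so the supremum on
the left runs over part of the family on the right. This is why source and target share a universe:
the representations in the supremum live in the universe of the algebra. -/
lemma minSeminorm_algMap_le (t : A ⊗[ℂ] B) :
    minSeminorm A' B' (algMap φ ψ t) ≤ minSeminorm A B t := by
  refine Real.iSup_le (fun i => ?_) ((minSeminorm A B).nonneg t)
  refine le_of_eq_of_le ?_ (repSeminorm_le (i.1.comap φ) (i.2.comap ψ) t)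
  exact congrArg norm (tensorRep_algMap φ ψ i.1 i.2 t)

/-- The tensor product of *-homomorphisms. -/
def map : MinTensor A B →⋆ₐ[ℂ] MinTensor A' B' :=
  CStarSeminorm.Completion.lift (minSeminorm A B) ((ofTensor A' B').comp (algMap φ ψ))
    fun t => (norm_ofTensor _).trans_le (minSeminorm_algMap_le φ ψ t)

lemma map_ofTensor (t : A ⊗[ℂ] B) : map φ ψ (ofTensor A B t) = ofTensor A' B' (algMap φ ψ t) :=
  CStarSeminorm.Completion.lift_ofHom _ _ _ _

lemma map_inl (a : A) : map φ ψ (inl A B a) = inl A' B' (φ a) := by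
  refine (map_ofTensor φ ψ (a ⊗ₜ 1)).trans ?_
  rw [algMap_tmul, map_one]; rfl

lemma map_inr (b : B) : map φ ψ (inr A B b) = inr A' B' (ψ b) := by
  refine (map_ofTensor φ ψ (1 ⊗ₜ b)).trans ?_
  rw [algMap_tmul, map_one]; rfl

end map

end MinTensor

/-! ### Coefficient functionals of representations -/

namespace HilbertTensor

variable {E F : Type*} [NormedAddCommGroup E] [InnerProductSpace ℂ E]
  [NormedAddCommGroup F] [InnerProductSpace ℂ F]

lemma norm_mk_tmul (x : E) (y : F) : ‖mk (x ⊗ₜ[ℂ] y)‖ = ‖x‖ * ‖y‖ :=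
  (UniformSpace.Completion.norm_coe (E := E ⊗[ℂ] F) _).trans (TensorProduct.norm_tmul x y)

lemma eq_zero_of_inner_mk_tmul {v : HilbertTensor E F}
    (h : ∀ x y, inner ℂ (mk (x ⊗ₜ y)) v = 0) : v = 0 := by
  have key : ∀ w : HilbertTensor E F, inner ℂ w v = 0 := by
    intro w
    refine denseRange_mk.induction_on (p := fun w : HilbertTensor E F => inner ℂ w v = 0) w
      (isClosed_eq (continuous_id.inner continuous_const) continuous_const) fun t => ?_
    induction t with
    | zero => rw [mk_zero, inner_zero_left]
    | tmul x y => exact h x y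
    | add s t hs ht => rw [mk_add, inner_add_left, hs, ht, add_zero]
  exact inner_self_eq_zero.1 (key v)

end HilbertTensor

/-- A coefficient functional `a ↦ ⟪η, π(a) ξ⟫` of a representation. -/
structure CoefficientFunctional (A : Type u) [CStarAlgebra A] where
  rep : HilbertRep.{u, u} A
  source : rep.H
  target : rep.H

namespace CoefficientFunctional

section

variable {A : Type u} [CStarAlgebra A] (f : CoefficientFunctional A)

/-- The underlying bounded functional. -/
def toCLM : A →L[ℂ] ℂ :=
  (innerSL ℂ f.target).comp
    ((ContinuousLinearMap.apply ℂ f.rep.H f.source).comp f.rep.hom.toCLM)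

instance : CoeFun (CoefficientFunctional A) fun _ => A → ℂ := ⟨fun f => f.toCLM⟩

lemma apply_def (a : A) : f a = inner ℂ f.target (f.rep.hom a f.source) := rfl

/-- The pullback of a coefficient functional under a *-homomorphism. -/
def comap {A' : Type u} [CStarAlgebra A'] (φ : A' →⋆ₐ[ℂ] A) : CoefficientFunctional A' where
  rep := f.rep.comap φ
  source := f.source
  target := f.target

end

section

variable {A : Type u} {B : Type v} [CStarAlgebra A] [CStarAlgebra B]

/-- The tensor product of coefficient functionals. -/
def tensor (f : CoefficientFunctional A) (g : CoefficientFunctional B) :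
    CoefficientFunctional (MinTensor A B) where
  rep := MinTensor.rep f.rep g.rep
  source := HilbertTensor.mk (f.source ⊗ₜ g.source)
  target := HilbertTensor.mk (f.target ⊗ₜ g.target)

lemma tensor_ofTensor (f : CoefficientFunctional A) (g : CoefficientFunctional B) (a : A) (b : B) :
    f.tensor g (MinTensor.ofTensor A B (a ⊗ₜ b)) = f a * g b := by
  rw [apply_def]
  change inner ℂ (HilbertTensor.mk (f.target ⊗ₜ g.target))
    ((MinTensor.rep f.rep g.rep).hom (MinTensor.ofTensor A B (a ⊗ₜ b))
      (HilbertTensor.mk (f.source ⊗ₜ g.source))) = _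
  rw [MinTensor.rep_ofTensor, MinTensor.tensorRep_tmul]
  refine (congrArg _ (HilbertTensor.map_mk_tmul _ _ _ _)).trans ?_
  rw [HilbertTensor.inner_mk, TensorProduct.inner_tmul]
  rfl

end

/-- A family of coefficient functionals separates the points. -/
def Separating {A : Type u} [CStarAlgebra A] {ι : Type*} (F : ι → CoefficientFunctional A) : Prop :=
  ∀ a, (∀ i, F i a = 0) → a = 0

end CoefficientFunctional

/-- The norm is the supremum of the norms of the images under all representations. -/
class IsRepNormed (A : Type u) [CStarAlgebra A] : Prop where
  norm_le : ∀ (a : A) (c : ℝ), 0 ≤ c → (∀ π : HilbertRep.{u, u} A, ‖π.hom a‖ ≤ c) → ‖a‖ ≤ c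

/-- Injective *-homomorphisms are isometric, and the representations of `A'` restrict to `A` along
`φ`. -/
lemma IsRepNormed.of_injective {A A' : Type u} [CStarAlgebra A] [CStarAlgebra A'] [IsRepNormed A']
    (φ : A →⋆ₐ[ℂ] A') (hφ : Function.Injective φ) : IsRepNormed A where
  norm_le a c hc h := by
    rw [← NonUnitalStarAlgHom.norm_map φ hφ]
    exact IsRepNormed.norm_le _ _ hc fun π => h (π.comap φ)

/-! ### Slice maps and separating families of functionals -/

namespace MinTensor

open CoefficientFunctional

variable {A : Type u} {B : Type v} [CStarAlgebra A] [CStarAlgebra B]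

/-- On algebraic tensors this is the definition of the minimal norm; approximation within `ε / 2`
extends the bound to the completion. -/
lemma norm_le_of_rep (t : MinTensor A B) (c : ℝ) (hc : 0 ≤ c)
    (h : ∀ (π : HilbertRep.{u, u} A) (σ : HilbertRep.{v, v} B), ‖(rep π σ).hom t‖ ≤ c) :
    ‖t‖ ≤ c := by
  refine le_of_forall_pos_le_add fun ε hε => ?_
  obtain ⟨s, hs⟩ := (Metric.denseRange_iff.1 (denseRange_ofTensor (A := A) (B := B))) t (ε / 2)
    (half_pos hε)
  rw [dist_eq_norm] at hs
  have h1 : ‖ofTensor A B s‖ ≤ c + ε / 2 := by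
    rw [norm_ofTensor]
    refine Real.iSup_le (fun i => ?_) (by positivity)
    have h2 : ‖(rep i.1 i.2).hom (ofTensor A B s)‖ ≤ c + ε / 2 := by
      have h3 : ofTensor A B s = t - (t - ofTensor A B s) := by abel
      rw [h3, map_sub]
      refine (norm_sub_le _ _).trans (add_le_add (h _ _) ?_)
      exact (NonUnitalStarAlgHom.norm_apply_le _ _).trans hs.le
    rw [rep_ofTensor] at h2
    exact h2
  calc ‖t‖ = ‖(t - ofTensor A B s) + ofTensor A B s‖ := by rw [sub_add_cancel]
    _ ≤ ε / 2 + (c + ε / 2) := (norm_add_le _ _).trans (add_le_add hs.le h1)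
    _ = c + ε := by ring

/-- The operators `π ⊗ σ` that define the minimal norm come from representations of the completion.
No assumption on `A` and `B` enters, so the property is available for all iterated constructions
that involve a tensor product. -/
instance : IsRepNormed (MinTensor A B) where
  norm_le t c hc h := norm_le_of_rep t c hc fun π σ => h (rep π σ)

/-- The products of coefficient functionals separate the points of the minimal tensor product. -/
lemma eq_zero_of_tensor {t : MinTensor A B}
    (h : ∀ (f : CoefficientFunctional A) (g : CoefficientFunctional B), f.tensor g t = 0) :
    t = 0 := by
  refine norm_le_zero_iff.1 (norm_le_of_rep t 0 le_rfl fun π σ => norm_le_zero_iff.2 ?_)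
  refine HilbertTensor.ext fun x y => ?_
  exact HilbertTensor.eq_zero_of_inner_mk_tmul fun x' y' => h ⟨π, x, x'⟩ ⟨σ, y, y'⟩

section slice

/-- `T` is a compression of `S` along `i` and `j`; testing against `y = T x` bounds `‖T x‖`. It is
applied with `i` and `j` tensoring by fixed vectors, which is where the scale factors `p` and `q`
come from. -/
lemma norm_le_of_inner {H K : Type*} [NormedAddCommGroup H] [InnerProductSpace ℂ H]
    [NormedAddCommGroup K] [InnerProductSpace ℂ K] (T : H →L[ℂ] H) (S : K →L[ℂ] K)
    (i j : H → K) (p q : ℝ) (hp : 0 ≤ p) (hq : 0 ≤ q) (hi : ∀ x, ‖i x‖ = ‖x‖ * p)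
    (hj : ∀ x, ‖j x‖ = ‖x‖ * q)
    (h : ∀ x y, inner ℂ y (T x) = inner ℂ (j y) (S (i x))) : ‖T‖ ≤ p * q * ‖S‖ := by
  refine T.opNorm_le_bound (by positivity) fun x => ?_
  rcases (norm_nonneg (T x)).eq_or_lt with h0 | h0
  · rw [← h0]; positivity
  refine le_of_mul_le_mul_left ?_ h0
  calc ‖T x‖ * ‖T x‖ = RCLike.re (inner ℂ (T x) (T x)) :=
        (inner_self_eq_norm_mul_norm (𝕜 := ℂ) (T x)).symm
    _ ≤ ‖inner ℂ (T x) (T x)‖ := RCLike.re_le_norm _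
    _ ≤ ‖j (T x)‖ * ‖S (i x)‖ := by rw [h]; exact norm_inner_le_norm _ _
    _ ≤ (‖T x‖ * q) * (‖S‖ * (‖x‖ * p)) := by
        rw [hj]
        exact mul_le_mul_of_nonneg_left ((S.le_opNorm _).trans_eq (by rw [hi])) (by positivity)
    _ = _ := by ring

/-- The algebraic slice map `a ⊗ b ↦ g(b) a`. -/
def algSliceRight (g : B →ₗ[ℂ] ℂ) : A ⊗[ℂ] B →ₗ[ℂ] A :=
  (TensorProduct.rid ℂ A).toLinearMap ∘ₗ TensorProduct.map LinearMap.id g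

/-- The algebraic slice map `a ⊗ b ↦ f(a) b`. -/
def algSliceLeft (f : A →ₗ[ℂ] ℂ) : A ⊗[ℂ] B →ₗ[ℂ] B :=
  (TensorProduct.lid ℂ B).toLinearMap ∘ₗ TensorProduct.map f LinearMap.id

/-- For each representation `π` of `A`, the image under `π` of the slice is the compression of the
operator of `t` under `π ⊗ g.rep` by the maps `x ↦ x ⊗ g.source` and `y ↦ y ⊗ g.target`. The norm of
the slice in `A` is recovered from all such `π`, hence the hypothesis `IsRepNormed A`. -/
lemma norm_algSliceRight_le [IsRepNormed A] (g : CoefficientFunctional B) (t : A ⊗[ℂ] B) :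
    ‖algSliceRight g.toCLM.toLinearMap t‖ ≤ ‖g.source‖ * ‖g.target‖ * minSeminorm A B t := by
  have h0 := (minSeminorm A B).nonneg t
  refine IsRepNormed.norm_le _ _ (by positivity) fun π => ?_
  refine (norm_le_of_inner _ (tensorRep π g.rep t) (fun x => HilbertTensor.mk (x ⊗ₜ g.source))
    (fun x => HilbertTensor.mk (x ⊗ₜ g.target)) ‖g.source‖ ‖g.target‖ (norm_nonneg _)
    (norm_nonneg _) (fun x => HilbertTensor.norm_mk_tmul _ _)
    (fun x => HilbertTensor.norm_mk_tmul _ _) fun x y => ?_).trans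
    (mul_le_mul_of_nonneg_left (repSeminorm_le π g.rep t) (by positivity))
  clear h0
  induction t with
  | zero => simp
  | add s t hs ht =>
    rw [map_add, map_add, map_add, add_apply, add_apply, inner_add_right, inner_add_right, hs, ht]
  | tmul a b =>
    rw [tensorRep_tmul, HilbertTensor.map_mk_tmul, HilbertTensor.inner_mk,
      TensorProduct.inner_tmul]
    change inner ℂ y (π.hom (g b • a) x) = _
    rw [map_smul, smul_apply, inner_smul_right, mul_comm]; rfl

lemma norm_algSliceLeft_le [IsRepNormed B] (f : CoefficientFunctional A) (t : A ⊗[ℂ] B) :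
    ‖algSliceLeft f.toCLM.toLinearMap t‖ ≤ ‖f.source‖ * ‖f.target‖ * minSeminorm A B t := by
  have h0 := (minSeminorm A B).nonneg t
  refine IsRepNormed.norm_le _ _ (by positivity) fun π => ?_
  refine (norm_le_of_inner _ (tensorRep f.rep π t) (fun x => HilbertTensor.mk (f.source ⊗ₜ x))
    (fun x => HilbertTensor.mk (f.target ⊗ₜ x)) ‖f.source‖ ‖f.target‖ (norm_nonneg _)
    (norm_nonneg _) (fun x => (HilbertTensor.norm_mk_tmul _ _).trans (mul_comm _ _))
    (fun x => (HilbertTensor.norm_mk_tmul _ _).trans (mul_comm _ _)) fun x y => ?_).trans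
    (mul_le_mul_of_nonneg_left (repSeminorm_le f.rep π t) (by positivity))
  clear h0
  induction t with
  | zero => simp
  | add s t hs ht =>
    rw [map_add, map_add, map_add, add_apply, add_apply, inner_add_right, inner_add_right, hs, ht]
  | tmul a b =>
    rw [tensorRep_tmul, HilbertTensor.map_mk_tmul, HilbertTensor.inner_mk,
      TensorProduct.inner_tmul]
    change inner ℂ y (π.hom (f a • b) x) = _
    rw [map_smul, smul_apply, inner_smul_right]; rfl

/-- The slice map `a ⊗ b ↦ g(b) a`. -/
def sliceRight (g : CoefficientFunctional B) : MinTensor A B →L[ℂ] A :=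
  CStarSeminorm.Completion.liftCLM (minSeminorm A B) (algSliceRight g.toCLM.toLinearMap)

/-- The slice map `a ⊗ b ↦ f(a) b`. -/
def sliceLeft (f : CoefficientFunctional A) : MinTensor A B →L[ℂ] B :=
  CStarSeminorm.Completion.liftCLM (minSeminorm A B) (algSliceLeft f.toCLM.toLinearMap)

lemma sliceRight_ofTensor [IsRepNormed A] (g : CoefficientFunctional B) (a : A) (b : B) :
    sliceRight g (ofTensor A B (a ⊗ₜ b)) = g b • a :=
  CStarSeminorm.Completion.liftCLM_ofHom (minSeminorm A B) (norm_algSliceRight_le g) (a ⊗ₜ b)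

lemma sliceLeft_ofTensor [IsRepNormed B] (f : CoefficientFunctional A) (a : A) (b : B) :
    sliceLeft f (ofTensor A B (a ⊗ₜ b)) = f a • b :=
  CStarSeminorm.Completion.liftCLM_ofHom (minSeminorm A B) (norm_algSliceLeft_le f) (a ⊗ₜ b)

lemma apply_sliceRight [IsRepNormed A] (f : CoefficientFunctional A) (g : CoefficientFunctional B)
    (t : MinTensor A B) : f (sliceRight g t) = f.tensor g t := by
  refine DFunLike.congr_fun (clm_ext (f := f.toCLM.comp (sliceRight g))
    (g := (f.tensor g).toCLM) fun a b => ?_) t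
  rw [ContinuousLinearMap.comp_apply, sliceRight_ofTensor, tensor_ofTensor, map_smul, smul_eq_mul,
    mul_comm]

lemma apply_sliceLeft [IsRepNormed B] (f : CoefficientFunctional A) (g : CoefficientFunctional B)
    (t : MinTensor A B) : g (sliceLeft f t) = f.tensor g t := by
  refine DFunLike.congr_fun (clm_ext (f := g.toCLM.comp (sliceLeft f))
    (g := (f.tensor g).toCLM) fun a b => ?_) t
  rw [ContinuousLinearMap.comp_apply, sliceLeft_ofTensor, tensor_ofTensor, map_smul, smul_eq_mul]

end slice

variable {ι κ : Type*}

/-- The products of the members of a separating family with all coefficient functionals of the right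
factor are separating. -/
lemma separating_tensor_right [IsRepNormed A] {F : ι → CoefficientFunctional A}
    (hF : Separating F) :
    Separating fun i : ι × CoefficientFunctional B => (F i.1).tensor i.2 := by
  intro t h
  refine eq_zero_of_tensor fun f g => ?_
  -- Slicing by an arbitrary `g` reduces the question to an element of `A`, on which the given
  -- family separates.
  have h1 : sliceRight g t = 0 := hF _ fun i => (apply_sliceRight (F i) g t).trans (h (i, g))
  rw [← apply_sliceRight, h1, map_zero]

/-- The products of all coefficient functionals of the left factor with the members of a separating
family are separating. -/
lemma separating_tensor_left [IsRepNormed B] {G : κ → CoefficientFunctional B}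
    (hG : Separating G) :
    Separating fun i : CoefficientFunctional A × κ => i.1.tensor (G i.2) := by
  intro t h
  refine eq_zero_of_tensor fun f g => ?_
  have h1 : sliceLeft f t = 0 := hG _ fun i => (apply_sliceLeft f (G i) t).trans (h (f, i))
  rw [← apply_sliceLeft, h1, map_zero]

lemma separating_tensor [IsRepNormed A] [IsRepNormed B] {F : ι → CoefficientFunctional A}
    (hF : Separating F) {G : κ → CoefficientFunctional B} (hG : Separating G) :
    Separating fun i : ι × κ => (F i.1).tensor (G i.2) := by
  intro t h
  refine separating_tensor_right (B := B) hF t fun i => ?_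
  have h1 : sliceLeft (F i.1) t = 0 :=
    hG _ fun j => (apply_sliceLeft (F i.1) (G j) t).trans (h (i.1, j))
  rw [← apply_sliceLeft, h1, map_zero]

end MinTensor

/-! ### Coactions from families of endomorphisms, and spectral components -/

namespace CircleCoaction

variable {X : Type*} [CStarAlgebra X]

section ofFamily

variable (α : Circle → X →⋆ₐ[ℂ] X)
  (hα : (Submodule.span ℂ {x | ∃ n : ℤ, ∀ z, α z x =
    ((z ^ n : Circle) : ℂ) • x}).topologicalClosure = ⊤)

include hα in
-- The maps `α z` are contractive, so approximating `x` by sums of homogeneous elements approximates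
-- its orbit uniformly by trigonometric polynomials.
lemma continuous_family (x : X) : Continuous fun z => α z x := by
  refine continuous_of_uniform_approx_of_continuous fun V hV => ?_
  obtain ⟨ε, hε, hV⟩ := Metric.mem_uniformity_dist.1 hV
  have hx : x ∈ (Submodule.span ℂ {x | ∃ n : ℤ, ∀ z, α z x =
    ((z ^ n : Circle) : ℂ) • x}).topologicalClosure := by rw [hα]; trivial
  obtain ⟨s, hs, hd⟩ := Metric.mem_closure_iff.1 hx ε hε
  refine ⟨fun z => α z s, ?_, fun z => hV ?_⟩
  · refine Submodule.span_induction (p := fun s _ => Continuous fun z => α z s) ?_ ?_ ?_ ?_ hs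
    · rintro s ⟨n, hn⟩
      simp only [hn]
      exact (circlePow n).continuous.smul continuous_const
    · simp only [map_zero]; exact continuous_const
    · intro a b _ _ ha hb
      simp only [map_add]
      exact ha.add hb
    · intro c a _ ha
      simp only [map_smul]
      exact ha.const_smul c
  · rw [dist_eq_norm, ← map_sub]
    rw [dist_eq_norm] at hd
    exact (NonUnitalStarAlgHom.norm_apply_le (α z) (x - s)).trans_lt hd

/-- The map `x ↦ (z ↦ α_z(x))`. -/
def familyHom : X →⋆ₐ[ℂ] C(Circle, X) where
  toFun x := ⟨fun z => α z x, continuous_family α hα x⟩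
  map_one' := by ext z; exact map_one (α z)
  map_mul' x y := by ext z; exact map_mul (α z) x y
  map_zero' := by ext z; exact map_zero (α z)
  map_add' x y := by ext z; exact map_add (α z) x y
  commutes' c := by ext z; exact (α z).toAlgHom.commutes c
  map_star' x := by ext z; exact map_star (α z) x

/-- The coaction defined by a family of *-homomorphisms, provided that the elements which
transform like homogeneous ones span a dense subspace. -/
def ofFamily : CircleCoaction X where
  toHom := familyHom α hα
  coassoc x z w := by
    change ((α z).comp (α w)) x = α (z * w) x
    refine DFunLike.congr_fun (StarAlgHom.eq_of_eqOn_dense_span hα ?_) x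
    rintro y ⟨n, hn⟩
    rw [StarAlgHom.comp_apply, hn, map_smul, hn, hn, smul_smul, mul_zpow, Circle.coe_mul, mul_comm]
  podles := by
    set W := closedMul (Set.range (familyHom α hα)) (Set.range (CFun.scalarHom Circle X))
    have hW : IsClosed (W : Set C(Circle, X)) := Submodule.isClosed_topologicalClosure _
    have key : ∀ (f : C(Circle, ℂ)) (x : X),
        CFun.constHom Circle X x * CFun.scalarHom Circle X f ∈ W := by
      intro f
      refine ContinuousLinearMap.apply_mem_of_dense_span hα
        (f := ((ContinuousLinearMap.mul ℂ C(Circle, X)).flip (CFun.scalarHom Circle X f)).comp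
          (CFun.constHom Circle X).toCLM) hW ?_
      rintro x ⟨n, hn⟩
      -- For `x` of degree `n` one has `x ⊗ f = ρ(x) (1 ⊗ z^(-n) f)`, which gives the Podleś
      -- condition on a dense subspace.
      refine Submodule.le_topologicalClosure _ (Submodule.subset_span
        ⟨_, ⟨x, rfl⟩, _, ⟨circlePow (-n) * f, rfl⟩, ?_⟩)
      ext z
      change x * algebraMap ℂ X (f z) = α z x * algebraMap ℂ X (((z ^ (-n) : Circle) : ℂ) * f z)
      rw [hn, ← Algebra.commutes, ← Algebra.commutes, ← Algebra.smul_def, ← Algebra.smul_def,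
        smul_smul, mul_assoc, mul_comm (f z), ← mul_assoc, ← Circle.coe_mul, ← zpow_add,
        neg_add_cancel, zpow_zero, Circle.coe_one, one_mul]
    refine eq_top_iff.2 fun F _ => ?_
    refine CFun.denseRange_tensorHom.induction_on (p := fun F => F ∈ W) F hW fun t => ?_
    induction t with
    | zero => rw [map_zero]; exact W.zero_mem
    | add s t hs ht => rw [map_add]; exact W.add_mem hs ht
    | tmul x f =>
      have h : CFun.tensorHom Circle X (x ⊗ₜ f) =
          CFun.constHom Circle X x * CFun.scalarHom Circle X f := by
        ext z
        rw [CFun.tensorHom_tmul, ContinuousMap.mul_apply, CFun.constHom_apply,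
          CFun.scalarHom_apply, ← Algebra.commutes, Algebra.smul_def]
      rw [h]
      exact key f x

end ofFamily

section component

variable (ρ : CircleCoaction X)

open MeasureTheory in
/-- The component of degree `n`, as a continuous linear map. -/
def componentCLM (n : ℤ) : X →L[ℂ] X :=
  LinearMap.mkContinuous
    { toFun := ρ.component n
      map_add' := fun x y => by
        have h := congrFun (fourierCoeff.add (T := 1) (integrable_of_continuous
          (ρ.continuous_orbit x)) (integrable_of_continuous (ρ.continuous_orbit y))) n
        refine Eq.trans ?_ h
        rw [component]
        congr 1
        funext t
        rw [map_add]; rfl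
      map_smul' := fun c x => by
        refine Eq.trans ?_ (fourierCoeff.const_smul (T := 1)
          (fun t => ρ.toHom x t.toCircle) c n)
        rw [component]
        congr 1
        funext t
        rw [map_smul]; rfl } 1 fun x => by
    rw [one_mul]
    change ‖fourierCoeff (T := 1) (fun t => ρ.toHom x t.toCircle) n‖ ≤ ‖x‖
    rw [fourierCoeff]
    refine (norm_integral_le_of_norm_le_const (C := ‖x‖) (Filter.Eventually.of_forall
      fun t => ?_)).trans_eq (by simp)
    rw [norm_smul]
    have h1 : ‖(fourier (-n) t : ℂ)‖ = 1 := by rw [fourier_apply]; exact Circle.norm_coe _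
    rw [h1, one_mul]
    exact ((ρ.toHom x).norm_coe_le_norm _).trans (NonUnitalStarAlgHom.norm_apply_le ρ.toHom x)

lemma componentCLM_apply (n : ℤ) (x : X) : ρ.componentCLM n x = ρ.component n x := rfl

variable {ρ} in
lemma IsHomogeneous.component {k : ℤ} {x : X} (hx : ρ.IsHomogeneous k x) (n : ℤ) :
    ρ.component n x = if n = k then x else 0 := by
  have h1 : (fun t : AddCircle (1 : ℝ) => ρ.toHom x t.toCircle) =
      fun t => (fourier k t : ℂ) • x := by
    funext t
    rw [hx, fourier_apply, AddCircle.toCircle_zsmul]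
  rw [CircleCoaction.component, h1]
  have h2 : fourierCoeff (T := 1) (fun t => (fourier k t : ℂ) • x) n =
      fourierCoeff (T := 1) (fourier k) n • x := by
    simp only [fourierCoeff]
    rw [← integral_smul_const]
    simp only [smul_smul, smul_eq_mul]
  rw [h2, fourierCoeff_fourier]
  split_ifs with h
  · rw [h, Pi.single_eq_same, one_smul]
  · rw [Pi.single_eq_of_ne h, zero_smul]

/-- An element is determined by its components. -/
lemma eq_zero_of_component {x : X} (hx : ∀ n, ρ.component n x = 0) : x = 0 := by
  obtain ⟨g, -, hg⟩ := exists_dual_vector'' ℂ x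
  -- Along the orbit of `x`, the functional `g` that norms `x` is a continuous function whose
  -- Fourier coefficients are the values of `g` at the components. They all vanish, hence are
  -- summable, so the Fourier series converges to `f` at `0`, and `f 0 = g x = ‖x‖`.
  let f : C(AddCircle (1 : ℝ), ℂ) :=
    ⟨fun t => g (ρ.toHom x t.toCircle), g.continuous.comp (ρ.continuous_orbit x)⟩
  have hf : ∀ n, fourierCoeff f n = 0 := fun n => by
    have h : fourierCoeff f n = g (ρ.component n x) := by
      rw [component, fourierCoeff, fourierCoeff, ← ContinuousLinearMap.integral_comp_comm]
      · simp only [map_smul]; rfl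
      · exact integrable_of_continuous
          (((fourier (-n)).continuous).smul (ρ.continuous_orbit x))
    rw [h, hx, map_zero]
  have h0 := has_pointwise_sum_fourier_series_of_summable (f := f)
    (by rw [show fourierCoeff f = fun _ => (0 : ℂ) from funext hf]; exact summable_zero) 0
  simp only [hf, zero_smul] at h0
  have h1 : g (ρ.toHom x (AddCircle.toCircle 0)) = 0 := h0.unique hasSum_zero
  rw [AddCircle.toCircle_zero, ρ.act_one, hg] at h1
  exact norm_eq_zero.1 (Complex.ofReal_eq_zero.1 h1)

/-- The *-endomorphism `ρ_z`. -/
def act (z : Circle) : X →⋆ₐ[ℂ] X where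
  toFun x := ρ.toHom x z
  map_one' := by rw [map_one]; rfl
  map_mul' x y := by rw [map_mul]; rfl
  map_zero' := by rw [map_zero]; rfl
  map_add' x y := by rw [map_add]; rfl
  commutes' c := congrArg (fun F : C(Circle, X) => F z) (ρ.toHom.toAlgHom.commutes c)
  map_star' x := by rw [map_star]; rfl

lemma act_apply (z : Circle) (x : X) : ρ.act z x = ρ.toHom x z := rfl

/-- This holds because the circle group is commutative. It allows the coaction on `X ⊠_ζ Y` to be
built from the maps `ρX_z ⊠_ζ ρY_z`. -/
lemma isEquivariant_act (z : Circle) : ρ.IsEquivariant ρ (ρ.act z) := fun x w => by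
  rw [act_apply, act_apply, ρ.coassoc, ρ.coassoc, mul_comm]

variable {ρ} in
lemma IsHomogeneous.map {Y : Type*} [CStarAlgebra Y] {ρY : CircleCoaction Y} {φ : X →⋆ₐ[ℂ] Y}
    (hφ : ρ.IsEquivariant ρY φ) {k : ℤ} {x : X} (hx : ρ.IsHomogeneous k x) :
    ρY.IsHomogeneous k (φ x) := fun z => by rw [hφ, hx, map_smul]

end component

end CircleCoaction

/-! ### Powers of unitaries and weighted permutation operators -/

lemma Unitary.map_zpow_of_eq {A B : Type*} [CStarAlgebra A] [CStarAlgebra B] (φ : A →⋆ₐ[ℂ] B)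
    {U : unitary A} {W : unitary B} (h : φ U = W) (n : ℤ) :
    φ (U ^ n : unitary A) = (W ^ n : unitary B) := by
  rcases n with m | m
  · rw [Int.ofNat_eq_natCast, zpow_natCast, zpow_natCast, SubmonoidClass.coe_pow, map_pow, h,
      SubmonoidClass.coe_pow]
  · rw [zpow_negSucc, zpow_negSucc, ← Unitary.star_eq_inv, ← Unitary.star_eq_inv,
      Unitary.coe_star, Unitary.coe_star, map_star, SubmonoidClass.coe_pow, map_pow, h,
      SubmonoidClass.coe_pow]

lemma zpow_smul_of_shift {G α : Type*} [Group G] [MulAction G α] {g : G} {f : ℤ → α}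
    (h : ∀ r, g • f r = f (r + 1)) (n r : ℤ) : g ^ n • f r = f (r + n) := by
  induction n using Int.induction_on generalizing r with
  | zero => rw [zpow_zero, one_smul, add_zero]
  | succ k ih => rw [zpow_add_one, mul_smul, h, ih]; congr 1; ring
  | pred k ih =>
    have h1 : g⁻¹ • f r = f (r - 1) := by rw [inv_smul_eq_iff, h, sub_add_cancel]
    rw [zpow_sub_one, mul_smul, h1, ih]; congr 1; ring

namespace HilbertBasis

variable {ι H : Type*} [NormedAddCommGroup H] [InnerProductSpace ℂ H] (b : HilbertBasis ι ℂ H)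
  (e : ι ≃ ι) (c : ι → Circle)

/-- The image of a Hilbert basis under a weighted permutation. -/
def weightedPerm [CompleteSpace H] : HilbertBasis ι ℂ H :=
  HilbertBasis.mk (v := fun i => (c i : ℂ) • b (e i))
    (by
      refine ⟨fun i => ?_, fun i j hij => ?_⟩
      · rw [norm_smul, Circle.norm_coe, one_mul]
        exact b.orthonormal.1 _
      · change inner ℂ ((c i : ℂ) • b (e i)) ((c j : ℂ) • b (e j)) = 0
        rw [inner_smul_left, inner_smul_right, b.orthonormal.2 (e.injective.ne hij), mul_zero,
          mul_zero])
    (by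
      rw [← b.dense_span]
      refine Submodule.topologicalClosure_mono (Submodule.span_le.2 ?_)
      rintro _ ⟨i, rfl⟩
      have h : b i = ((c (e.symm i))⁻¹ : Circle) •
          ((c (e.symm i) : Circle) : ℂ) • b (e (e.symm i)) := by
        rw [Equiv.apply_symm_apply, Circle.smul_def, smul_smul, ← Circle.coe_mul, inv_mul_cancel,
          Circle.coe_one, one_smul]
      rw [h, Circle.smul_def]
      exact Submodule.smul_mem _ _ (Submodule.subset_span ⟨e.symm i, rfl⟩))

/-- The unitary operator `b i ↦ c i • b (e i)`. -/
def weightedPermUnitary [CompleteSpace H] : unitary (H →L[ℂ] H) :=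
  Unitary.linearIsometryEquiv.symm (b.repr.trans (b.weightedPerm e c).repr.symm)

lemma weightedPermUnitary_apply [CompleteSpace H] (i : ι) :
    (b.weightedPermUnitary e c : H →L[ℂ] H) (b i) = (c i : ℂ) • b (e i) := by
  classical
  change (b.weightedPerm e c).repr.symm (b.repr (b i)) = _
  rw [b.repr_self, HilbertBasis.repr_symm_single]
  exact congrFun (HilbertBasis.coe_mk _ _) i

end HilbertBasis

/-! ### The noncommutative torus: gauge actions, regular representation, Fourier coefficients -/

namespace NCTorus

variable (ζ : Circle)

section lift

variable {ζ} {M : Type*} [CStarAlgebra M]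

/-- The *-homomorphism defined by two unitaries `u` and `v` with `v u = ζ u v`. -/
def lift (u v : unitary M) (h : (v : M) * u = (ζ : ℂ) • ((u : M) * v)) : NCTorus ζ →⋆ₐ[ℂ] M :=
  (presentation ζ).lift (fun i => ((![u, v] i : unitary M) : M)) (by
    rintro r (⟨i, rfl⟩ | ⟨i, rfl⟩ | rfl)
    · rw [map_sub, map_mul, map_star, FreeStarAlgebra.lift_gen, map_one, sub_eq_zero]
      exact Unitary.coe_star_mul_self _
    · rw [map_sub, map_mul, map_star, FreeStarAlgebra.lift_gen, map_one, sub_eq_zero]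
      exact Unitary.coe_mul_star_self _
    · rw [map_sub, map_smul, map_mul, map_mul, FreeStarAlgebra.lift_gen, FreeStarAlgebra.lift_gen,
        sub_eq_zero]
      exact h)

lemma lift_U (u v : unitary M) (h : (v : M) * u = (ζ : ℂ) • ((u : M) * v)) :
    lift u v h (U ζ) = u :=
  (presentation ζ).lift_gen _ _ 0

lemma lift_V (u v : unitary M) (h : (v : M) * u = (ζ : ℂ) • ((u : M) * v)) :
    lift u v h (V ζ) = v :=
  (presentation ζ).lift_gen _ _ 1

end lift

/-- The monomials `U ^ p V ^ q`. -/
def monomial (p q : ℤ) : NCTorus ζ :=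
  ((U ζ ^ p : unitary (NCTorus ζ)) : NCTorus ζ) * (V ζ ^ q : unitary (NCTorus ζ))

/-- Left multiplication by powers of `U` shifts a monomial, and by powers of `V` it does so up to a
scalar, by the commutation relation. Thus the span is stable under the generators and their
adjoints. -/
lemma dense_span_monomial :
    (Submodule.span ℂ {t | ∃ p q, t = monomial ζ p q}).topologicalClosure = ⊤ := by
  have hU : ∀ k p q, ((U ζ ^ k : unitary (NCTorus ζ)) : NCTorus ζ) * monomial ζ p q =
      monomial ζ (k + p) q := fun k p q => by
    rw [monomial, monomial, zpow_add, ← mul_assoc]; rfl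
  have hV : ∀ k p q, ((V ζ ^ k : unitary (NCTorus ζ)) : NCTorus ζ) * monomial ζ p q =
      ((ζ ^ (k * p) : Circle) : ℂ) • monomial ζ p (k + q) := fun k p q => by
    rw [monomial, monomial, zpow_add, ← mul_assoc, V_zpow_mul_U_zpow, smul_mul_assoc, mul_assoc]
    rfl
  set W := (Submodule.span ℂ {t | ∃ p q, t = monomial ζ p q}).topologicalClosure
  have mU : ∀ k p q : ℤ, ((U ζ ^ k : unitary (NCTorus ζ)) : NCTorus ζ) * monomial ζ p q ∈ W :=
    fun k p q => by
      rw [hU]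
      exact Submodule.le_topologicalClosure _ (Submodule.subset_span ⟨_, _, rfl⟩)
  have mV : ∀ k p q : ℤ, ((V ζ ^ k : unitary (NCTorus ζ)) : NCTorus ζ) * monomial ζ p q ∈ W :=
    fun k p q => by
      rw [hV]
      exact Submodule.le_topologicalClosure _
        (Submodule.smul_mem _ _ (Submodule.subset_span ⟨_, _, rfl⟩))
  have e1 : ∀ u : unitary (NCTorus ζ), ((u ^ (1 : ℤ) : unitary (NCTorus ζ)) : NCTorus ζ) = u :=
    fun u => by rw [zpow_one]
  have e2 : ∀ u : unitary (NCTorus ζ), ((u ^ (-1 : ℤ) : unitary (NCTorus ζ)) : NCTorus ζ) =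
      star (u : NCTorus ζ) := fun u => by
    rw [zpow_neg_one, ← Unitary.star_eq_inv, Unitary.coe_star]
  refine CStarPresentation.dense_span_of_mul_mem (presentation ζ) ⟨0, 0, ?_⟩ ?_ ?_
  · rw [monomial, zpow_zero, zpow_zero]; exact (one_mul 1).symm
  · rintro i _ ⟨p, q, rfl⟩
    have h1 := mU 1 p q
    have h2 := mV 1 p q
    rw [e1] at h1 h2
    fin_cases i
    · exact h1
    · exact h2
  · rintro i _ ⟨p, q, rfl⟩
    have h1 := mU (-1) p q
    have h2 := mV (-1) p q
    rw [e2] at h1 h2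
    fin_cases i
    · exact h1
    · exact h2

section gauge

/-- The gauge automorphism `U ↦ z U`, `V ↦ w V`. -/
def gauge (z w : Circle) : NCTorus ζ →⋆ₐ[ℂ] NCTorus ζ :=
  lift (scalarUnitary _ z * U ζ) (scalarUnitary _ w * V ζ) (by
    change algebraMap ℂ (NCTorus ζ) w * (V ζ : NCTorus ζ) *
      (algebraMap ℂ (NCTorus ζ) z * (U ζ : NCTorus ζ)) = (ζ : ℂ) •
      (algebraMap ℂ (NCTorus ζ) z * (U ζ : NCTorus ζ) *
      (algebraMap ℂ (NCTorus ζ) w * (V ζ : NCTorus ζ)))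
    simp only [← Algebra.smul_def, smul_mul_assoc, mul_smul_comm, V_mul_U, smul_smul]
    congr 1
    ring)

lemma gauge_monomial (z w : Circle) (p q : ℤ) :
    gauge ζ z w (monomial ζ p q) = ((z ^ p * w ^ q : Circle) : ℂ) • monomial ζ p q := by
  have hc : ∀ w u, Commute (scalarUnitary (NCTorus ζ) w) u := fun w u =>
    Subtype.ext (Algebra.commutes (w : ℂ) (u : NCTorus ζ))
  have hU : gauge ζ z w (U ζ) = (scalarUnitary _ z * U ζ : unitary (NCTorus ζ)) := lift_U _ _ _
  have hV : gauge ζ z w (V ζ) = (scalarUnitary _ w * V ζ : unitary (NCTorus ζ)) := lift_V _ _ _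
  rw [monomial, map_mul, Unitary.map_zpow_of_eq _ hU, Unitary.map_zpow_of_eq _ hV, (hc _ _).mul_zpow, (hc _ _).mul_zpow, ← map_zpow,
    ← map_zpow]
  change algebraMap ℂ (NCTorus ζ) (z ^ p : Circle) * _ *
    (algebraMap ℂ (NCTorus ζ) (w ^ q : Circle) * _) = _
  rw [← Algebra.smul_def, ← Algebra.smul_def, smul_mul_smul_comm, Circle.coe_mul]

lemma dense_span_of_monomial {S : Set (NCTorus ζ)} (h : ∀ p q, monomial ζ p q ∈ S) :
    (Submodule.span ℂ S).topologicalClosure = ⊤ := by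
  rw [eq_top_iff, ← dense_span_monomial ζ]
  refine Submodule.topologicalClosure_mono (Submodule.span_mono ?_)
  rintro _ ⟨p, q, rfl⟩
  exact h p q

/-- The gauge action on `U`. -/
def gaugeU : CircleCoaction (NCTorus ζ) :=
  CircleCoaction.ofFamily (fun z => gauge ζ z 1) (dense_span_of_monomial ζ fun p q =>
    ⟨p, fun z => by rw [gauge_monomial, one_zpow, mul_one]⟩)

/-- The gauge action on `V`. -/
def gaugeV : CircleCoaction (NCTorus ζ) :=
  CircleCoaction.ofFamily (fun z => gauge ζ 1 z) (dense_span_of_monomial ζ fun p q =>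
    ⟨q, fun z => by rw [gauge_monomial, one_zpow, one_mul]⟩)

lemma gaugeU_monomial (p q : ℤ) : (gaugeU ζ).IsHomogeneous p (monomial ζ p q) := fun z =>
  (gauge_monomial ζ z 1 p q).trans (by rw [one_zpow, mul_one])

lemma gaugeV_monomial (p q : ℤ) : (gaugeV ζ).IsHomogeneous q (monomial ζ p q) := fun z =>
  (gauge_monomial ζ 1 z p q).trans (by rw [one_zpow, one_mul])

end gauge

section regularRep

/-- The Hilbert space `ℓ²(ℤ × ℤ)`. -/
abbrev RegularSpace : Type := lp (fun _ : ℤ × ℤ => ℂ) 2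

/-- The standard basis of `ℓ²(ℤ × ℤ)`. -/
def stdBasis : HilbertBasis (ℤ × ℤ) ℂ RegularSpace := default

/-- The operator `δ_{p,q} ↦ δ_{p+1,q}`. -/
def regU : unitary (RegularSpace →L[ℂ] RegularSpace) :=
  stdBasis.weightedPermUnitary ((Equiv.addRight 1).prodCongr (Equiv.refl ℤ)) 1

/-- The operator `δ_{p,q} ↦ ζ^p δ_{p,q+1}`. -/
def regV : unitary (RegularSpace →L[ℂ] RegularSpace) :=
  stdBasis.weightedPermUnitary ((Equiv.refl ℤ).prodCongr (Equiv.addRight 1)) fun i => ζ ^ i.1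

lemma regU_apply (p q : ℤ) : (regU : _ →L[ℂ] _) (stdBasis (p, q)) = stdBasis (p + 1, q) := by
  refine (stdBasis.weightedPermUnitary_apply _ _ _).trans ?_
  rw [Pi.one_apply, Circle.coe_one, one_smul]; rfl

lemma regV_apply (p q : ℤ) : (regV ζ : _ →L[ℂ] _) (stdBasis (p, q)) =
    ((ζ ^ p : Circle) : ℂ) • stdBasis (p, q + 1) :=
  stdBasis.weightedPermUnitary_apply _ _ _

lemma regV_mul_regU : (regV ζ : RegularSpace →L[ℂ] RegularSpace) * regU =
    (ζ : ℂ) • ((regU : RegularSpace →L[ℂ] RegularSpace) * regV ζ) := by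
  refine ContinuousLinearMap.ext_on
    ((Submodule.dense_iff_topologicalClosure_eq_top).2 stdBasis.dense_span) ?_
  rintro _ ⟨⟨p, q⟩, rfl⟩
  rw [smul_apply, mul_apply_eq_comp, mul_apply_eq_comp, regU_apply, regV_apply, regV_apply,
    map_smul, regU_apply, smul_smul, ← Circle.coe_mul, zpow_add_one, mul_comm]

/-- The regular representation on `ℓ²(ℤ × ℤ)`. -/
def regularRep : HilbertRep.{0, 0} (NCTorus ζ) where
  H := RegularSpace
  hom := lift regU (regV ζ) (regV_mul_regU ζ)

/-- `V^q` acts first and moves `(0, 0)` to `(0, q)` without a phase, since its weight `ζ^p` is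
trivial at `p = 0`; then `U^p` shifts the first index. So the monomials map to an orthonormal basis,
and inner products read off their coefficients. -/
lemma regularRep_monomial (p q : ℤ) :
    (regularRep ζ).hom (monomial ζ p q) (stdBasis (0, 0)) = stdBasis (p, q) := by
  have hV := zpow_smul_of_shift (g := regV ζ) (f := fun r => stdBasis (0, r)) (fun r =>
    (regV_apply ζ 0 r).trans (by rw [zpow_zero, Circle.coe_one, one_smul])) q 0
  have hU := zpow_smul_of_shift (g := regU) (f := fun r => stdBasis (r, q)) (fun r =>
    regU_apply r q) p 0
  have h : (regularRep ζ).hom (monomial ζ p q) =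
      ((regU ^ p * regV ζ ^ q : unitary (RegularSpace →L[ℂ] RegularSpace)) :
        RegularSpace →L[ℂ] RegularSpace) :=
    (map_mul (regularRep ζ).hom _ _).trans
      (congrArg₂ (· * ·) (Unitary.map_zpow_of_eq _ (lift_U _ _ (regV_mul_regU ζ)) p)
        (Unitary.map_zpow_of_eq _ (lift_V _ _ (regV_mul_regU ζ)) q))
  rw [zero_add] at hU hV
  refine (DFunLike.congr_fun h _).trans (Eq.trans ?_ hU)
  exact congrArg (fun v => regU ^ p • v) hV

/-- The functional `U ^ p V ^ q ↦ 1` that vanishes on the other monomials. -/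
def coeff (i : ℤ × ℤ) : CoefficientFunctional (NCTorus ζ) where
  rep := regularRep ζ
  source := stdBasis (0, 0)
  target := stdBasis i

lemma coeff_monomial (i : ℤ × ℤ) (p q : ℤ) :
    coeff ζ i (monomial ζ p q) = if i = (p, q) then 1 else 0 := by
  rw [CoefficientFunctional.apply_def]
  change inner ℂ (stdBasis i) ((regularRep ζ).hom (monomial ζ p q) (stdBasis (0, 0))) = _
  rw [regularRep_monomial]
  exact orthonormal_iff_ite.1 stdBasis.orthonormal i (p, q)

/-- The component of bidegree `(p, q)` under the two gauge actions is the coefficient times `U^p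
V^q`: both sides are continuous and agree on monomials. Vanishing coefficients therefore force all
components to vanish, and components determine the element. -/
lemma separating_coeff : CoefficientFunctional.Separating (coeff ζ) := by
  intro t ht
  have key : ∀ i : ℤ × ℤ, ((gaugeU ζ).componentCLM i.1).comp ((gaugeV ζ).componentCLM i.2) =
      (coeff ζ i).toCLM.smulRight (monomial ζ i.1 i.2) := by
    intro i
    refine ContinuousLinearMap.eq_of_eqOn_dense_span (dense_span_monomial ζ) ?_
    rintro _ ⟨p, q, rfl⟩
    rw [ContinuousLinearMap.comp_apply, CircleCoaction.componentCLM_apply,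
      CircleCoaction.componentCLM_apply, (gaugeV_monomial ζ p q).component,
      ContinuousLinearMap.smulRight_apply, coeff_monomial]
    by_cases h2 : i.2 = q
    · rw [if_pos h2, (gaugeU_monomial ζ p q).component]
      by_cases h1 : i.1 = p
      · rw [if_pos h1, if_pos (Prod.ext h1 h2), one_smul, h1, h2]
      · rw [if_neg h1, if_neg fun h => h1 (congrArg Prod.fst h), zero_smul]
    · rw [if_neg h2, if_neg fun h => h2 (congrArg Prod.snd h), zero_smul,
        ← CircleCoaction.componentCLM_apply, map_zero]
  refine (gaugeV ζ).eq_zero_of_component fun q => (gaugeU ζ).eq_zero_of_component fun p => ?_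
  refine (DFunLike.congr_fun (key (p, q)) t).trans ?_
  rw [ContinuousLinearMap.smulRight_apply, ht, zero_smul]

/-- An element of the kernel of the regular representation has zero coefficients, so this single
representation is faithful and already attains the norm. -/
instance : IsRepNormed (NCTorus ζ) where
  norm_le t c _ h := by
    have hinj : Function.Injective (regularRep ζ).hom := by
      rw [injective_iff_map_eq_zero]
      intro t ht
      refine separating_coeff ζ t fun i => ?_
      rw [CoefficientFunctional.apply_def]
      change inner ℂ _ ((regularRep ζ).hom t _) = _
      rw [ht]
      exact inner_zero_right _
    rw [← NonUnitalStarAlgHom.norm_map (regularRep ζ).hom hinj]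
    exact h _

end regularRep

end NCTorus

/-! ### Density, commutation, functoriality and coaction for the braided tensor product -/

namespace BraidedTensor

variable {X X' : Type u} {Y Y' : Type v} [CStarAlgebra X] [CStarAlgebra Y] [CStarAlgebra X']
  [CStarAlgebra Y'] {ζ : Circle} {ρX : CircleCoaction X} {ρY : CircleCoaction Y}
  {ρX' : CircleCoaction X'} {ρY' : CircleCoaction Y'}

variable (ζ ρX ρY) in
/-- The inclusion `X ⊠_ζ Y ⊆ X ⊗ Y ⊗ C(𝕋²_ζ)`. -/
def incl : BraidedTensor ζ ρX ρY →⋆ₐ[ℂ] Braided.Ambient X Y ζ :=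
  (Braided.subalgebra ζ ρX ρY).subtype

lemma incl_injective : Function.Injective (incl ζ ρX ρY) := Subtype.val_injective

lemma incl_mem (a : BraidedTensor ζ ρX ρY) : incl ζ ρX ρY a ∈ Braided.subalgebra ζ ρX ρY := a.2

lemma incl_j₁ (x : X) : incl ζ ρX ρY (j₁ ζ ρX ρY x) = Braided.j₁' ζ ρX x := rfl

lemma incl_j₂ (y : Y) : incl ζ ρX ρY (j₂ ζ ρX ρY y) = Braided.j₂' ζ ρY y := rfl

instance : IsRepNormed (BraidedTensor ζ ρX ρY) := .of_injective (incl ζ ρX ρY) incl_injective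

variable (ζ ρX ρY) in
/-- The products of homogeneous elements span a dense subspace. -/
lemma dense_span_homogeneous :
    (Submodule.span ℂ {a | ∃ (k l : ℤ) (x : X) (y : Y), ρX.IsHomogeneous k x ∧
      ρY.IsHomogeneous l y ∧ a = j₁ ζ ρX ρY x * j₂ ζ ρX ρY y}).topologicalClosure = ⊤ := by
  set S := {a | ∃ (k l : ℤ) (x : X) (y : Y), ρX.IsHomogeneous k x ∧
      ρY.IsHomogeneous l y ∧ a = j₁ ζ ρX ρY x * j₂ ζ ρX ρY y}
  refine eq_top_iff.2 fun a _ => ?_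
  have ha : incl ζ ρX ρY a ∈ ((Braided.homogeneousPart ζ ρX ρY).topologicalClosure :
      Set (Braided.Ambient X Y ζ)) := by
    rw [← Braided.closedMul_eq_closure]; exact incl_mem a
  refine Metric.mem_closure_iff.2 fun ε hε => ?_
  obtain ⟨s, hs, hd⟩ := Metric.mem_closure_iff.1 ha ε hε
  -- The approximant found in the ambient algebra already comes from the span inside `X ⊠_ζ Y`, and
  -- the inclusion preserves distances.
  have h : s ∈ (Submodule.span ℂ S).map (incl ζ ρX ρY).toAlgHom.toLinearMap := by
    refine Submodule.span_le.2 ?_ hs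
    rintro _ ⟨k, l, x, y, hx, hy, rfl⟩
    exact ⟨_, Submodule.subset_span ⟨k, l, x, y, hx, hy, rfl⟩, rfl⟩
  obtain ⟨t, ht, rfl⟩ := h
  exact ⟨t, ht, hd⟩

variable (ζ ρX ρY) in
/-- The products `j₁(x) j₂(y)` span a dense subspace. -/
lemma dense_span :
    (Submodule.span ℂ {a | ∃ x y, a = j₁ ζ ρX ρY x * j₂ ζ ρX ρY y}).topologicalClosure = ⊤ := by
  rw [eq_top_iff, ← dense_span_homogeneous ζ ρX ρY]
  refine Submodule.topologicalClosure_mono (Submodule.span_mono ?_)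
  rintro _ ⟨k, l, x, y, -, -, rfl⟩
  exact ⟨x, y, rfl⟩

/-- The commutation relation of homogeneous elements. -/
lemma j₂_mul_j₁ {k l : ℤ} {x : X} {y : Y} (hx : ρX.IsHomogeneous k x)
    (hy : ρY.IsHomogeneous l y) : j₂ ζ ρX ρY y * j₁ ζ ρX ρY x =
      ((ζ ^ (l * k) : Circle) : ℂ) • (j₁ ζ ρX ρY x * j₂ ζ ρX ρY y) :=
  Subtype.ext (Braided.j₂'_mul_j₁' ζ hx hy)

/-- For homogeneous `y` of degree `l` the scalar `ζ^(l k)` is the effect of `ρ_(ζ^k)` on `y`.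
Written this way, the relation is linear and continuous in `y` and extends to all of `Y`; the proof
of bisimplifiability needs it with only one factor homogeneous. -/
lemma j₂_mul_j₁_left {k : ℤ} {x : X} (hx : ρX.IsHomogeneous k x) (y : Y) :
    j₂ ζ ρX ρY y * j₁ ζ ρX ρY x = j₁ ζ ρX ρY x * j₂ ζ ρX ρY (ρY.act (ζ ^ k) y) := by
  refine DFunLike.congr_fun (ContinuousLinearMap.eq_of_eqOn_dense_span
    ρY.closure_span_homogeneous
    (f := ((ContinuousLinearMap.mul ℂ _).flip (j₁ ζ ρX ρY x)).comp (j₂ ζ ρX ρY).toCLM)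
    (g := (ContinuousLinearMap.mul ℂ _ (j₁ ζ ρX ρY x)).comp
      ((j₂ ζ ρX ρY).comp (ρY.act (ζ ^ k))).toCLM) ?_) y
  rintro y ⟨l, hy⟩
  change j₂ ζ ρX ρY y * j₁ ζ ρX ρY x = j₁ ζ ρX ρY x * j₂ ζ ρX ρY (ρY.toHom y (ζ ^ k))
  rw [j₂_mul_j₁ hx hy, hy, map_smul, mul_smul_comm, ← zpow_mul, mul_comm]

lemma j₂_mul_j₁_right {l : ℤ} {y : Y} (hy : ρY.IsHomogeneous l y) (x : X) :
    j₂ ζ ρX ρY y * j₁ ζ ρX ρY x = j₁ ζ ρX ρY (ρX.act (ζ ^ l) x) * j₂ ζ ρX ρY y := by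
  refine DFunLike.congr_fun (ContinuousLinearMap.eq_of_eqOn_dense_span
    ρX.closure_span_homogeneous
    (f := (ContinuousLinearMap.mul ℂ _ (j₂ ζ ρX ρY y)).comp (j₁ ζ ρX ρY).toCLM)
    (g := ((ContinuousLinearMap.mul ℂ _).flip (j₂ ζ ρX ρY y)).comp
      ((j₁ ζ ρX ρY).comp (ρX.act (ζ ^ l))).toCLM) ?_) x
  rintro x ⟨k, hx⟩
  change j₂ ζ ρX ρY y * j₁ ζ ρX ρY x = j₁ ζ ρX ρY (ρX.toHom x (ζ ^ l)) * j₂ ζ ρX ρY y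
  rw [j₂_mul_j₁ hx hy, hx, map_smul, smul_mul_assoc, ← zpow_mul]

section map

variable {π₁ : X →⋆ₐ[ℂ] X'} {π₂ : Y →⋆ₐ[ℂ] Y'}

variable (ζ π₁ π₂) in
/-- The homomorphism `π₁ ⊗ π₂ ⊗ id`. -/
def ambientMap : Braided.Ambient X Y ζ →⋆ₐ[ℂ] Braided.Ambient X' Y' ζ :=
  MinTensor.map (MinTensor.map π₁ π₂) (StarAlgHom.id ℂ (NCTorus ζ))

/-- An equivariant morphism preserves degrees, so the same power of `U` appears on both sides for
homogeneous `x`. -/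
lemma ambientMap_j₁ (h₁ : ρX.IsEquivariant ρX' π₁) (x : X) :
    ambientMap ζ π₁ π₂ (Braided.j₁' ζ ρX x) = Braided.j₁' ζ ρX' (π₁ x) := by
  refine DFunLike.congr_fun (StarAlgHom.eq_of_eqOn_dense_span ρX.closure_span_homogeneous
    (φ := (ambientMap ζ π₁ π₂).comp (Braided.j₁' ζ ρX))
    (ψ := (Braided.j₁' ζ ρX').comp π₁) ?_) x
  rintro x ⟨k, hx⟩
  rw [StarAlgHom.comp_apply, StarAlgHom.comp_apply, Braided.j₁'_homogeneous ζ hx,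
    Braided.j₁'_homogeneous ζ (hx.map h₁), map_mul, ambientMap, MinTensor.map_inl,
    MinTensor.map_inr, MinTensor.map_inl]
  rfl

lemma ambientMap_j₂ (h₂ : ρY.IsEquivariant ρY' π₂) (y : Y) :
    ambientMap ζ π₁ π₂ (Braided.j₂' ζ ρY y) = Braided.j₂' ζ ρY' (π₂ y) := by
  refine DFunLike.congr_fun (StarAlgHom.eq_of_eqOn_dense_span ρY.closure_span_homogeneous
    (φ := (ambientMap ζ π₁ π₂).comp (Braided.j₂' ζ ρY))
    (ψ := (Braided.j₂' ζ ρY').comp π₂) ?_) y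
  rintro y ⟨k, hy⟩
  rw [StarAlgHom.comp_apply, StarAlgHom.comp_apply, Braided.j₂'_homogeneous ζ hy,
    Braided.j₂'_homogeneous ζ (hy.map h₂), map_mul, ambientMap, MinTensor.map_inl,
    MinTensor.map_inr, MinTensor.map_inr]
  rfl

variable (ζ) in
/-- The morphism `π₁ ⊠_ζ π₂` of equivariant morphisms. -/
def map (h₁ : ρX.IsEquivariant ρX' π₁) (h₂ : ρY.IsEquivariant ρY' π₂) :
    BraidedTensor ζ ρX ρY →⋆ₐ[ℂ] BraidedTensor ζ ρX' ρY' :=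
  StarAlgHom.codRestrict ((ambientMap ζ π₁ π₂).comp (incl ζ ρX ρY))
    (Braided.subalgebra ζ ρX' ρY') (by
      refine ContinuousLinearMap.apply_mem_of_dense_span (dense_span ζ ρX ρY)
        (f := ((ambientMap ζ π₁ π₂).comp (incl ζ ρX ρY)).toCLM)
        (W := closedMul (Set.range (Braided.j₁' ζ ρX')) (Set.range (Braided.j₂' ζ ρY')))
        (isClosed_subalgebra ζ ρX' ρY') ?_
      rintro _ ⟨x, y, rfl⟩
      change ambientMap ζ π₁ π₂ (incl ζ ρX ρY (j₁ ζ ρX ρY x * j₂ ζ ρX ρY y)) ∈ closedMul _ _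
      rw [map_mul, map_mul, incl_j₁, incl_j₂, ambientMap_j₁ h₁, ambientMap_j₂ h₂]
      exact Submodule.le_topologicalClosure _ (Submodule.subset_span
        ⟨_, ⟨_, rfl⟩, _, ⟨_, rfl⟩, rfl⟩))

variable (h₁ : ρX.IsEquivariant ρX' π₁) (h₂ : ρY.IsEquivariant ρY' π₂)

lemma map_j₁ (x : X) : map ζ h₁ h₂ (j₁ ζ ρX ρY x) = j₁ ζ ρX' ρY' (π₁ x) :=
  Subtype.ext (ambientMap_j₁ h₁ x)

lemma map_j₂ (y : Y) : map ζ h₁ h₂ (j₂ ζ ρX ρY y) = j₂ ζ ρX' ρY' (π₂ y) :=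
  Subtype.ext (ambientMap_j₂ h₂ y)

lemma isMap_map : IsMap π₁ π₂ (map ζ h₁ h₂) := fun x y => by
  rw [map_mul, map_j₁, map_j₂]

end map

section coaction

variable (ζ ρX ρY) in
/-- The coaction on `X ⊠_ζ Y`. -/
def coaction : CircleCoaction (BraidedTensor ζ ρX ρY) :=
  CircleCoaction.ofFamily
    (fun z => map ζ (ρX.isEquivariant_act z) (ρY.isEquivariant_act z)) (by
      rw [eq_top_iff, ← dense_span_homogeneous ζ ρX ρY]
      refine Submodule.topologicalClosure_mono (Submodule.span_mono ?_)
      rintro _ ⟨k, l, x, y, hx, hy, rfl⟩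
      refine ⟨k + l, fun z => ?_⟩
      rw [map_mul, map_j₁, map_j₂, CircleCoaction.act_apply, CircleCoaction.act_apply, hx, hy,
        map_smul, map_smul, smul_mul_smul_comm, zpow_add, Circle.coe_mul])

lemma isCoaction_coaction : IsCoaction (coaction ζ ρX ρY) :=
  ⟨fun x z => map_j₁ (ρX.isEquivariant_act z) (ρY.isEquivariant_act z) x,
    fun y z => map_j₂ (ρX.isEquivariant_act z) (ρY.isEquivariant_act z) y⟩

end coaction

end BraidedTensor

/-! ### Isomorphisms obtained from their graphs -/

section bijection

variable {L R : Type*} [CStarAlgebra L] [CStarAlgebra R]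

/-- A *-homomorphism from a C*-algebra which is injective and has dense range is bijective. -/
lemma StarAlgHom.bijective_of_denseRange (φ : L →⋆ₐ[ℂ] R) (hi : Function.Injective φ)
    (hd : DenseRange φ) : Function.Bijective φ := by
  refine ⟨hi, ?_⟩
  -- An injective *-homomorphism is isometric, so its range is complete.
  have hc : IsClosed (Set.range φ) :=
    (NonUnitalStarAlgHom.isometry φ hi).isClosedEmbedding.isClosed_range
  exact Set.range_eq_univ.1 (hc.closure_eq.symm.trans hd.closure_eq)

/-- A closed *-subalgebra of `L × R` with dense and injective projections is the graph of an
isomorphism. -/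
lemma exists_starAlgEquiv_of_graph (G : StarSubalgebra ℂ (L × R)) (hG : IsClosed (G : Set (L × R)))
    (hL : ∀ l, l ∈ closure (Prod.fst '' (G : Set (L × R))))
    (hR : ∀ r, r ∈ closure (Prod.snd '' (G : Set (L × R))))
    (iL : ∀ g ∈ G, g.1 = 0 → g.2 = 0) (iR : ∀ g ∈ G, g.2 = 0 → g.1 = 0) :
    ∃ α : L ≃⋆ₐ[ℂ] R, ∀ g ∈ G, α g.1 = g.2 := by
  let _ : CStarAlgebra G := StarSubalgebra.cstarAlgebra G (h_closed := hG)
  let pL : G →⋆ₐ[ℂ] L := (StarAlgHom.fst ℂ L R).comp G.subtype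
  let pR : G →⋆ₐ[ℂ] R := (StarAlgHom.snd ℂ L R).comp G.subtype
  have bL : Function.Bijective pL := by
    refine StarAlgHom.bijective_of_denseRange pL ?_ fun l => ?_
    · rw [injective_iff_map_eq_zero]
      intro g hg
      exact Subtype.ext (Prod.ext hg (iL g g.2 hg))
    · refine closure_mono ?_ (hL l)
      rintro _ ⟨g, hg, rfl⟩
      exact ⟨⟨g, hg⟩, rfl⟩
  have bR : Function.Bijective pR := by
    refine StarAlgHom.bijective_of_denseRange pR ?_ fun l => ?_
    · rw [injective_iff_map_eq_zero]
      intro g hg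
      exact Subtype.ext (Prod.ext (iR g g.2 hg) hg)
    · refine closure_mono ?_ (hR l)
      rintro _ ⟨g, hg, rfl⟩
      exact ⟨⟨g, hg⟩, rfl⟩
  refine ⟨(StarAlgEquiv.ofBijective pL bL).symm.trans (StarAlgEquiv.ofBijective pR bR),
    fun g hg => ?_⟩
  have h : (StarAlgEquiv.ofBijective pL bL).symm g.1 = ⟨g, hg⟩ :=
    (StarAlgEquiv.ofBijective pL bL).symm_apply_apply ⟨g, hg⟩
  exact congrArg (StarAlgEquiv.ofBijective pR bR) h

end bijection

/-! ### C*-algebras generated by three braided commuting copies -/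

namespace Braided

variable {X Y Z M : Type*} [CStarAlgebra X] [CStarAlgebra Y] [CStarAlgebra Z] [CStarAlgebra M]
  {ζ : Circle} {ρX : CircleCoaction X} {ρY : CircleCoaction Y} {ρZ : CircleCoaction Z}

/-- The homomorphisms `a` and `b` satisfy the braided commutation relation. -/
def BraidedCommute (ζ : Circle) (ρX : CircleCoaction X) (ρY : CircleCoaction Y) (a : X →⋆ₐ[ℂ] M)
    (b : Y →⋆ₐ[ℂ] M) : Prop :=
  ∀ (k l : ℤ) (x : X) (y : Y), ρX.IsHomogeneous k x → ρY.IsHomogeneous l y →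
    b y * a x = ((ζ ^ (l * k) : Circle) : ℂ) • (a x * b y)

variable (ρX ρY ρZ) in
/-- The products `a(x) b(y) c(z)` of homogeneous elements. -/
def tripleProducts (a : X →⋆ₐ[ℂ] M) (b : Y →⋆ₐ[ℂ] M) (c : Z →⋆ₐ[ℂ] M) : Set M :=
  {t | ∃ (k l m : ℤ) (x : X) (y : Y) (z : Z), ρX.IsHomogeneous k x ∧ ρY.IsHomogeneous l y ∧
    ρZ.IsHomogeneous m z ∧ t = a x * b y * c z}

variable {a : X →⋆ₐ[ℂ] M} {b : Y →⋆ₐ[ℂ] M} {c : Z →⋆ₐ[ℂ] M}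
  (hab : BraidedCommute ζ ρX ρY a b) (hac : BraidedCommute ζ ρX ρZ a c)
  (hbc : BraidedCommute ζ ρY ρZ b c)

/-- The linear span of the products `a(x) b(y) c(z)` of homogeneous elements, as a
*-subalgebra. -/
def tripleSpan : StarSubalgebra ℂ M where
  carrier := Submodule.span ℂ (tripleProducts ρX ρY ρZ a b c)
  add_mem' := Submodule.add_mem _
  mul_mem' {s t} hs ht := by
    refine Submodule.span_induction₂ (p := fun s t _ _ => s * t ∈ Submodule.span ℂ _)
      ?_ ?_ ?_ ?_ ?_ ?_ ?_ hs ht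
    · rintro _ _ ⟨k, l, m, x, y, z, hx, hy, hz, rfl⟩ ⟨k', l', m', x', y', z', hx', hy', hz', rfl⟩
      -- Reordering takes three exchanges, of `c z` with `a x'`, of `b y` with `a x'` and of `c z`
      -- with `b y'`; each contributes one factor.
      have h : a x * b y * c z * (a x' * b y' * c z') =
          (((ζ ^ (m * k') : Circle) : ℂ) * (((ζ ^ (l * k') : Circle) : ℂ) *
            ((ζ ^ (m * l') : Circle) : ℂ))) • (a (x * x') * b (y * y') * c (z * z')) := by
        calc a x * b y * c z * (a x' * b y' * c z')
            = a x * b y * (c z * a x') * b y' * c z' := by simp only [mul_assoc]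
          _ = ((ζ ^ (m * k') : Circle) : ℂ) • (a x * (b y * a x') * (c z * b y') * c z') := by
              rw [hac _ _ _ _ hx' hz]
              simp only [mul_smul_comm, smul_mul_assoc, mul_assoc]
          _ = _ := by
              rw [hab _ _ _ _ hx' hy, hbc _ _ _ _ hy' hz]
              simp only [mul_smul_comm, smul_mul_assoc, mul_assoc, map_mul, smul_smul]
              congr 1
              ring
      rw [h]
      exact Submodule.smul_mem _ _ (Submodule.subset_span
        ⟨k + k', l + l', m + m', _, _, _, hx.mul hx', hy.mul hy', hz.mul hz', rfl⟩)
    · intro t _; rw [zero_mul]; exact Submodule.zero_mem _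
    · intro t _; rw [mul_zero]; exact Submodule.zero_mem _
    · intro s s' t _ _ _ h h'; rw [add_mul]; exact Submodule.add_mem _ h h'
    · intro s t t' _ _ _ h h'; rw [mul_add]; exact Submodule.add_mem _ h h'
    · intro r s t _ _ h; rw [smul_mul_assoc]; exact Submodule.smul_mem _ _ h
    · intro r s t _ _ h; rw [mul_smul_comm]; exact Submodule.smul_mem _ _ h
  algebraMap_mem' r := by
    rw [Algebra.algebraMap_eq_smul_one]
    refine Submodule.smul_mem _ _ (Submodule.subset_span
      ⟨0, 0, 0, 1, 1, 1, ρX.isHomogeneous_one, ρY.isHomogeneous_one, ρZ.isHomogeneous_one, ?_⟩)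
    rw [map_one, map_one, map_one, one_mul, one_mul]
  star_mem' {s} hs := by
    refine Submodule.span_induction (p := fun s _ => star s ∈ Submodule.span ℂ _) ?_ ?_ ?_ ?_ hs
    · rintro _ ⟨k, l, m, x, y, z, hx, hy, hz, rfl⟩
      -- The adjoint has the order `c b a`, which three exchanges turn into `a b c`. Adjoints have
      -- opposite degrees, hence the signs in the exponents.
      have h : star (a x * b y * c z) =
          (((ζ ^ (-l * -k) : Circle) : ℂ) * (((ζ ^ (-m * -k) : Circle) : ℂ) *
            ((ζ ^ (-m * -l) : Circle) : ℂ))) • (a (star x) * b (star y) * c (star z)) := by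
        calc star (a x * b y * c z) = c (star z) * (b (star y) * a (star x)) := by
              rw [star_mul, star_mul, map_star, map_star, map_star]
          _ = ((ζ ^ (-l * -k) : Circle) : ℂ) • ((c (star z) * a (star x)) * b (star y)) := by
              rw [hab _ _ _ _ hx.star hy.star, mul_smul_comm, mul_assoc]
          _ = (((ζ ^ (-l * -k) : Circle) : ℂ) * ((ζ ^ (-m * -k) : Circle) : ℂ)) •
              (a (star x) * (c (star z) * b (star y))) := by
              rw [hac _ _ _ _ hx.star hz.star, smul_mul_assoc, smul_smul, mul_assoc]
          _ = _ := by
              rw [hbc _ _ _ _ hy.star hz.star, mul_smul_comm, smul_smul, mul_assoc, mul_assoc]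
      rw [h]
      exact Submodule.smul_mem _ _ (Submodule.subset_span
        ⟨-k, -l, -m, _, _, _, hx.star, hy.star, hz.star, rfl⟩)
    · rw [star_zero]; exact Submodule.zero_mem _
    · intro s t _ _ h h'; rw [star_add]; exact Submodule.add_mem _ h h'
    · intro r s _ h; rw [star_smul]; exact Submodule.smul_mem _ _ h

/-- The C*-algebra generated by the ranges of `a`, `b` and `c`. -/
def tripleAlg : StarSubalgebra ℂ M := (tripleSpan hab hac hbc).topologicalClosure

lemma isClosed_tripleAlg : IsClosed (tripleAlg hab hac hbc : Set M) :=
  StarSubalgebra.isClosed_topologicalClosure _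

lemma tripleProducts_subset {t : M} (ht : t ∈ tripleProducts ρX ρY ρZ a b c) :
    t ∈ tripleAlg hab hac hbc :=
  StarSubalgebra.le_topologicalClosure _ (Submodule.subset_span (s := tripleProducts _ _ _ _ _ _) ht)

lemma left_mem_tripleAlg (x : X) : a x ∈ tripleAlg hab hac hbc := by
  refine ContinuousLinearMap.apply_mem_of_dense_span ρX.closure_span_homogeneous (f := a.toCLM)
    (W := (tripleAlg hab hac hbc).toSubalgebra.toSubmodule) (isClosed_tripleAlg hab hac hbc) ?_ x
  rintro x ⟨k, hx⟩
  refine tripleProducts_subset hab hac hbc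
    ⟨k, 0, 0, x, 1, 1, hx, ρY.isHomogeneous_one, ρZ.isHomogeneous_one, ?_⟩
  rw [map_one, map_one, mul_one, mul_one]; rfl

lemma middle_mem_tripleAlg (y : Y) : b y ∈ tripleAlg hab hac hbc := by
  refine ContinuousLinearMap.apply_mem_of_dense_span ρY.closure_span_homogeneous (f := b.toCLM)
    (W := (tripleAlg hab hac hbc).toSubalgebra.toSubmodule) (isClosed_tripleAlg hab hac hbc) ?_ y
  rintro y ⟨k, hy⟩
  refine tripleProducts_subset hab hac hbc
    ⟨0, k, 0, 1, y, 1, ρX.isHomogeneous_one, hy, ρZ.isHomogeneous_one, ?_⟩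
  rw [map_one, map_one, one_mul, mul_one]; rfl

lemma right_mem_tripleAlg (z : Z) : c z ∈ tripleAlg hab hac hbc := by
  refine ContinuousLinearMap.apply_mem_of_dense_span ρZ.closure_span_homogeneous (f := c.toCLM)
    (W := (tripleAlg hab hac hbc).toSubalgebra.toSubmodule) (isClosed_tripleAlg hab hac hbc) ?_ z
  rintro z ⟨k, hz⟩
  refine tripleProducts_subset hab hac hbc
    ⟨0, 0, k, 1, 1, z, ρX.isHomogeneous_one, ρY.isHomogeneous_one, hz, ?_⟩
  rw [map_one, map_one, one_mul, one_mul]; rfl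

lemma eqOn_tripleAlg {f g : M →L[ℂ] ℂ} (h : ∀ t ∈ tripleProducts ρX ρY ρZ a b c, f t = g t)
    {t : M} (ht : t ∈ tripleAlg hab hac hbc) : f t = g t := by
  have hle : (Submodule.span ℂ (tripleProducts ρX ρY ρZ a b c)).topologicalClosure ≤
      LinearMap.eqLocus f.toLinearMap g.toLinearMap :=
    Submodule.topologicalClosure_minimal _ (Submodule.span_le.2 h)
      (isClosed_eq f.continuous g.continuous)
  exact hle ht

end Braided

/-! ### Functionals on braided tensor products -/

namespace BraidedTensor

open CoefficientFunctional Braided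

section functional

variable {X : Type u} {Y : Type v} [CStarAlgebra X] [CStarAlgebra Y] {ζ : Circle}
  {ρX : CircleCoaction X} {ρY : CircleCoaction Y}

/-- The factor `U^k` commutes with the copy of `y`, so the product becomes an elementary tensor. Its
torus factor is a monomial that records both degrees, which is what makes `functional` select a
bidegree. -/
lemma incl_homogeneous {k l : ℤ} {x : X} {y : Y} (hx : ρX.IsHomogeneous k x)
    (hy : ρY.IsHomogeneous l y) : incl ζ ρX ρY (j₁ ζ ρX ρY x * j₂ ζ ρX ρY y) =
      MinTensor.ofTensor (MinTensor X Y) (NCTorus ζ)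
        (MinTensor.ofTensor X Y (x ⊗ₜ y) ⊗ₜ NCTorus.monomial ζ k l) := by
  rw [map_mul, incl_j₁, incl_j₂, j₁'_homogeneous ζ hx, j₂'_homogeneous ζ hy, mul_assoc,
    ← mul_assoc (MinTensor.inr _ _ _), ← (MinTensor.commute_inl_inr _ _ _ _).eq, mul_assoc,
    ← mul_assoc, ← map_mul, ← map_mul, MinTensor.inl_mul_inr, MinTensor.inl_mul_inr]
  rfl

variable (ρX ρY) in
/-- The functional on `X ⊠_ζ Y` defined by a functional on `X ⊗ Y` and a pair of degrees. -/
def functional (F : CoefficientFunctional (MinTensor X Y)) (i : ℤ × ℤ) :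
    CoefficientFunctional (BraidedTensor ζ ρX ρY) :=
  (F.tensor (NCTorus.coeff ζ i)).comap (incl ζ ρX ρY)

lemma functional_homogeneous (F : CoefficientFunctional (MinTensor X Y)) (i : ℤ × ℤ) {k l : ℤ}
    {x : X} {y : Y} (hx : ρX.IsHomogeneous k x) (hy : ρY.IsHomogeneous l y) :
    functional ρX ρY F i (j₁ ζ ρX ρY x * j₂ ζ ρX ρY y) =
      if i = (k, l) then F (MinTensor.ofTensor X Y (x ⊗ₜ y)) else 0 := by
  refine (congrArg (F.tensor (NCTorus.coeff ζ i)).toCLM (incl_homogeneous hx hy)).trans ?_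
  rw [tensor_ofTensor, NCTorus.coeff_monomial, mul_ite, mul_one, mul_zero]

variable (ζ ρX ρY) in
-- Products of separating families separate the points of the minimal tensor product, here of `X ⊗
-- Y` with `C(𝕋²_ζ)`; both factors are normed by representations, so both slice maps exist. The
-- injective inclusion transports this to `X ⊠_ζ Y`.
lemma separating_functional {ι : Type*} {F : ι → CoefficientFunctional (MinTensor X Y)}
    (hF : Separating F) : Separating fun i : ι × (ℤ × ℤ) => functional (ζ := ζ) ρX ρY (F i.1) i.2 := by
  intro a ha
  have h : incl ζ ρX ρY a = 0 :=
    MinTensor.separating_tensor hF (NCTorus.separating_coeff ζ) _ ha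
  exact incl_injective (h.trans (map_zero _).symm)

end functional

section commute

variable {X Y M M' : Type*} [CStarAlgebra X] [CStarAlgebra Y] [CStarAlgebra M] [CStarAlgebra M']
  {ζ : Circle} {ρX : CircleCoaction X} {ρY : CircleCoaction Y}
  {a : X →⋆ₐ[ℂ] M} {b : Y →⋆ₐ[ℂ] M} {a' : X →⋆ₐ[ℂ] M'} {b' : Y →⋆ₐ[ℂ] M'}

variable (ρX ρY) in
lemma braidedCommute_j : BraidedCommute ζ ρX ρY (j₁ ζ ρX ρY) (j₂ ζ ρX ρY) :=
  fun _ _ _ _ hx hy => j₂_mul_j₁ hx hy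

lemma _root_.Braided.BraidedCommute.prod (h : BraidedCommute ζ ρX ρY a b)
    (h' : BraidedCommute ζ ρX ρY a' b') : BraidedCommute ζ ρX ρY (a.prod a') (b.prod b') :=
  fun k l x y hx hy => Prod.ext (h k l x y hx hy) (h' k l x y hx hy)

lemma _root_.Braided.BraidedCommute.postcomp (h : BraidedCommute ζ ρX ρY a b) (φ : M →⋆ₐ[ℂ] M') :
    BraidedCommute ζ ρX ρY (φ.comp a) (φ.comp b) := fun k l x y hx hy => by
  rw [StarAlgHom.comp_apply, StarAlgHom.comp_apply, ← map_mul, ← map_mul, h k l x y hx hy, map_smul]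

lemma _root_.Braided.BraidedCommute.precomp_left {X' : Type*} [CStarAlgebra X']
    {ρX' : CircleCoaction X'} {φ : X' →⋆ₐ[ℂ] X} (h : BraidedCommute ζ ρX ρY a b)
    (hφ : ρX'.IsEquivariant ρX φ) : BraidedCommute ζ ρX' ρY (a.comp φ) b :=
  fun k l x y hx hy => h k l (φ x) y (hx.map hφ) hy

lemma _root_.Braided.BraidedCommute.precomp_right {Y' : Type*} [CStarAlgebra Y']
    {ρY' : CircleCoaction Y'} {φ : Y' →⋆ₐ[ℂ] Y} (h : BraidedCommute ζ ρX ρY a b)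
    (hφ : ρY'.IsEquivariant ρY φ) : BraidedCommute ζ ρX ρY' a (b.comp φ) :=
  fun k l x y hx hy => h k l x (φ y) hx (hy.map hφ)

end commute

/-! ### Associativity of the braided tensor product -/

section associator

variable {X Y Z : Type u} [CStarAlgebra X] [CStarAlgebra Y] [CStarAlgebra Z]
  {ζ : Circle} {ρX : CircleCoaction X} {ρY : CircleCoaction Y} {ρZ : CircleCoaction Z}
  {ρXY : CircleCoaction (BraidedTensor ζ ρX ρY)} {ρYZ : CircleCoaction (BraidedTensor ζ ρY ρZ)}

variable (ρZ ρXY) in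
/-- The functionals on `(X ⊠_ζ Y) ⊠_ζ Z`. -/
def leftFunctional (f : CoefficientFunctional X) (g : CoefficientFunctional Y)
    (h : CoefficientFunctional Z) (i j : ℤ × ℤ) :
    CoefficientFunctional (BraidedTensor ζ ρXY ρZ) :=
  functional ρXY ρZ ((functional ρX ρY (f.tensor g) i).tensor h) j

variable (ρX ρYZ) in
/-- The functionals on `X ⊠_ζ (Y ⊠_ζ Z)`. -/
def rightFunctional (f : CoefficientFunctional X) (g : CoefficientFunctional Y)
    (h : CoefficientFunctional Z) (i j : ℤ × ℤ) :
    CoefficientFunctional (BraidedTensor ζ ρX ρYZ) :=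
  functional ρX ρYZ (f.tensor (functional ρY ρZ (g.tensor h) i)) j

/-- The separation result is applied twice, with a slice by functionals of `Z` in between. That
slice takes values in `X ⊠_ζ Y`, which is always normed by its representations, so nothing is
required of `X`, `Y` and `Z`. -/
lemma eq_zero_of_leftFunctional {a : BraidedTensor ζ ρXY ρZ}
    (ha : ∀ f g h i j, leftFunctional ρZ ρXY f g h i j a = 0) : a = 0 := by
  have h0 : Separating fun p : CoefficientFunctional X × CoefficientFunctional Y =>
      p.1.tensor p.2 := fun t ht => MinTensor.eq_zero_of_tensor fun f g => ht (f, g)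
  exact separating_functional ζ ρXY ρZ (MinTensor.separating_tensor_right (B := Z)
    (separating_functional ζ ρX ρY h0)) a fun i =>
      ha i.1.1.1.1 i.1.1.1.2 i.1.2 i.1.1.2 i.2

lemma eq_zero_of_rightFunctional {a : BraidedTensor ζ ρX ρYZ}
    (ha : ∀ f g h i j, rightFunctional ρX ρYZ f g h i j a = 0) : a = 0 := by
  have h0 : Separating fun p : CoefficientFunctional Y × CoefficientFunctional Z =>
      p.1.tensor p.2 := fun t ht => MinTensor.eq_zero_of_tensor fun f g => ht (f, g)
  exact separating_functional ζ ρX ρYZ (MinTensor.separating_tensor_left (A := X)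
    (separating_functional ζ ρY ρZ h0)) a fun i =>
      ha i.1.1 i.1.2.1.1 i.1.2.1.2 i.1.2.2 i.2

variable (hXY : IsCoaction ρXY) (hYZ : IsCoaction ρYZ)

include hXY in
-- Since `j₁` and `j₂` are equivariant for `ρXY`, the inner product `j₁(x) j₂(y)` is homogeneous of
-- degree `k + l`; the outer pair of degrees is therefore `(k + l, m)` and the inner one `(k, l)`.
lemma leftFunctional_homogeneous (f : CoefficientFunctional X) (g : CoefficientFunctional Y)
    (h : CoefficientFunctional Z) (i j : ℤ × ℤ) {k l m : ℤ} {x : X} {y : Y} {z : Z}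
    (hx : ρX.IsHomogeneous k x) (hy : ρY.IsHomogeneous l y) (hz : ρZ.IsHomogeneous m z) :
    leftFunctional ρZ ρXY f g h i j (j₁ ζ ρXY ρZ (j₁ ζ ρX ρY x) * j₁ ζ ρXY ρZ (j₂ ζ ρX ρY y) *
      j₂ ζ ρXY ρZ z) = if i = (k, l) ∧ j = (k + l, m) then f x * g y * h z else 0 := by
  rw [← map_mul, leftFunctional, functional_homogeneous _ _ ((hx.map hXY.1).mul (hy.map hXY.2)) hz,
    tensor_ofTensor, functional_homogeneous _ _ hx hy, tensor_ofTensor]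
  split_ifs <;> simp_all

include hYZ in
lemma rightFunctional_homogeneous (f : CoefficientFunctional X) (g : CoefficientFunctional Y)
    (h : CoefficientFunctional Z) (i j : ℤ × ℤ) {k l m : ℤ} {x : X} {y : Y} {z : Z}
    (hx : ρX.IsHomogeneous k x) (hy : ρY.IsHomogeneous l y) (hz : ρZ.IsHomogeneous m z) :
    rightFunctional ρX ρYZ f g h i j (j₁ ζ ρX ρYZ x * j₂ ζ ρX ρYZ (j₁ ζ ρY ρZ y) *
      j₂ ζ ρX ρYZ (j₂ ζ ρY ρZ z)) =
      if i = (l, m) ∧ j = (k, l + m) then f x * g y * h z else 0 := by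
  rw [mul_assoc, ← map_mul, rightFunctional,
    functional_homogeneous _ _ hx ((hy.map hYZ.1).mul (hz.map hYZ.2)), tensor_ofTensor,
    functional_homogeneous _ _ hy hz, tensor_ofTensor]
  split_ifs <;> simp_all [mul_assoc]

variable (ρX ρY ρZ ρXY ρYZ) in
/-- The canonical copies of `X` in both triple products. -/
def pair₁ : X →⋆ₐ[ℂ] BraidedTensor ζ ρXY ρZ × BraidedTensor ζ ρX ρYZ :=
  ((j₁ ζ ρXY ρZ).comp (j₁ ζ ρX ρY)).prod (j₁ ζ ρX ρYZ)

variable (ρX ρY ρZ ρXY ρYZ) in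
/-- The canonical copies of `Y` in both triple products. -/
def pair₂ : Y →⋆ₐ[ℂ] BraidedTensor ζ ρXY ρZ × BraidedTensor ζ ρX ρYZ :=
  ((j₁ ζ ρXY ρZ).comp (j₂ ζ ρX ρY)).prod ((j₂ ζ ρX ρYZ).comp (j₁ ζ ρY ρZ))

variable (ρX ρY ρZ ρXY ρYZ) in
/-- The canonical copies of `Z` in both triple products. -/
def pair₃ : Z →⋆ₐ[ℂ] BraidedTensor ζ ρXY ρZ × BraidedTensor ζ ρX ρYZ :=
  (j₂ ζ ρXY ρZ).prod ((j₂ ζ ρX ρYZ).comp (j₂ ζ ρY ρZ))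

include hYZ in
-- In the left coordinate the relation is that of `X ⊠_ζ Y`, carried along `j₁`. In the right one it
-- is that of `X` with `Y ⊠_ζ Z`, restricted along the equivariant copy of `Y`.
lemma braidedCommute_pair₁₂ :
    BraidedCommute ζ ρX ρY (pair₁ ρX ρY ρZ ρXY ρYZ) (pair₂ ρX ρY ρZ ρXY ρYZ) :=
  ((braidedCommute_j ρX ρY).postcomp (j₁ ζ ρXY ρZ)).prod
    ((braidedCommute_j ρX ρYZ).precomp_right hYZ.1)

include hXY hYZ in
lemma braidedCommute_pair₁₃ :
    BraidedCommute ζ ρX ρZ (pair₁ ρX ρY ρZ ρXY ρYZ) (pair₃ ρX ρY ρZ ρXY ρYZ) :=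
  ((braidedCommute_j ρXY ρZ).precomp_left hXY.1).prod
    ((braidedCommute_j ρX ρYZ).precomp_right hYZ.2)

include hXY in
lemma braidedCommute_pair₂₃ :
    BraidedCommute ζ ρY ρZ (pair₂ ρX ρY ρZ ρXY ρYZ) (pair₃ ρX ρY ρZ ρXY ρYZ) :=
  ((braidedCommute_j ρXY ρZ).precomp_left hXY.2).prod
    ((braidedCommute_j ρY ρZ).postcomp (j₂ ζ ρX ρYZ))

/-- The graph of the associator. -/
def associatorGraph : StarSubalgebra ℂ (BraidedTensor ζ ρXY ρZ × BraidedTensor ζ ρX ρYZ) :=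
  tripleAlg (braidedCommute_pair₁₂ (ρZ := ρZ) (ρXY := ρXY) hYZ) (braidedCommute_pair₁₃ hXY hYZ)
    (braidedCommute_pair₂₃ (ρX := ρX) (ρYZ := ρYZ) hXY)

lemma triple_mem_associatorGraph (x : X) (y : Y) (z : Z) : pair₁ ρX ρY ρZ ρXY ρYZ x *
    pair₂ ρX ρY ρZ ρXY ρYZ y * pair₃ ρX ρY ρZ ρXY ρYZ z ∈ associatorGraph hXY hYZ :=
  mul_mem (mul_mem (left_mem_tripleAlg _ _ _ x) (middle_mem_tripleAlg _ _ _ y))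
    (right_mem_tripleAlg _ _ _ z)

/-- The graph contains the pairs of triple products of arbitrary elements, and their left
coordinates `j₁(j₁(x) j₂(y)) j₂(z)` span a dense subspace, by density in the inner and then in the
outer braided product. -/
lemma dense_fst_associatorGraph (a : BraidedTensor ζ ρXY ρZ) :
    a ∈ closure (Prod.fst '' (associatorGraph hXY hYZ :
      Set (BraidedTensor ζ ρXY ρZ × BraidedTensor ζ ρX ρYZ))) := by
  let W := ((associatorGraph hXY hYZ).toSubalgebra.toSubmodule.map
    (LinearMap.fst ℂ (BraidedTensor ζ ρXY ρZ) (BraidedTensor ζ ρX ρYZ))).topologicalClosure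
  have hW : IsClosed (W : Set (BraidedTensor ζ ρXY ρZ)) := Submodule.isClosed_topologicalClosure _
  have h1 : ∀ (z : Z) (w : BraidedTensor ζ ρX ρY), j₁ ζ ρXY ρZ w * j₂ ζ ρXY ρZ z ∈ W := by
    intro z
    refine ContinuousLinearMap.apply_mem_of_dense_span (dense_span ζ ρX ρY)
      (f := ((ContinuousLinearMap.mul ℂ _).flip (j₂ ζ ρXY ρZ z)).comp (j₁ ζ ρXY ρZ).toCLM) hW ?_
    rintro _ ⟨x, y, rfl⟩
    refine Submodule.le_topologicalClosure _ ⟨_, triple_mem_associatorGraph hXY hYZ x y z, ?_⟩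
    exact congrArg (· * j₂ ζ ρXY ρZ z) (map_mul (j₁ ζ ρXY ρZ) _ _).symm
  refine ContinuousLinearMap.apply_mem_of_dense_span (dense_span ζ ρXY ρZ)
    (f := ContinuousLinearMap.id ℂ _) hW ?_ a
  rintro _ ⟨w, z, rfl⟩
  exact h1 z w

lemma dense_snd_associatorGraph (a : BraidedTensor ζ ρX ρYZ) :
    a ∈ closure (Prod.snd '' (associatorGraph hXY hYZ :
      Set (BraidedTensor ζ ρXY ρZ × BraidedTensor ζ ρX ρYZ))) := by
  let W := ((associatorGraph hXY hYZ).toSubalgebra.toSubmodule.map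
    (LinearMap.snd ℂ (BraidedTensor ζ ρXY ρZ) (BraidedTensor ζ ρX ρYZ))).topologicalClosure
  have hW : IsClosed (W : Set (BraidedTensor ζ ρX ρYZ)) := Submodule.isClosed_topologicalClosure _
  have h1 : ∀ (x : X) (w : BraidedTensor ζ ρY ρZ), j₁ ζ ρX ρYZ x * j₂ ζ ρX ρYZ w ∈ W := by
    intro x
    refine ContinuousLinearMap.apply_mem_of_dense_span (dense_span ζ ρY ρZ)
      (f := (ContinuousLinearMap.mul ℂ _ (j₁ ζ ρX ρYZ x)).comp (j₂ ζ ρX ρYZ).toCLM) hW ?_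
    rintro _ ⟨y, z, rfl⟩
    refine Submodule.le_topologicalClosure _ ⟨_, triple_mem_associatorGraph hXY hYZ x y z, ?_⟩
    exact (mul_assoc _ _ _).trans
      (congrArg (j₁ ζ ρX ρYZ x * ·) (map_mul (j₂ ζ ρX ρYZ) _ _).symm)
  refine ContinuousLinearMap.apply_mem_of_dense_span (dense_span ζ ρX ρYZ)
    (f := ContinuousLinearMap.id ℂ _) hW ?_ a
  rintro _ ⟨x, w, rfl⟩
  exact h1 x w

variable {hXY hYZ}

lemma eqOn_associatorGraph {Λ : BraidedTensor ζ ρXY ρZ →L[ℂ] ℂ}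
    {Λ' : BraidedTensor ζ ρX ρYZ →L[ℂ] ℂ}
    (h : ∀ (k l m : ℤ) (x : X) (y : Y) (z : Z), ρX.IsHomogeneous k x → ρY.IsHomogeneous l y →
      ρZ.IsHomogeneous m z →
      Λ (j₁ ζ ρXY ρZ (j₁ ζ ρX ρY x) * j₁ ζ ρXY ρZ (j₂ ζ ρX ρY y) * j₂ ζ ρXY ρZ z) =
      Λ' (j₁ ζ ρX ρYZ x * j₂ ζ ρX ρYZ (j₁ ζ ρY ρZ y) * j₂ ζ ρX ρYZ (j₂ ζ ρY ρZ z)))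
    {t : BraidedTensor ζ ρXY ρZ × BraidedTensor ζ ρX ρYZ} (ht : t ∈ associatorGraph hXY hYZ) :
    Λ t.1 = Λ' t.2 := by
  refine eqOn_tripleAlg _ _ _
    (f := Λ.comp (ContinuousLinearMap.fst ℂ (BraidedTensor ζ ρXY ρZ) (BraidedTensor ζ ρX ρYZ)))
    (g := Λ'.comp (ContinuousLinearMap.snd ℂ (BraidedTensor ζ ρXY ρZ) (BraidedTensor ζ ρX ρYZ)))
    ?_ ht
  rintro _ ⟨k, l, m, x, y, z, hx, hy, hz, rfl⟩
  exact h k l m x y z hx hy hz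

/-- On the graph every functional of the right coordinate equals one of the left coordinate, because
the two agree on homogeneous triples. Hence a zero left coordinate kills all functionals of the
right one, and these separate points. -/
lemma snd_eq_zero_of_mem_associatorGraph
    {t : BraidedTensor ζ ρXY ρZ × BraidedTensor ζ ρX ρYZ} (ht : t ∈ associatorGraph hXY hYZ)
    (h0 : t.1 = 0) : t.2 = 0 := by
  refine eq_zero_of_rightFunctional fun f g h i j => ?_
  -- A triple of degrees `(k, l, m)` is seen on the right by `i = (l, m)`, `j = (k, l + m)` and on
  -- the left by `(k, l)`, `(k + l, m)`. Solving for `k = j.1`, `l = i.1`, `m = i.2` gives the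
  -- matching left indices, provided that `j.2 = i.1 + i.2`.
  by_cases hij : j.2 = i.1 + i.2
  · rw [← eqOn_associatorGraph (Λ := (leftFunctional ρZ ρXY f g h (j.1, i.1)
      (j.1 + i.1, i.2)).toCLM) (fun k l m x y z hx hy hz => ?_) ht, h0, map_zero]
    rw [leftFunctional_homogeneous hXY _ _ _ _ _ hx hy hz,
      rightFunctional_homogeneous hYZ _ _ _ _ _ hx hy hz]
    refine if_congr ?_ rfl rfl
    simp only [Prod.ext_iff]
    omega
  -- Indices of this kind belong to no triple of degrees, so the functional vanishes on all
  -- homogeneous triples and corresponds to `0`.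
  · rw [← eqOn_associatorGraph (Λ := 0) (fun k l m x y z hx hy hz => ?_) ht]
    · rfl
    rw [rightFunctional_homogeneous hYZ _ _ _ _ _ hx hy hz, if_neg]
    · rfl
    simp only [Prod.ext_iff]
    omega

lemma fst_eq_zero_of_mem_associatorGraph
    {t : BraidedTensor ζ ρXY ρZ × BraidedTensor ζ ρX ρYZ} (ht : t ∈ associatorGraph hXY hYZ)
    (h0 : t.2 = 0) : t.1 = 0 := by
  refine eq_zero_of_leftFunctional fun f g h i j => ?_
  by_cases hij : j.1 = i.1 + i.2
  · rw [eqOn_associatorGraph (Λ' := (rightFunctional ρX ρYZ f g h (i.2, j.2)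
      (i.1, i.2 + j.2)).toCLM) (fun k l m x y z hx hy hz => ?_) ht, h0, map_zero]
    rw [leftFunctional_homogeneous hXY _ _ _ _ _ hx hy hz,
      rightFunctional_homogeneous hYZ _ _ _ _ _ hx hy hz]
    refine if_congr ?_ rfl rfl
    simp only [Prod.ext_iff]
    omega
  · rw [eqOn_associatorGraph (Λ' := 0) (fun k l m x y z hx hy hz => ?_) ht]
    · rfl
    rw [leftFunctional_homogeneous hXY _ _ _ _ _ hx hy hz, if_neg]
    · rfl
    simp only [Prod.ext_iff]
    omega

/-- The braided tensor product is associative. -/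
theorem exists_associator (hXY : IsCoaction ρXY) (hYZ : IsCoaction ρYZ) :
    ∃ α : BraidedTensor ζ ρXY ρZ ≃⋆ₐ[ℂ] BraidedTensor ζ ρX ρYZ, IsAssociator α := by
  obtain ⟨α, hα⟩ := exists_starAlgEquiv_of_graph (associatorGraph hXY hYZ)
    (isClosed_tripleAlg _ _ _) (dense_fst_associatorGraph hXY hYZ)
    (dense_snd_associatorGraph hXY hYZ) (fun _ => snd_eq_zero_of_mem_associatorGraph)
    (fun _ => fst_eq_zero_of_mem_associatorGraph)
  exact ⟨α, fun x => hα _ (left_mem_tripleAlg _ _ _ x), fun y => hα _ (middle_mem_tripleAlg _ _ _ y),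
    fun z => hα _ (right_mem_tripleAlg _ _ _ z)⟩

end associator

end BraidedTensor

/-! ### Closed spans of products -/

section closedMul

variable {A : Type*} [CStarAlgebra A] {S T : Set A}

lemma isClosed_closedMul : IsClosed (closedMul S T : Set A) :=
  Submodule.isClosed_topologicalClosure _

lemma mul_mem_closedMul {s t : A} (hs : s ∈ S) (ht : t ∈ T) : s * t ∈ closedMul S T :=
  Submodule.le_topologicalClosure _ (Submodule.subset_span ⟨s, hs, t, ht, rfl⟩)

/-- A continuous linear map sends `closedMul S T` into a closed subspace as soon as it does so with
the products. -/
lemma apply_mem_of_mem_closedMul {B : Type*} [NormedAddCommGroup B] [NormedSpace ℂ B]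
    {f : A →L[ℂ] B} {W : Submodule ℂ B} (hW : IsClosed (W : Set B))
    (h : ∀ s ∈ S, ∀ t ∈ T, f (s * t) ∈ W) {a : A} (ha : a ∈ closedMul S T) : f a ∈ W := by
  have hle : closedMul S T ≤ W.comap f.toLinearMap :=
    Submodule.topologicalClosure_minimal _ (Submodule.span_le.2 (by
      rintro _ ⟨s, hs, t, ht, rfl⟩
      exact h s hs t ht)) (hW.preimage f.continuous)
  exact hle ha

lemma mul_mem_closedMul_left {r : A} (hr : ∀ s ∈ S, r * s ∈ S) {a : A} (ha : a ∈ closedMul S T) :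
    r * a ∈ closedMul S T :=
  apply_mem_of_mem_closedMul (f := ContinuousLinearMap.mul ℂ A r) isClosed_closedMul
    (fun s hs t ht => by
      rw [ContinuousLinearMap.mul_apply', ← mul_assoc]
      exact mul_mem_closedMul (hr s hs) ht) ha

lemma mul_mem_closedMul_right {r : A} (hr : ∀ t ∈ T, t * r ∈ T) {a : A} (ha : a ∈ closedMul S T) :
    a * r ∈ closedMul S T :=
  apply_mem_of_mem_closedMul (f := (ContinuousLinearMap.mul ℂ A).flip r) isClosed_closedMul
    (fun s hs t ht => by
      rw [ContinuousLinearMap.flip_apply, ContinuousLinearMap.mul_apply', mul_assoc]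
      exact mul_mem_closedMul hs (hr t ht)) ha

lemma star_mem_closedMul (hS : ∀ s ∈ S, star s ∈ S) (hT : ∀ t ∈ T, star t ∈ T) {a : A}
    (ha : a ∈ closedMul S T) : star a ∈ closedMul T S := by
  refine map_mem_closure continuous_star ha fun s hs => ?_
  refine Submodule.span_induction (p := fun s _ => star s ∈ Submodule.span ℂ _) ?_ ?_ ?_ ?_ hs
  · rintro _ ⟨s, hs, t, ht, rfl⟩
    rw [star_mul]
    exact Submodule.subset_span ⟨_, hT t ht, _, hS s hs, rfl⟩
  · rw [star_zero]; exact Submodule.zero_mem _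
  · intro s t _ _ h h'; rw [star_add]; exact Submodule.add_mem _ h h'
  · intro c s _ h; rw [star_smul]; exact Submodule.smul_mem _ _ h

lemma closedMul_swap_eq_top (hS : ∀ s ∈ S, star s ∈ S) (hT : ∀ t ∈ T, star t ∈ T)
    (h : closedMul S T = ⊤) : closedMul T S = ⊤ := by
  refine eq_top_iff.2 fun a _ => ?_
  rw [← star_star a]
  exact star_mem_closedMul hS hT (by rw [h]; trivial)

end closedMul

lemma CircleCoaction.IsHomogeneous.sum {X : Type*} [CStarAlgebra X] {ρ : CircleCoaction X} {k : ℤ}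
    {ι : Type*} {s : Finset ι} {f : ι → X} (h : ∀ i ∈ s, ρ.IsHomogeneous k (f i)) :
    ρ.IsHomogeneous k (∑ i ∈ s, f i) := fun z => by
  rw [map_sum, ContinuousMap.sum_apply, Finset.smul_sum]
  exact Finset.sum_congr rfl fun i hi => h i hi z

/-! ### Matrices over *-algebras: unitarity, twisted conjugation, gauge transformations -/

namespace FreeUnitary

open Matrix

section matrix

variable {n : ℕ} {R S : Type*} [Ring R] [StarRing R] [Algebra ℂ R] [Ring S] [StarRing S]
  [Algebra ℂ S] (φ : R →⋆ₐ[ℂ] S) (v w : Matrix (Fin n) (Fin n) R)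

lemma map_matrix_mul : (v * w).map φ = v.map φ * w.map φ := by
  ext i j
  simp only [Matrix.map_apply, Matrix.mul_apply, map_sum, map_mul]

lemma map_matrix_star : (star v).map φ = star (v.map φ) := by
  ext i j
  exact map_star φ _

lemma map_matrix_one : (1 : Matrix (Fin n) (Fin n) R).map φ = 1 :=
  Matrix.map_one φ (map_zero φ) (map_one φ)

lemma map_mem_unitary {v : Matrix (Fin n) (Fin n) R} (hv : v ∈ unitary (Matrix (Fin n) (Fin n) R)) :
    v.map φ ∈ unitary (Matrix (Fin n) (Fin n) S) := by
  rw [Unitary.mem_iff] at hv ⊢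
  rw [← map_matrix_star, ← map_matrix_mul, ← map_matrix_mul, hv.1, hv.2, map_matrix_one]
  exact ⟨rfl, rfl⟩

/-- This translates between the entrywise relations of the presentation and unitarity of a matrix;
it serves both to see that the universal matrix is unitary and to check the relations for a given
one. -/
lemma map_mem_unitary_iff :
    v.map φ ∈ unitary (Matrix (Fin n) (Fin n) S) ↔ ∀ r ∈ unitaryRels v, φ r = 0 := by
  have key : ∀ m : Matrix (Fin n) (Fin n) R, m.map φ = 1 ↔ ∀ i j, φ ((m - 1) i j) = 0 := by
    intro m
    rw [← Matrix.ext_iff]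
    refine forall_congr' fun i => forall_congr' fun j => ?_
    rw [Matrix.sub_apply, map_sub, sub_eq_zero, ← Matrix.map_apply (f := φ) (M := 1),
      map_matrix_one, Matrix.map_apply]
  rw [Unitary.mem_iff, ← map_matrix_star, ← map_matrix_mul, ← map_matrix_mul, key, key]
  constructor
  · rintro ⟨h1, h2⟩ r (⟨i, j, rfl⟩ | ⟨i, j, rfl⟩)
    · exact h1 i j
    · exact h2 i j
  · exact fun h => ⟨fun i j => h _ (Or.inl ⟨i, j, rfl⟩), fun i j => h _ (Or.inr ⟨i, j, rfl⟩)⟩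

variable (F : GL (Fin n) ℂ) (ζ : Circle) (d : Fin n → ℤ)

lemma map_conjMatrix : (conjMatrix ζ d v).map φ = conjMatrix ζ d (v.map φ) := by
  ext i j
  change φ (((ζ ^ (d i * (d j - d i)) : Circle) : ℂ) • star (v i j)) =
    ((ζ ^ (d i * (d j - d i)) : Circle) : ℂ) • star (φ (v i j))
  rw [map_smul, map_star]

lemma map_scalarMatrix (M : Matrix (Fin n) (Fin n) ℂ) :
    (M.map (algebraMap ℂ R)).map φ = M.map (algebraMap ℂ S) := by
  ext i j
  exact φ.toAlgHom.commutes _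

lemma map_twistedConj : (twistedConj F ζ d v).map φ = twistedConj F ζ d (v.map φ) := by
  rw [twistedConj, map_matrix_mul, map_matrix_mul, map_scalarMatrix, map_scalarMatrix,
    map_conjMatrix, twistedConj]

variable (R) in
lemma inv_mul_scalarMatrix : ((F⁻¹ : GL (Fin n) ℂ) : Matrix (Fin n) (Fin n) ℂ).map (algebraMap ℂ R) *
    (F : Matrix (Fin n) (Fin n) ℂ).map (algebraMap ℂ R) = 1 := by
  rw [← Matrix.map_mul, Units.inv_mul, Matrix.map_one _ (map_zero _) (map_one _)]

lemma twistedConj_apply (i j : Fin n) : twistedConj F ζ d v i j =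
    ∑ l, ∑ k, ((F : Matrix (Fin n) (Fin n) ℂ) i k *
      ((F⁻¹ : GL (Fin n) ℂ) : Matrix (Fin n) (Fin n) ℂ) l j) • conjMatrix ζ d v k l := by
  rw [twistedConj, Matrix.mul_apply]
  refine Finset.sum_congr rfl fun l _ => ?_
  rw [Matrix.mul_apply, Finset.sum_mul]
  refine Finset.sum_congr rfl fun k _ => ?_
  rw [Matrix.map_apply, Matrix.map_apply, ← Algebra.commutes, ← Algebra.smul_def, ← Algebra.smul_def,
    smul_smul, mul_comm]

/-- The entries of `v*` are linear combinations of those of `F v̄_ζ F⁻¹`. -/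
lemma star_mem_of_twistedConj_mem {W : Submodule ℂ R} (h : ∀ i j, twistedConj F ζ d v i j ∈ W)
    (i j : Fin n) : star (v i j) ∈ W := by
  have h1 : conjMatrix ζ d v = ((F⁻¹ : GL (Fin n) ℂ) : Matrix (Fin n) (Fin n) ℂ).map
      (algebraMap ℂ R) * twistedConj F ζ d v * (F : Matrix (Fin n) (Fin n) ℂ).map (algebraMap ℂ R) := by
    rw [twistedConj, mul_assoc, mul_assoc, mul_assoc, inv_mul_scalarMatrix, mul_one, ← mul_assoc,
      inv_mul_scalarMatrix, one_mul]
  have h2 : conjMatrix ζ d v i j ∈ W := by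
    rw [h1, Matrix.mul_apply]
    refine W.sum_mem fun l _ => ?_
    rw [Matrix.map_apply, ← Algebra.commutes, ← Algebra.smul_def, Matrix.mul_apply]
    refine W.smul_mem _ (W.sum_mem fun k _ => ?_)
    rw [Matrix.map_apply, ← Algebra.smul_def]
    exact W.smul_mem _ (h k l)
  have h3 : star (v i j) =
      (((ζ ^ (d i * (d j - d i)))⁻¹ : Circle) : ℂ) • conjMatrix ζ d v i j := by
    change _ = _ • (((ζ ^ (d i * (d j - d i)) : Circle) : ℂ) • star (v i j))
    rw [smul_smul, ← Circle.coe_mul, inv_mul_cancel, Circle.coe_one, one_smul]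
  rw [h3]
  exact W.smul_mem _ h2

end matrix

section gauge

variable {n : ℕ} {R : Type*} [CStarAlgebra R]

/-- The matrix with entries `z ^ (e j - e i) v i j`. -/
def gaugeMatrix (e : Fin n → ℤ) (z : Circle) (v : Matrix (Fin n) (Fin n) R) :
    Matrix (Fin n) (Fin n) R :=
  Matrix.of fun i j => ((z ^ (e j - e i) : Circle) : ℂ) • v i j

lemma circle_zpow_star (z : Circle) (k : ℤ) : star ((z ^ k : Circle) : ℂ) = (z ^ (-k) : Circle) := by
  rw [_root_.zpow_neg, Circle.coe_inv_eq_conj]; rfl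

/-- The new matrix is `D* v D` for the diagonal unitary `D = diag(z^(e_i))`. So the rescaling is
compatible with `v* v` and `v v*`, and it fixes the identity matrix. -/
lemma gaugeMatrix_mem_unitary (e : Fin n → ℤ) (z : Circle) {v : Matrix (Fin n) (Fin n) R}
    (hv : v ∈ unitary (Matrix (Fin n) (Fin n) R)) :
    gaugeMatrix e z v ∈ unitary (Matrix (Fin n) (Fin n) R) := by
  rw [Unitary.mem_iff] at hv ⊢
  constructor
  · have h : star (gaugeMatrix e z v) * gaugeMatrix e z v =
        gaugeMatrix e z (star v * v) := by
      ext i j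
      change _ = ((z ^ (e j - e i) : Circle) : ℂ) • (star v * v) i j
      rw [Matrix.mul_apply, Matrix.mul_apply, Finset.smul_sum]
      refine Finset.sum_congr rfl fun k _ => ?_
      change star (((z ^ (e i - e k) : Circle) : ℂ) • v k i) *
        (((z ^ (e j - e k) : Circle) : ℂ) • v k j) = _ • (star (v k i) * v k j)
      rw [star_smul, smul_mul_smul_comm, circle_zpow_star, ← Circle.coe_mul, ← _root_.zpow_add]
      exact congrArg (fun m : ℤ => ((z ^ m : Circle) : ℂ) • (star (v k i) * v k j)) (by ring)
    rw [h, hv.1]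
    ext i j
    change ((z ^ (e j - e i) : Circle) : ℂ) • (1 : Matrix (Fin n) (Fin n) R) i j = _
    rcases eq_or_ne i j with rfl | hij
    · rw [sub_self, zpow_zero, Circle.coe_one, one_smul]
    · rw [Matrix.one_apply_ne hij, smul_zero]
  · have h : gaugeMatrix e z v * star (gaugeMatrix e z v) =
        gaugeMatrix e z (v * star v) := by
      ext i j
      change _ = ((z ^ (e j - e i) : Circle) : ℂ) • (v * star v) i j
      rw [Matrix.mul_apply, Matrix.mul_apply, Finset.smul_sum]
      refine Finset.sum_congr rfl fun k _ => ?_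
      change (((z ^ (e k - e i) : Circle) : ℂ) • v i k) *
        star (((z ^ (e k - e j) : Circle) : ℂ) • v j k) = _ • (v i k * star (v j k))
      rw [star_smul, smul_mul_smul_comm, circle_zpow_star, ← Circle.coe_mul, ← _root_.zpow_add]
      exact congrArg (fun m : ℤ => ((z ^ m : Circle) : ℂ) • (v i k * star (v j k))) (by ring)
    rw [h, hv.2]
    ext i j
    change ((z ^ (e j - e i) : Circle) : ℂ) • (1 : Matrix (Fin n) (Fin n) R) i j = _
    rcases eq_or_ne i j with rfl | hij
    · rw [sub_self, zpow_zero, Circle.coe_one, one_smul]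
    · rw [Matrix.one_apply_ne hij, smul_zero]

/-- Conjugation turns the factor `z^(d_l - d_k)` into `z^(d_k - d_l)`. A summand `F_ik F⁻¹_lj`
survives only if `d'_i = -d_k + d₀` and `d'_j = -d_l + d₀`, and then `d_k - d_l = d'_j - d'_i`
depends on `i` and `j` alone. This is the only use of admissibility. -/
lemma twistedConj_gaugeMatrix {F : GL (Fin n) ℂ} {d d' : Fin n → ℤ} {d₀ : ℤ}
    (hF : IsAdmissible F d d' d₀) (ζ z : Circle) (v : Matrix (Fin n) (Fin n) R) :
    twistedConj F ζ d (gaugeMatrix d z v) = gaugeMatrix d' z (twistedConj F ζ d v) := by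
  ext i j
  change _ = ((z ^ (d' j - d' i) : Circle) : ℂ) • twistedConj F ζ d v i j
  rw [twistedConj_apply, twistedConj_apply, Finset.smul_sum]
  refine Finset.sum_congr rfl fun l _ => ?_
  rw [Finset.smul_sum]
  refine Finset.sum_congr rfl fun k _ => ?_
  by_cases hk : -d k + d₀ = d' i
  · by_cases hl : -d l + d₀ = d' j
    · have h : conjMatrix ζ d (gaugeMatrix d z v) k l =
          ((z ^ (d' j - d' i) : Circle) : ℂ) • conjMatrix ζ d v k l := by
        change ((ζ ^ (d k * (d l - d k)) : Circle) : ℂ) •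
            star (((z ^ (d l - d k) : Circle) : ℂ) • v k l) =
          _ • ((ζ ^ (d k * (d l - d k)) : Circle) : ℂ) • star (v k l)
        rw [star_smul, circle_zpow_star, smul_comm, ← hk, ← hl]
        congr 4
        ring
      rw [h, smul_comm]
    · rw [(hF j l hl).2, mul_zero, zero_smul, zero_smul, smul_zero]
  · rw [(hF i k hk).1, zero_mul, zero_smul, zero_smul, smul_zero]

end gauge

end FreeUnitary

/-! ### The universal property of the braided free unitary quantum group -/

namespace FreeUnitary

open BraidedTensor CircleCoaction

variable {n : ℕ} {F : Matrix.GeneralLinearGroup (Fin n) ℂ} {ζ : Circle} {d d' : Fin n → ℤ} {d₀ : ℤ}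

section universal

lemma map_freeMatrix_lift {B : Type*} [CStarAlgebra B] (v : Matrix (Fin n) (Fin n) B) :
    (freeMatrix n).map (FreeStarAlgebra.lift fun p : Fin n × Fin n => v p.1 p.2) = v := by
  ext i j
  exact FreeStarAlgebra.lift_gen _ _

variable (F ζ d) in
lemma u_mem_unitary : u F ζ d ∈ unitary (Matrix (Fin n) (Fin n) (FreeUnitary F ζ d)) :=
  (map_mem_unitary_iff (presentation F ζ d).toAlg (freeMatrix n)).2 fun _ hr =>
    (presentation F ζ d).toAlg_rel (Or.inl hr)

variable (F ζ d) in
lemma twistedConj_u_mem_unitary : twistedConj F ζ d (u F ζ d) ∈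
    unitary (Matrix (Fin n) (Fin n) (FreeUnitary F ζ d)) := by
  have h := (map_mem_unitary_iff (presentation F ζ d).toAlg
    (twistedConj F ζ d (freeMatrix n))).2 fun _ hr =>
      (presentation F ζ d).toAlg_rel (Or.inr hr)
  rw [map_twistedConj] at h
  exact h

lemma hom_ext {B : Type*} [CStarAlgebra B] {φ ψ : FreeUnitary F ζ d →⋆ₐ[ℂ] B}
    (h : ∀ i j, φ (u F ζ d i j) = ψ (u F ζ d i j)) : φ = ψ :=
  CStarPresentation.hom_ext (P := presentation F ζ d) fun p => h p.1 p.2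

/-- The homomorphism defined by a matrix that satisfies the relations. -/
def lift {B : Type*} [CStarAlgebra B] (v : Matrix (Fin n) (Fin n) B)
    (h1 : v ∈ unitary (Matrix (Fin n) (Fin n) B))
    (h2 : twistedConj F ζ d v ∈ unitary (Matrix (Fin n) (Fin n) B)) :
    FreeUnitary F ζ d →⋆ₐ[ℂ] B :=
  (presentation F ζ d).lift (fun p => v p.1 p.2) (by
    rintro r (hr | hr)
    · exact (map_mem_unitary_iff _ (freeMatrix n)).1
        (by rw [map_freeMatrix_lift]; exact h1) r hr
    · exact (map_mem_unitary_iff _ (twistedConj F ζ d (freeMatrix n))).1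
        (by rw [map_twistedConj, map_freeMatrix_lift]; exact h2) r hr)

@[simp]
lemma lift_u {B : Type*} [CStarAlgebra B] (v : Matrix (Fin n) (Fin n) B)
    (h1 : v ∈ unitary (Matrix (Fin n) (Fin n) B))
    (h2 : twistedConj F ζ d v ∈ unitary (Matrix (Fin n) (Fin n) B)) (i j : Fin n) :
    lift v h1 h2 (u F ζ d i j) = v i j :=
  (presentation F ζ d).lift_gen _ _ (i, j)

lemma dense_span_of_mul_mem {S : Set (FreeUnitary F ζ d)} (h1 : 1 ∈ S)
    (hg : ∀ i j, ∀ s ∈ S, u F ζ d i j * s ∈ S)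
    (hs : ∀ i j, ∀ s ∈ S, star (u F ζ d i j) * s ∈ S) :
    (Submodule.span ℂ S).topologicalClosure = ⊤ :=
  CStarPresentation.dense_span_of_mul_mem (presentation F ζ d) h1
    (fun p s h => Submodule.le_topologicalClosure _ (Submodule.subset_span (hg p.1 p.2 s h)))
    (fun p s h => Submodule.le_topologicalClosure _ (Submodule.subset_span (hs p.1 p.2 s h)))

end universal

/-! ### The coaction of the circle -/

section coaction

variable (hF : IsAdmissible F d d' d₀)

/-- The gauge automorphism `u i j ↦ z ^ (d j - d i) u i j`. -/
def gauge (ζ z : Circle) : FreeUnitary F ζ d →⋆ₐ[ℂ] FreeUnitary F ζ d :=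
  lift (gaugeMatrix d z (u F ζ d)) (gaugeMatrix_mem_unitary d z (u_mem_unitary F ζ d)) (by
    rw [twistedConj_gaugeMatrix hF]
    exact gaugeMatrix_mem_unitary d' z (twistedConj_u_mem_unitary F ζ d))

lemma gauge_u (z : Circle) (i j : Fin n) :
    gauge hF ζ z (u F ζ d i j) = ((z ^ (d j - d i) : Circle) : ℂ) • u F ζ d i j :=
  lift_u _ _ _ i j

/-- The coaction `ρ` on `C(U_ζ⁺(F))`. -/
def coaction (ζ : Circle) : CircleCoaction (FreeUnitary F ζ d) :=
  CircleCoaction.ofFamily (gauge hF ζ) (by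
    refine dense_span_of_mul_mem ⟨0, fun z => ?_⟩ ?_ ?_
    · rw [map_one, zpow_zero, Circle.coe_one, one_smul]
    · rintro i j s ⟨k, hs⟩
      refine ⟨d j - d i + k, fun z => ?_⟩
      rw [map_mul, gauge_u, hs, smul_mul_smul_comm, zpow_add, Circle.coe_mul]
    · rintro i j s ⟨k, hs⟩
      refine ⟨-(d j - d i) + k, fun z => ?_⟩
      rw [map_mul, map_star, gauge_u, hs, star_smul, circle_zpow_star, smul_mul_smul_comm, zpow_add,
        Circle.coe_mul])

lemma isHomogeneous_u (i j : Fin n) :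
    (coaction hF ζ).IsHomogeneous (d j - d i) (u F ζ d i j) := fun z => gauge_u hF z i j

end coaction

/-! ### The comultiplication, coassociativity and bisimplifiability -/

section comultiplication

variable {ρ : CircleCoaction (FreeUnitary F ζ d)}
  (hρ : ∀ i j, ρ.IsHomogeneous (d j - d i) (u F ζ d i j))

include hρ in
-- The adjoint of a summand is `j₂(u_kj*) j₁(u_ik*)`, and exchanging the factors gives `ζ^((d_j -
-- d_k)(d_k - d_i))`. The claim is the identity `d_i (d_j - d_i) + (d_j - d_k)(d_k - d_i) = d_i (d_k
-- - d_i) + d_k (d_j - d_k)`, which is the reason for the weights in `v̄_ζ`.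
lemma conjMatrix_j₁_mul_j₂ : conjMatrix ζ d ((u F ζ d).map (j₁ ζ ρ ρ) * (u F ζ d).map (j₂ ζ ρ ρ)) =
    conjMatrix ζ d ((u F ζ d).map (j₁ ζ ρ ρ)) * conjMatrix ζ d ((u F ζ d).map (j₂ ζ ρ ρ)) := by
  ext i j
  rw [Matrix.mul_apply]
  change ((ζ ^ (d i * (d j - d i)) : Circle) : ℂ) •
    star (((u F ζ d).map (j₁ ζ ρ ρ) * (u F ζ d).map (j₂ ζ ρ ρ)) i j) = _
  rw [Matrix.mul_apply, star_sum, Finset.smul_sum]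
  refine Finset.sum_congr rfl fun k _ => ?_
  change _ • star (j₁ ζ ρ ρ (u F ζ d i k) * j₂ ζ ρ ρ (u F ζ d k j)) =
    (((ζ ^ (d i * (d k - d i)) : Circle) : ℂ) • star (j₁ ζ ρ ρ (u F ζ d i k))) *
    (((ζ ^ (d k * (d j - d k)) : Circle) : ℂ) • star (j₂ ζ ρ ρ (u F ζ d k j)))
  rw [star_mul, ← map_star, ← map_star, j₂_mul_j₁ (hρ i k).star (hρ k j).star, smul_mul_smul_comm,
    smul_smul, ← Circle.coe_mul, ← Circle.coe_mul, ← zpow_add, ← zpow_add]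
  exact congrArg (fun m : ℤ => ((ζ ^ m : Circle) : ℂ) •
    (j₁ ζ ρ ρ (star (u F ζ d i k)) * j₂ ζ ρ ρ (star (u F ζ d k j)))) (by ring)

include hρ in
-- Multiplicativity of the weighted conjugation passes to its conjugate by `F`, since the inner `F⁻¹
-- F` cancels.
lemma twistedConj_j₁_mul_j₂ :
    twistedConj F ζ d ((u F ζ d).map (j₁ ζ ρ ρ) * (u F ζ d).map (j₂ ζ ρ ρ)) =
    twistedConj F ζ d ((u F ζ d).map (j₁ ζ ρ ρ)) *
      twistedConj F ζ d ((u F ζ d).map (j₂ ζ ρ ρ)) := by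
  rw [twistedConj, conjMatrix_j₁_mul_j₂ hρ, twistedConj, twistedConj]
  simp only [mul_assoc]
  rw [← mul_assoc (Matrix.map _ _) (Matrix.map _ _) (conjMatrix _ _ _ * _), inv_mul_scalarMatrix,
    one_mul]

lemma j₁_mul_j₂_mem_unitary : (u F ζ d).map (j₁ ζ ρ ρ) * (u F ζ d).map (j₂ ζ ρ ρ) ∈
    unitary (Matrix (Fin n) (Fin n) (BraidedTensor ζ ρ ρ)) :=
  mul_mem (map_mem_unitary _ (u_mem_unitary F ζ d)) (map_mem_unitary _ (u_mem_unitary F ζ d))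

include hρ in
lemma twistedConj_j₁_mul_j₂_mem_unitary :
    twistedConj F ζ d ((u F ζ d).map (j₁ ζ ρ ρ) * (u F ζ d).map (j₂ ζ ρ ρ)) ∈
    unitary (Matrix (Fin n) (Fin n) (BraidedTensor ζ ρ ρ)) := by
  rw [twistedConj_j₁_mul_j₂ hρ, ← map_twistedConj, ← map_twistedConj]
  exact mul_mem (map_mem_unitary _ (twistedConj_u_mem_unitary F ζ d))
    (map_mem_unitary _ (twistedConj_u_mem_unitary F ζ d))

/-- The comultiplication. -/
def comul : FreeUnitary F ζ d →⋆ₐ[ℂ] BraidedTensor ζ ρ ρ :=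
  lift ((u F ζ d).map (j₁ ζ ρ ρ) * (u F ζ d).map (j₂ ζ ρ ρ))
    j₁_mul_j₂_mem_unitary (twistedConj_j₁_mul_j₂_mem_unitary hρ)

lemma map_u_comul :
    (u F ζ d).map (comul hρ) = (u F ζ d).map (j₁ ζ ρ ρ) * (u F ζ d).map (j₂ ζ ρ ρ) := by
  ext i j
  exact lift_u _ j₁_mul_j₂_mem_unitary (twistedConj_j₁_mul_j₂_mem_unitary hρ) i j

lemma comul_u (i j : Fin n) : comul hρ (u F ζ d i j) =
    ∑ k, j₁ ζ ρ ρ (u F ζ d i k) * j₂ ζ ρ ρ (u F ζ d k j) :=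
  (lift_u _ j₁_mul_j₂_mem_unitary (twistedConj_j₁_mul_j₂_mem_unitary hρ) i j).trans (Matrix.mul_apply ..)

lemma map_twistedConj_u_comul :
    (twistedConj F ζ d (u F ζ d)).map (comul hρ) =
      (twistedConj F ζ d (u F ζ d)).map (j₁ ζ ρ ρ) *
        (twistedConj F ζ d (u F ζ d)).map (j₂ ζ ρ ρ) := by
  rw [map_twistedConj, map_u_comul, twistedConj_j₁_mul_j₂ hρ, map_twistedConj, map_twistedConj]

/-- It suffices to look at the generators. Each summand of `Δ(u_ij)` has degree `(d_k - d_i) + (d_j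
- d_k) = d_j - d_i`, which is that of `u_ij`. -/
lemma isEquivariant_comul : ρ.IsEquivariant (BraidedTensor.coaction ζ ρ ρ) (comul hρ) := by
  intro a z
  have h : ((BraidedTensor.coaction ζ ρ ρ).act z).comp (comul hρ) =
      (comul hρ).comp (ρ.act z) := by
    refine hom_ext fun i j => ?_
    have h1 : (BraidedTensor.coaction ζ ρ ρ).IsHomogeneous (d j - d i)
        (comul hρ (u F ζ d i j)) := by
      rw [comul_u]
      refine IsHomogeneous.sum fun k _ => ?_
      have h2 := ((hρ i k).map isCoaction_coaction.1).mul ((hρ k j).map (isCoaction_coaction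
        (ζ := ζ) (ρX := ρ)).2)
      rwa [add_comm, sub_add_sub_cancel] at h2
    rw [StarAlgHom.comp_apply, StarAlgHom.comp_apply, act_apply, act_apply, h1 z, hρ i j z, map_smul]
  exact DFunLike.congr_fun h a

/-- On `u_ij` both sides are the double sum of the products of the canonical copies of `u_ik`,
`u_kl` and `u_lj`; only the order of summation and the bracketing differ. -/
lemma coassoc_comul {α : BraidedTensor ζ (BraidedTensor.coaction ζ ρ ρ) ρ ≃⋆ₐ[ℂ]
      BraidedTensor ζ ρ (BraidedTensor.coaction ζ ρ ρ)} (hα : IsAssociator α)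
    (hid : ρ.IsEquivariant ρ (StarAlgHom.id ℂ (FreeUnitary F ζ d))) (a : FreeUnitary F ζ d) :
    α (BraidedTensor.map ζ (isEquivariant_comul hρ) hid (comul hρ a)) =
      BraidedTensor.map ζ hid (isEquivariant_comul hρ) (comul hρ a) := by
  have h : ((α : _ →⋆ₐ[ℂ] _).comp (BraidedTensor.map ζ (isEquivariant_comul hρ) hid)).comp
      (comul hρ) = (BraidedTensor.map ζ hid (isEquivariant_comul hρ)).comp (comul hρ) := by
    refine hom_ext fun i j => ?_
    change α (BraidedTensor.map ζ (isEquivariant_comul hρ) hid (comul hρ (u F ζ d i j))) =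
      BraidedTensor.map ζ hid (isEquivariant_comul hρ) (comul hρ (u F ζ d i j))
    have hid' (b : FreeUnitary F ζ d) : StarAlgHom.id ℂ (FreeUnitary F ζ d) b = b := rfl
    simp only [comul_u, map_sum, map_mul, map_j₁, map_j₂, hid', hα.1, hα.2.1, hα.2.2]
    refine (Finset.sum_congr rfl fun k _ => Finset.sum_mul ..).trans (Finset.sum_comm.trans ?_)
    refine Finset.sum_congr rfl fun k _ => ((Finset.mul_sum ..).trans ?_).symm
    exact Finset.sum_congr rfl fun l _ => (mul_assoc _ _ _).symm
  exact DFunLike.congr_fun h a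

/-- If `Δ(m) = j₁(m) j₂(m)` for a unitary matrix `m`, then `j₁` of the entries of `m` belongs to
`Δ(A) j₂(A)`. -/
lemma j₁_mem_of_map_eq {Δ : FreeUnitary F ζ d →⋆ₐ[ℂ] BraidedTensor ζ ρ ρ}
    {m : Matrix (Fin n) (Fin n) (FreeUnitary F ζ d)}
    (hm : m ∈ unitary (Matrix (Fin n) (Fin n) (FreeUnitary F ζ d)))
    (h : m.map Δ = m.map (j₁ ζ ρ ρ) * m.map (j₂ ζ ρ ρ)) (i j : Fin n) :
    j₁ ζ ρ ρ (m i j) ∈ closedMul (Set.range Δ) (Set.range (j₂ ζ ρ ρ)) := by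
  have h1 : m.map (j₁ ζ ρ ρ) = m.map Δ * (star m).map (j₂ ζ ρ ρ) := by
    rw [h, mul_assoc, ← map_matrix_mul, (Unitary.mem_iff.1 hm).2, map_matrix_one, mul_one]
  have h2 : j₁ ζ ρ ρ (m i j) = (m.map Δ * (star m).map (j₂ ζ ρ ρ)) i j := by rw [← h1]; rfl
  rw [h2, Matrix.mul_apply]
  exact Submodule.sum_mem _ fun k _ => mul_mem_closedMul ⟨_, rfl⟩ ⟨_, rfl⟩

lemma j₂_mem_of_map_eq {Δ : FreeUnitary F ζ d →⋆ₐ[ℂ] BraidedTensor ζ ρ ρ}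
    {m : Matrix (Fin n) (Fin n) (FreeUnitary F ζ d)}
    (hm : m ∈ unitary (Matrix (Fin n) (Fin n) (FreeUnitary F ζ d)))
    (h : m.map Δ = m.map (j₁ ζ ρ ρ) * m.map (j₂ ζ ρ ρ)) (i j : Fin n) :
    j₂ ζ ρ ρ (m i j) ∈ closedMul (Set.range (j₁ ζ ρ ρ)) (Set.range Δ) := by
  have h1 : m.map (j₂ ζ ρ ρ) = (star m).map (j₁ ζ ρ ρ) * m.map Δ := by
    rw [h, ← mul_assoc, ← map_matrix_mul, (Unitary.mem_iff.1 hm).1, map_matrix_one, one_mul]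
  have h2 : j₂ ζ ρ ρ (m i j) = ((star m).map (j₁ ζ ρ ρ) * m.map Δ) i j := by rw [← h1]; rfl
  rw [h2, Matrix.mul_apply]
  exact Submodule.sum_mem _ fun k _ => mul_mem_closedMul ⟨_, rfl⟩ ⟨_, rfl⟩

lemma mul_mem_range {A B : Type*} [CStarAlgebra A] [CStarAlgebra B] (φ : A →⋆ₐ[ℂ] B) (a : A) :
    ∀ s ∈ Set.range φ, φ a * s ∈ Set.range φ := by
  rintro _ ⟨b, rfl⟩
  exact ⟨a * b, map_mul φ a b⟩

lemma mul_mem_range' {A B : Type*} [CStarAlgebra A] [CStarAlgebra B] (φ : A →⋆ₐ[ℂ] B) (a : A) :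
    ∀ s ∈ Set.range φ, s * φ a ∈ Set.range φ := by
  rintro _ ⟨b, rfl⟩
  exact ⟨b * a, map_mul φ b a⟩

lemma star_mem_range {A B : Type*} [CStarAlgebra A] [CStarAlgebra B] (φ : A →⋆ₐ[ℂ] B) :
    ∀ s ∈ Set.range φ, star s ∈ Set.range φ := by
  rintro _ ⟨b, rfl⟩
  exact ⟨star b, map_star φ b⟩

/-- It is enough that the closed span `P = Δ(A) j₂(A)` contains `j₁(A)`, as `P` is stable under
right multiplication by `j₂(A)`. The generators and their adjoints are in `P` by unitarity, and
words are built up by left multiplication. -/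
lemma closedMul_comul_j₂ : closedMul (Set.range (comul hρ)) (Set.range (j₂ ζ ρ ρ)) = ⊤ := by
  set P := closedMul (Set.range (comul hρ)) (Set.range (j₂ ζ ρ ρ)) with hP
  have hPc : IsClosed (P : Set (BraidedTensor ζ ρ ρ)) := isClosed_closedMul
  have hu : ∀ i j, j₁ ζ ρ ρ (u F ζ d i j) ∈ P :=
    j₁_mem_of_map_eq (u_mem_unitary F ζ d) (map_u_comul hρ)
  -- The second unitary `F ū_ζ F⁻¹` satisfies the same formula for `Δ`, and its entries span the
  -- adjoints `u_ij*`.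
  have hu' : ∀ i j, j₁ ζ ρ ρ (star (u F ζ d i j)) ∈ P :=
    star_mem_of_twistedConj_mem (u F ζ d) F ζ d (W := P.comap (j₁ ζ ρ ρ).toAlgHom.toLinearMap)
      (j₁_mem_of_map_eq (twistedConj_u_mem_unitary F ζ d) (map_twistedConj_u_comul hρ))
  -- Moving `j₁(s)` to the left of `j₂(c)` only applies an automorphism to `c`, so `Δ(b) j₂(c)
  -- j₁(s)` lies in `Δ(b) P j₂(A) ⊆ P`. Homogeneity of `s` is needed here, so it is carried along in
  -- the set whose span is shown to be dense.
  have hmul : ∀ (k : ℤ) (s : FreeUnitary F ζ d), ρ.IsHomogeneous k s → j₁ ζ ρ ρ s ∈ P →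
      ∀ p ∈ P, p * j₁ ζ ρ ρ s ∈ P := by
    intro k s hs hsP p hp
    refine apply_mem_of_mem_closedMul
      (f := (ContinuousLinearMap.mul ℂ (BraidedTensor ζ ρ ρ)).flip (j₁ ζ ρ ρ s)) hPc ?_ hp
    rintro _ ⟨b, rfl⟩ _ ⟨c, rfl⟩
    change comul hρ b * j₂ ζ ρ ρ c * j₁ ζ ρ ρ s ∈ P
    rw [mul_assoc, j₂_mul_j₁_left hs, ← mul_assoc]
    exact mul_mem_closedMul_right (mul_mem_range' _ _)
      (mul_mem_closedMul_left (mul_mem_range _ _) hsP)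
  have hdense : (Submodule.span ℂ {s : FreeUnitary F ζ d |
      ∃ k, ρ.IsHomogeneous k s ∧ j₁ ζ ρ ρ s ∈ P}).topologicalClosure = ⊤ := by
    refine dense_span_of_mul_mem ⟨0, ρ.isHomogeneous_one, ?_⟩ ?_ ?_
    · rw [map_one, ← one_mul 1]
      exact mul_mem_closedMul ⟨1, map_one _⟩ ⟨1, map_one _⟩
    · rintro i j s ⟨k, hs, hsP⟩
      exact ⟨_, (hρ i j).mul hs, by rw [map_mul]; exact hmul k s hs hsP _ (hu i j)⟩
    · rintro i j s ⟨k, hs, hsP⟩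
      exact ⟨_, (hρ i j).star.mul hs, by rw [map_mul]; exact hmul k s hs hsP _ (hu' i j)⟩
  have hall : ∀ a, j₁ ζ ρ ρ a ∈ P :=
    ContinuousLinearMap.apply_mem_of_dense_span hdense (f := (j₁ ζ ρ ρ).toCLM) hPc
      fun s hs => hs.choose_spec.2
  refine eq_top_iff.2 fun a _ => ?_
  refine ContinuousLinearMap.apply_mem_of_dense_span (dense_span ζ ρ ρ)
    (f := ContinuousLinearMap.id ℂ _) hPc ?_ a
  rintro _ ⟨x, y, rfl⟩
  exact mul_mem_closedMul_right (mul_mem_range' _ _) (hall x)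

/-- The mirror image, with `j₂(m) = j₁(m)* Δ(m)`. The order `j₁(A) Δ(A)` is the one for which `P` is
a left module over `j₁(A)`. -/
lemma closedMul_j₁_comul : closedMul (Set.range (j₁ ζ ρ ρ)) (Set.range (comul hρ)) = ⊤ := by
  set P := closedMul (Set.range (j₁ ζ ρ ρ)) (Set.range (comul hρ)) with hP
  have hPc : IsClosed (P : Set (BraidedTensor ζ ρ ρ)) := isClosed_closedMul
  have hu : ∀ i j, j₂ ζ ρ ρ (u F ζ d i j) ∈ P :=
    j₂_mem_of_map_eq (u_mem_unitary F ζ d) (map_u_comul hρ)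
  have hu' : ∀ i j, j₂ ζ ρ ρ (star (u F ζ d i j)) ∈ P :=
    star_mem_of_twistedConj_mem (u F ζ d) F ζ d (W := P.comap (j₂ ζ ρ ρ).toAlgHom.toLinearMap)
      (j₂_mem_of_map_eq (twistedConj_u_mem_unitary F ζ d) (map_twistedConj_u_comul hρ))
  -- The homogeneous element now stands on the left, so it can be taken to be a generator or its
  -- adjoint; the words built up so far need not be homogeneous.
  have hmul : ∀ (k : ℤ) (s : FreeUnitary F ζ d), ρ.IsHomogeneous k s → j₂ ζ ρ ρ s ∈ P →
      ∀ p ∈ P, j₂ ζ ρ ρ s * p ∈ P := by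
    intro k s hs hsP p hp
    refine apply_mem_of_mem_closedMul
      (f := ContinuousLinearMap.mul ℂ (BraidedTensor ζ ρ ρ) (j₂ ζ ρ ρ s)) hPc ?_ hp
    rintro _ ⟨c, rfl⟩ _ ⟨b, rfl⟩
    change j₂ ζ ρ ρ s * (j₁ ζ ρ ρ c * comul hρ b) ∈ P
    rw [← mul_assoc, j₂_mul_j₁_right hs, mul_assoc]
    exact mul_mem_closedMul_left (mul_mem_range _ _)
      (mul_mem_closedMul_right (mul_mem_range' _ _) hsP)
  have hdense : (Submodule.span ℂ {s : FreeUnitary F ζ d |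
      j₂ ζ ρ ρ s ∈ P}).topologicalClosure = ⊤ := by
    refine dense_span_of_mul_mem ?_ ?_ ?_
    · rw [Set.mem_ofPred_eq, map_one, ← one_mul 1]
      exact mul_mem_closedMul ⟨1, map_one _⟩ ⟨1, map_one _⟩
    · intro i j s hs
      rw [Set.mem_ofPred_eq, map_mul]
      exact hmul _ _ (hρ i j) (hu i j) _ hs
    · intro i j s hs
      rw [Set.mem_ofPred_eq, map_mul]
      exact hmul _ _ (hρ i j).star (hu' i j) _ hs
  have hall : ∀ a, j₂ ζ ρ ρ a ∈ P :=
    ContinuousLinearMap.apply_mem_of_dense_span hdense (f := (j₂ ζ ρ ρ).toCLM) hPc fun s hs => hs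
  refine eq_top_iff.2 fun a _ => ?_
  refine ContinuousLinearMap.apply_mem_of_dense_span (dense_span ζ ρ ρ)
    (f := ContinuousLinearMap.id ℂ _) hPc ?_ a
  rintro _ ⟨x, y, rfl⟩
  exact mul_mem_closedMul_left (mul_mem_range _ _) (hall y)

theorem isBraidedCompactQuantumGroup_comul : IsBraidedCompactQuantumGroup ζ ρ (comul hρ) := by
  have hid : ρ.IsEquivariant ρ (StarAlgHom.id ℂ (FreeUnitary F ζ d)) := fun _ _ => rfl
  obtain ⟨α, hα⟩ := exists_associator (ζ := ζ) (ρX := ρ) (ρY := ρ) (ρZ := ρ)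
    isCoaction_coaction isCoaction_coaction
  exact ⟨BraidedTensor.coaction ζ ρ ρ, isCoaction_coaction, isEquivariant_comul hρ,
    ⟨_, _, α, isMap_map (isEquivariant_comul hρ) hid, isMap_map hid (isEquivariant_comul hρ), hα,
      coassoc_comul hρ hα hid⟩,
    closedMul_comul_j₂ hρ,
    -- Taking adjoints turns `j₁(A) Δ(A)` into `Δ(A) j₁(A)`.
    closedMul_swap_eq_top (star_mem_range _) (star_mem_range _) (closedMul_j₁_comul hρ)⟩

end comultiplication

end FreeUnitary

end

/-! ### The braided free unitary quantum group -/

theorem mainTheorem2 {n : ℕ} (F : Matrix.GeneralLinearGroup (Fin n) ℂ) (d d' : Fin n → ℤ)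
    (d₀ : ℤ) (hF : FreeUnitary.IsAdmissible F d d' d₀) (ζ : Circle) :
    (FreeUnitary.u F ζ d ∈ unitary (Matrix (Fin n) (Fin n) (FreeUnitary F ζ d)) ∧
      FreeUnitary.twistedConj F ζ d (FreeUnitary.u F ζ d) ∈
        unitary (Matrix (Fin n) (Fin n) (FreeUnitary F ζ d)) ∧
      ∀ (B : Type*) [CStarAlgebra B] (v : Matrix (Fin n) (Fin n) B),
        v ∈ unitary (Matrix (Fin n) (Fin n) B) →
        FreeUnitary.twistedConj F ζ d v ∈ unitary (Matrix (Fin n) (Fin n) B) →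
        ∃! φ : FreeUnitary F ζ d →⋆ₐ[ℂ] B, ∀ i j, φ (FreeUnitary.u F ζ d i j) = v i j) ∧
    ∃ ρ : CircleCoaction (FreeUnitary F ζ d),
      (∀ i j, ρ.IsHomogeneous (d j - d i) (FreeUnitary.u F ζ d i j)) ∧
      (∀ ρ' : FreeUnitary F ζ d →⋆ₐ[ℂ] C(Circle, FreeUnitary F ζ d),
        (∀ i j z, ρ' (FreeUnitary.u F ζ d i j) z =
          ((z ^ (d j - d i) : Circle) : ℂ) • FreeUnitary.u F ζ d i j) → ρ' = ρ.toHom) ∧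
      ∃ Δ : FreeUnitary F ζ d →⋆ₐ[ℂ] BraidedTensor ζ ρ ρ,
        (∀ i j, Δ (FreeUnitary.u F ζ d i j) = ∑ k,
          BraidedTensor.j₁ ζ ρ ρ (FreeUnitary.u F ζ d i k) *
            BraidedTensor.j₂ ζ ρ ρ (FreeUnitary.u F ζ d k j)) ∧
        (∀ Δ' : FreeUnitary F ζ d →⋆ₐ[ℂ] BraidedTensor ζ ρ ρ,
          (∀ i j, Δ' (FreeUnitary.u F ζ d i j) = ∑ k,
            BraidedTensor.j₁ ζ ρ ρ (FreeUnitary.u F ζ d i k) *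
              BraidedTensor.j₂ ζ ρ ρ (FreeUnitary.u F ζ d k j)) → Δ' = Δ) ∧
        IsBraidedCompactQuantumGroup ζ ρ Δ := by
  refine ⟨⟨FreeUnitary.u_mem_unitary F ζ d, FreeUnitary.twistedConj_u_mem_unitary F ζ d,
    fun B _ v h1 h2 => ⟨FreeUnitary.lift v h1 h2, FreeUnitary.lift_u v h1 h2, fun φ hφ =>
      FreeUnitary.hom_ext fun i j => (hφ i j).trans (FreeUnitary.lift_u v h1 h2 i j).symm⟩⟩,
    FreeUnitary.coaction hF ζ, FreeUnitary.isHomogeneous_u hF,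
    fun ρ' h => FreeUnitary.hom_ext fun i j => ContinuousMap.ext fun z =>
      (h i j z).trans (FreeUnitary.isHomogeneous_u hF i j z).symm,
    FreeUnitary.comul (FreeUnitary.isHomogeneous_u hF), FreeUnitary.comul_u _,
    fun Δ' h => FreeUnitary.hom_ext fun i j => (h i j).trans (FreeUnitary.comul_u _ i j).symm,
    FreeUnitary.isBraidedCompactQuantumGroup_comul _⟩
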